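/- Let $S$ be a finite nonempty set with all subsets measurable, let $\lambda_S$ be the equidistribution on $S$, and let $z>0$. Particles are elements $y=(x,\sigma)$ of $\mathbb R^2\times S$, with reference measure $dy=dx\otimes\lambda_S$. A configuration is a set $Y\subset\mathbb R^2\times S$ having only finitely many particles with position in any bounded set; the configuration space $\mathcal Y$ carries the $\sigma$-algebra generated by the counting variables $Y\mapsto\#(Y\cap A)$, $A\subset\mathbb R^2\times S$ measurable. For $\Lambda\subset\mathbb R^2$ write $Y_\Lambda=Y\cap(\Lambda\times S)$. Let $|\cdot|_h$ be a norm on $\mathbb R^2$ and let $\phi_{\sigma_1\sigma_2}=\phi_{\sigma_2\sigma_1}:[0,\infty)\to[0,\infty]$ ($\sigma_1,\sigma_2\in S$) be measurable functions. Assume that each $\phi=\phi_{\sigma_1\sigma_2}$ is well behaved: there are $n\ge 0$ and $0\le r_0<\dots<r_n$ such that $\phi(r)=\infty$ for $r<r_0$, $\phi(r)=0$ for $r>r_n$, $\phi$ is continuous on every interval $(r_i,r_{i+1})$, and at each of the points $r_1,\dots,r_n$ the left and right limits of $\phi$ exist (continuity and limits in $[0,\infty]$). Let $U(x_1,\sigma_1,x_2,\sigma_2)=\phi_{\sigma_1\sigma_2}(|x_1-x_2|_h)$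 be the corresponding Potts-type potential. For bounded Borel $\Lambda\subset\mathbb R^2$ let $\nu_\Lambda(\cdot\,|\bar Y)$ be the law of $Y\cup\bar Y_{\Lambda^c}$, where $Y$ is a Poisson point process in $\Lambda\times S$ with intensity measure $dy$; let $H_\Lambda(Y)$ be the sum of $U(y_1,y_2)$ over all unordered pairs of distinct particles $y_1,y_2\in Y$ at least one of which lies in $\Lambda\times S$; and let $$\gamma_\Lambda(A|\bar Y)=\frac{1}{Z_\Lambda(\bar Y)}\int_A e^{-H_\Lambda(Y)}z^{\#Y_\Lambda}\,\nu_\Lambda(dY|\bar Y),\qquad Z_\Lambda(\bar Y)=\int e^{-H_\Lambda(Y)}z^{\#Y_\Lambda}\,\nu_\Lambda(dY|\bar Y).$$ A Gibbs measure for $U$ and $z$ is a probability measure $\mu$ on $\mathcal Y$ such that for all bounded Borel $\Lambda\subset\mathbb R^2$ and all measurable $A\subset\mathcal Y$, the conditional probability of $A$ under $\mu$ given the $\sigma$-algebra generated by $Y\mapsto Y_{\Lambda^c}$ equals $\gamma_\Lambda(A|\cdot)$ $\mu$-almost surely. Then every Gibbs measure $\mu$ for $U$ and $z$ is translation invariant: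 for every $v\in\mathbb R^2$, the image of $\mu$ under the map $Y\mapsto\{(x+v,\sigma):(x,\sigma)\in Y\}$ equals $\mu$. -/

import Mathlib

open MeasureTheory Set Filter Topology
open scoped ENNReal NNReal

noncomputable section

namespace GibbsParticles

/-- The state space of a particle: a position in the plane and a spin. -/
abbrev Particle (S : Type*) : Type _ := (ℝ × ℝ) × S

/-- The reference measure on particles: Lebesgue measure on positions times the
equidistribution on the finite spin space. -/
def refMeasure (S : Type*) [MeasurableSpace S] : Measure (Particle S) :=
  (volume : Measure (ℝ × ℝ)).prod (ProbabilityTheory.uniformOn (univ : Set S))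

/-- The set of particles with position in `Λ`. -/
def cyl (S : Type*) (Λ : Set (ℝ × ℝ)) : Set (Particle S) := {y | y.1 ∈ Λ}

/-- The configuration space: all locally finite sets of particles. -/
def Config (S : Type*) : Type _ :=
  {Y : Set (Particle S) // ∀ Λ : Set (ℝ × ℝ), Bornology.IsBounded Λ → (Y ∩ cyl S Λ).Finite}

namespace Config

variable {S : Type*}

/-- The number of particles of a configuration in a set of particles. -/
def count (A : Set (Particle S)) (Y : Config S) : ℕ∞ := (Y.1 ∩ A).encard

/-- The σ-algebra on configurations generated by the counting variables of measurable sets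
(the countable set `ℕ∞` of values carries the σ-algebra of all subsets). -/
instance instMeasurableSpace [MeasurableSpace S] : MeasurableSpace (Config S) :=
  ⨆ (A : Set (Particle S)) (_ : MeasurableSet A), MeasurableSpace.comap (count A) ⊤

/-- The restriction of a configuration to the particles with position in `Λ`. -/
def restrict (Λ : Set (ℝ × ℝ)) (Y : Config S) : Config S :=
  ⟨Y.1 ∩ cyl S Λ, fun Δ hΔ => (Y.2 Δ hΔ).subset
    (inter_subset_inter_left _ inter_subset_left)⟩

/-- The superposition of two configurations. -/
def union (Y Y' : Config S) : Config S :=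
  ⟨Y.1 ∪ Y'.1, fun Δ hΔ => by
    rw [union_inter_distrib_right]
    exact (Y.2 Δ hΔ).union (Y'.2 Δ hΔ)⟩

/-- The finite configuration `{y₁, …, y_k}`. -/
def ofTuple {k : ℕ} (y : Fin k → Particle S) : Config S :=
  ⟨range y, fun _ _ => (finite_range y).subset inter_subset_left⟩

/-- The configuration in which every particle is translated by `v`. -/
def translate (v : ℝ × ℝ) (Y : Config S) : Config S :=
  ⟨(fun y : Particle S => (y.1 + v, y.2)) '' Y.1, fun Δ hΔ => by
    have hb : Bornology.IsBounded ((fun x : ℝ × ℝ => x - v) '' Δ) := by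
      obtain ⟨C, hC⟩ := hΔ.exists_norm_le
      refine isBounded_iff_forall_norm_le.2 ⟨C + ‖v‖, ?_⟩
      rintro _ ⟨x, hx, rfl⟩
      exact (norm_sub_le _ _).trans (by gcongr; exact hC x hx)
    refine ((Y.2 _ hb).image (fun y : Particle S => (y.1 + v, y.2))).subset ?_
    rintro _ ⟨⟨y, hy, rfl⟩, hΔ'⟩
    exact ⟨y, ⟨hy, y.1 + v, hΔ', by simp⟩, rfl⟩⟩

section Measurability

variable [MeasurableSpace S]

theorem measurable_count {A : Set (Particle S)} (hA : MeasurableSet A) :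
    Measurable[_, ⊤] (count A) :=
  Measurable.of_comap_le (le_iSup₂_of_le A hA le_rfl)

theorem measurable_of_count {T : Type*} {m : MeasurableSpace T} {f : T → Config S}
    (h : ∀ A : Set (Particle S), MeasurableSet A →
      @Measurable T ℕ∞ m ⊤ (fun t => count A (f t))) : Measurable f := by
  refine Measurable.of_le_map ?_
  refine iSup₂_le fun A hA => ?_
  rintro _ ⟨B, hB, rfl⟩
  exact h A hA hB

theorem measurable_restrict {Λ : Set (ℝ × ℝ)} (hΛ : MeasurableSet Λ) :
    Measurable (restrict (S := S) Λ) := by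
  refine measurable_of_count fun A hA => ?_
  have hm : MeasurableSet (cyl S Λ ∩ A) := (measurable_fst hΛ).inter hA
  have : (fun Y : Config S => count A (restrict Λ Y)) = count (cyl S Λ ∩ A) := by
    funext Y
    simp only [count, restrict, inter_assoc]
  rw [this]
  exact measurable_count hm

theorem measurable_glue {Λ : Set (ℝ × ℝ)} (hΛ : MeasurableSet Λ) (Ybar : Config S) :
    Measurable (fun Y : Config S => (Y.restrict Λ).union (Ybar.restrict Λᶜ)) := by
  refine measurable_of_count fun A hA => ?_
  have hm : MeasurableSet (cyl S Λ ∩ A) := (measurable_fst hΛ).inter hA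
  have : (fun Y : Config S => count A ((Y.restrict Λ).union (Ybar.restrict Λᶜ))) =
      (fun n : ℕ∞ => n + count A (Ybar.restrict Λᶜ)) ∘ count (cyl S Λ ∩ A) := by
    funext Y
    simp only [count, restrict, union, Function.comp, union_inter_distrib_right]
    rw [encard_union_eq, inter_assoc]
    refine disjoint_left.2 ?_
    rintro y ⟨⟨_, h1⟩, _⟩ ⟨⟨_, h2⟩, _⟩
    exact h2 h1
  rw [this]
  exact Measurable.comp (fun _ _ => trivial) (measurable_count hm)

theorem measurable_translate (v : ℝ × ℝ) : Measurable (translate (S := S) v) := by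
  refine measurable_of_count fun A hA => ?_
  have hf : Measurable (fun y : Particle S => ((y.1 + v, y.2) : Particle S)) := by fun_prop
  have : (fun Y : Config S => count A (translate v Y)) =
      count ((fun y : Particle S => ((y.1 + v, y.2) : Particle S)) ⁻¹' A) := by
    funext Y
    simp only [count, translate]
    rw [← image_inter_preimage, Function.Injective.encard_image]
    rintro ⟨x, s⟩ ⟨x', s'⟩ h
    simpa using h
  rw [this]
  exact measurable_count (hf hA)

theorem measurable_ofTuple [Countable S] [MeasurableSingletonClass S] {k : ℕ} :
    Measurable (ofTuple (S := S) (k := k)) := by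
  refine measurable_of_count fun A hA => ?_
  let T : (Fin k → Particle S) → Set (Fin k) :=
    fun y => {i | y i ∈ A ∧ ∀ j < i, y j ≠ y i}
  have heq : ∀ i j, MeasurableSet {y : Fin k → Particle S | y i = y j} := by
    intro i j
    have : {y : Fin k → Particle S | y i = y j} =
        {y | (y i).1 = (y j).1} ∩ ⋃ s : S, {y | (y i).2 = s} ∩ {y | (y j).2 = s} := by
      ext y
      simp [Prod.ext_iff, eq_comm]
    rw [this]
    refine (measurableSet_eq_fun (by fun_prop) (by fun_prop)).inter
      (MeasurableSet.iUnion fun s => ?_)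
    have h2 : ∀ l : Fin k, Measurable fun y : Fin k → Particle S => (y l).2 := fun l => by
      fun_prop
    exact (h2 i (measurableSet_singleton s)).inter (h2 j (measurableSet_singleton s))
  have hT : Measurable T := by
    refine measurable_set_iff.2 fun i => measurableSet_setOfPred.1 ?_
    have : {y : Fin k → Particle S | i ∈ T y} =
        (fun y => y i) ⁻¹' A ∩ ⋂ j : Fin k, {y | j < i → y j ≠ y i} := by
      ext y
      simp [T]
    rw [this]
    refine (measurable_pi_apply i hA).inter (MeasurableSet.iInter fun j => ?_)
    by_cases hj : j < i
    · simp only [hj, forall_const]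
      exact (heq j i).compl
    · simp [hj]
  have : (fun y : Fin k → Particle S => count A (ofTuple y)) = encard ∘ T := by
    classical
    funext y
    have him : range y ∩ A = y '' T y := by
      ext p
      constructor
      · rintro ⟨⟨i, rfl⟩, hiA⟩
        have hne : (Finset.univ.filter fun j => y j = y i).Nonempty := ⟨i, by simp⟩
        have hmin := Finset.min'_mem _ hne
        simp only [Finset.mem_filter, Finset.mem_univ, true_and] at hmin
        refine ⟨_, ⟨by rw [hmin]; exact hiA, fun j hj hjy => ?_⟩, hmin⟩
        exact absurd (Finset.min'_le (Finset.univ.filter fun j => y j = y i) j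
          (by simp [hjy, hmin])) (not_le.2 hj)
      · rintro ⟨i, hi, rfl⟩
        exact ⟨⟨i, rfl⟩, hi.1⟩
    have hinj : InjOn y (T y) := by
      intro i hi j hj hij
      rcases lt_trichotomy i j with hlt | heq' | hlt
      · exact absurd hij (hj.2 i hlt)
      · exact heq'
      · exact absurd hij.symm (hi.2 j hlt)
    simp only [count, ofTuple, Function.comp, him]
    exact hinj.encard_image
  rw [this]
  intro B _
  exact hT (t := encard ⁻¹' B) (Set.toFinite _).measurableSet

end Measurability

end Config

/-- The law of the Poisson point process in a bounded Borel set `Λ`, with intensity the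
reference measure: `e^{-λ(Λ)} ∑ₖ (1/k!) ∫_{Λᵏ} 1{ {y₁,…,y_k} ∈ · } dy₁ … dy_k`. -/
def poisson (S : Type*) [MeasurableSpace S] (Λ : Set (ℝ × ℝ)) : Measure (Config S) :=
  ENNReal.ofReal (Real.exp (-(volume Λ).toReal)) •
    Measure.sum fun k : ℕ => (Nat.factorial k : ℝ≥0∞)⁻¹ •
      (Measure.pi fun _ : Fin k => (refMeasure S).restrict (cyl S Λ)).map Config.ofTuple

variable {S : Type*}

/-- The law of the Poisson point process in `Λ` with boundary condition `Ybar`. -/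
def poissonBC [MeasurableSpace S] (Λ : Set (ℝ × ℝ)) (Ybar : Config S) : Measure (Config S) :=
  (poisson S Λ).map fun Y => (Y.restrict Λ).union (Ybar.restrict Λᶜ)

/-- The energy of a configuration for a nonnegative symmetric pair potential `U`: the sum of `U`
over unordered pairs of distinct particles, i.e. half the sum over ordered pairs. -/
def energy (U : Particle S → Particle S → ℝ≥0∞) (Y : Config S) : ℝ≥0∞ :=
  2⁻¹ * ∑' (y₁ : Y.1) (y₂ : Y.1), ({y | y ≠ y₁.1} : Set (Particle S)).indicator (U y₁) y₂

/-- The interaction energy between two configurations. -/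
def interaction (U : Particle S → Particle S → ℝ≥0∞) (Y Y' : Config S) : ℝ≥0∞ :=
  ∑' (y₁ : Y.1) (y₂ : Y'.1), U y₁ y₂

/-- The Hamiltonian of a configuration in `Λ`. -/
def hamiltonian (U : Particle S → Particle S → ℝ≥0∞) (Λ : Set (ℝ × ℝ)) (Y : Config S) : ℝ≥0∞ :=
  energy U (Y.restrict Λ) + interaction U (Y.restrict Λ) (Y.restrict Λᶜ)

/-- The weight `e^{-H_Λ(Y)} z^{#Y_Λ}`, with `e^{-∞} = 0`. -/
def weight (U : Particle S → Particle S → ℝ≥0∞) (z : ℝ) (Λ : Set (ℝ × ℝ)) (Y : Config S) :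
    ℝ≥0∞ :=
  EReal.exp (-(hamiltonian U Λ Y : EReal)) * ENNReal.ofReal z ^ (Y.restrict Λ).1.ncard

/-- The partition function in `Λ` with boundary condition `Ybar`. -/
def partitionFunction [MeasurableSpace S] (U : Particle S → Particle S → ℝ≥0∞) (z : ℝ)
    (Λ : Set (ℝ × ℝ)) (Ybar : Config S) : ℝ≥0∞ :=
  ∫⁻ Y, weight U z Λ Y ∂(poissonBC Λ Ybar)

/-- The conditional Gibbs distribution in `Λ` with boundary condition `Ybar`. -/
def gibbsKernel [MeasurableSpace S] (U : Particle S → Particle S → ℝ≥0∞) (z : ℝ)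
    (Λ : Set (ℝ × ℝ)) (Ybar : Config S) (A : Set (Config S)) : ℝ≥0∞ :=
  (partitionFunction U z Λ Ybar)⁻¹ * ∫⁻ Y, A.indicator (weight U z Λ) Y ∂(poissonBC Λ Ybar)

/-- The σ-algebra of the events that only depend on the particles in `Δ`. -/
@[reducible] def eventsIn (S : Type*) [MeasurableSpace S] (Δ : Set (ℝ × ℝ)) : MeasurableSpace (Config S) :=
  MeasurableSpace.comap (Config.restrict Δ) Config.instMeasurableSpace

theorem eventsIn_le [MeasurableSpace S] {Δ : Set (ℝ × ℝ)} (hΔ : MeasurableSet Δ) :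
    eventsIn S Δ ≤ Config.instMeasurableSpace :=
  (Config.measurable_restrict hΔ).comap_le

/-- `μ` is a Gibbs measure for the nonnegative pair potential `U` and the activity `z`: it is a
probability measure on configurations, and for every bounded Borel set `Λ` the conditional
probabilities given the configuration outside `Λ` are the conditional Gibbs distributions. -/
def IsGibbsMeasure [MeasurableSpace S] (U : Particle S → Particle S → ℝ≥0∞) (z : ℝ)
    (μ : Measure (Config S)) : Prop :=
  IsProbabilityMeasure μ ∧
    ∀ Λ : Set (ℝ × ℝ), MeasurableSet Λ → Bornology.IsBounded Λ →
      ∀ A : Set (Config S), MeasurableSet A →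
        μ[A.indicator (fun _ => (1 : ℝ)) | eventsIn S Λᶜ] =ᵐ[μ]
          fun Ybar => (gibbsKernel U z Λ Ybar A).toReal

/-- The Potts type potential `U(x₁,σ₁,x₂,σ₂) = φ_{σ₁σ₂}(|x₁ - x₂|)` for the norm `h`. -/
def pottsPotential (h : Seminorm ℝ (ℝ × ℝ)) (φ : S → S → ℝ≥0 → ℝ≥0∞) :
    Particle S → Particle S → ℝ≥0∞ :=
  fun y₁ y₂ => φ y₁.2 y₂.2 ⟨h (y₁.1 - y₂.1), apply_nonneg h _⟩

/-- Well behaved functions `φ : [0,∞) → [0,∞]`. Continuity and one-sided limits are understood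
in `[0,∞]`; nothing is required of `φ` at the points `r₀, …, r_n` themselves or of its
behaviour near `r₀`. -/
def WellBehaved (φ : ℝ≥0 → ℝ≥0∞) : Prop :=
  ∃ (n : ℕ) (r : Fin (n + 1) → ℝ≥0), StrictMono r ∧
    (∀ t, t < r 0 → φ t = ⊤) ∧
    (∀ t, r (Fin.last n) < t → φ t = 0) ∧
    (∀ i : Fin n, ContinuousOn φ (Ioo (r i.castSucc) (r i.succ))) ∧
    ∀ i : Fin n, (∃ l : ℝ≥0∞, Tendsto φ (𝓝[<] (r i.succ)) (𝓝 l)) ∧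
      ∃ l : ℝ≥0∞, Tendsto φ (𝓝[>] (r i.succ)) (𝓝 l)

end GibbsParticles

end

/-!
Write each Boltzmann factor `exp (-U)` as a soft part plus a remainder. The soft part is a square
`q²` whose second differences satisfy `q(x)² - q(x + s) q(x - s) ≤ C ‖s‖²`, and the remainder has
so small an integral that, multiplied by the activity, it is at most `1/2`. Expanding the product
of all Boltzmann factors over sets of bonds, the remainders become weights of bonds, and the
particles fall into clusters joined by bonds. Move every cluster rigidly by `τ(x) w`, where `x` is
the position of a representative of the cluster and `τ` is a logarithmic cutoff, equal to `1` on a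
given ball and to `0` near the boundary of a large box. The geometric mean of the weights after the
moves by `τ w` and by `-τ w` differs from the original weight only to second order in `τ`: the
first order changes of the soft factors and of the volume elements cancel. The losses are sums over
pairs of particles joined by paths of bonds, which decay geometrically in the length of the path by
the bound on the remainders; they are small because the Dirichlet energy of a logarithmic cutoff
tends to `0` in dimension two. Hence `μ A ≤ (μ (A - w) + μ (A + w)) / 2` for every local event `A`,
so that `k ↦ μ (A + k w)` is a bounded midpoint convex sequence and thus constant.
-/

noncomputable section

open ProbabilityTheory

namespace GibbsParticles

section Pairs

variable {ι P β : Type*}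

/-- The unordered pairs of distinct indices. -/
def edges (ι : Type*) [Fintype ι] [DecidableEq ι] : Finset (Sym2 ι) :=
  Finset.univ.filter fun p => ¬ p.IsDiag

theorem mk_mem_edges [Fintype ι] [DecidableEq ι] {i j : ι} : s(i, j) ∈ edges ι ↔ i ≠ j := by
  simp [edges]

/-- The value of a pair function at an unordered pair of entries of a tuple. The pair is ordered by
an arbitrary choice, so that no proof of symmetry is needed; see `pairVal_mk`. -/
def pairVal (u : P → P → β) (y : ι → P) (p : Sym2 ι) : β :=
  u (y (Quot.out p).1) (y (Quot.out p).2)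

theorem pairVal_mk {u : P → P → β} (hu : ∀ a b, u a b = u b a) (y : ι → P) (i j : ι) :
    pairVal u y s(i, j) = u (y i) (y j) := by
  have h : s((Quot.out s(i, j)).1, (Quot.out s(i, j)).2) = s(i, j) := Quot.out_eq s(i, j)
  rcases Sym2.eq_iff.1 h with ⟨h₁, h₂⟩ | ⟨h₁, h₂⟩
  · simp only [pairVal, h₁, h₂]
  · simp only [pairVal, h₁, h₂, hu (y j)]

theorem measurable_pairVal [MeasurableSpace P] [MeasurableSpace β] {u : P → P → β}
    (hu : Measurable (Function.uncurry u)) (p : Sym2 ι) :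
    Measurable fun y : ι → P => pairVal u y p :=
  hu.comp (f := fun y : ι → P => (y (Quot.out p).1, y (Quot.out p).2)) (by fun_prop)

/-- The product of a pair function over all pairs of entries of a tuple. -/
def pairProd [Fintype ι] [DecidableEq ι] (u : P → P → ℝ≥0∞) (y : ι → P) : ℝ≥0∞ :=
  ∏ p ∈ edges ι, pairVal u y p

/-- The Boltzmann weight of a tuple, for the one-particle weight `b` and the pair weight `e`. -/
def tupleWeight [Fintype ι] [DecidableEq ι] (b : P → ℝ≥0∞) (e : P → P → ℝ≥0∞) (y : ι → P) :
    ℝ≥0∞ :=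
  (∏ i, b (y i)) * pairProd e y

theorem measurable_tupleWeight [Fintype ι] [DecidableEq ι] [MeasurableSpace P] {b : P → ℝ≥0∞}
    {e : P → P → ℝ≥0∞} (hb : Measurable b) (he : Measurable (Function.uncurry e)) :
    Measurable fun y : ι → P => tupleWeight b e y :=
  (Finset.measurable_prod _ fun i _ => hb.comp (measurable_pi_apply i)).mul
    (Finset.measurable_prod _ fun p _ => measurable_pairVal he p)

end Pairs

theorem sum_powerset_filter_subset_prod_mul_prod {α R : Type*} [DecidableEq α] [CommSemiring R]
    {s t : Finset α} (hts : t ⊆ s) (f g : α → R) :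
    ∑ B ∈ s.powerset with t ⊆ B, (∏ p ∈ B, f p) * ∏ p ∈ s \ B, g p =
      (∏ p ∈ t, f p) * ∏ p ∈ s \ t, (f p + g p) := by
  -- Replacing `g` by zero on `t` removes the subsets that do not contain `t`.
  let g' : α → R := fun p => if p ∈ t then 0 else g p
  have hprod : ∏ p ∈ s, (f p + g' p) = (∏ p ∈ t, f p) * ∏ p ∈ s \ t, (f p + g p) := by
    rw [← Finset.prod_sdiff hts, mul_comm]
    congr 1
    · exact Finset.prod_congr rfl fun p hp => by simp [g', hp]
    · exact Finset.prod_congr rfl fun p hp => by simp [g', (Finset.mem_sdiff.1 hp).2]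
  rw [← hprod, Finset.prod_add, Finset.sum_filter]
  refine Finset.sum_congr rfl fun B _ => ?_
  split_ifs with htB
  · congr 1
    refine Finset.prod_congr rfl fun p hp => ?_
    exact (if_neg fun hpt => (Finset.mem_sdiff.1 hp).2 (htB hpt)).symm
  · obtain ⟨p, hpt, hpB⟩ := Finset.not_subset.1 htB
    have hp : p ∈ s \ B := Finset.mem_sdiff.2 ⟨hts hpt, hpB⟩
    have hzero : ∏ p ∈ s \ B, g' p = 0 := Finset.prod_eq_zero hp (if_pos hpt)
    rw [hzero, mul_zero]

section ProductMeasures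

variable {P : Type*} [MeasurableSpace P] (ref : Measure P) [SigmaFinite ref]

theorem lintegral_pi_sumEquiv {ι κ ω : Type*} [Fintype ι] [Fintype κ] [Fintype ω]
    (σ : ι ⊕ κ ≃ ω) {F : (ι → P) → ℝ≥0∞} {G : (κ → P) → ℝ≥0∞}
    (hF : Measurable F) (hG : Measurable G) :
    ∫⁻ y, F (fun i => y (σ (.inl i))) * G (fun j => y (σ (.inr j)))
        ∂(Measure.pi fun _ : ω => ref) =
      (∫⁻ y, F y ∂(Measure.pi fun _ : ι => ref)) * ∫⁻ y, G y ∂(Measure.pi fun _ : κ => ref) := by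
  have hT : MeasurePreserving
      (fun (p : (ι → P) × (κ → P)) (a : ω) => Sum.elim p.1 p.2 (σ.symm a))
      ((Measure.pi fun _ : ι => ref).prod (Measure.pi fun _ : κ => ref))
      (Measure.pi fun _ : ω => ref) := by
    convert (measurePreserving_piCongrLeft (fun _ : ω => ref) σ).comp
      (measurePreserving_sumPiEquivProdPi_symm fun _ : ι ⊕ κ => ref) using 1
    funext p a
    obtain ⟨b, rfl⟩ := σ.surjective a
    rw [Function.comp_apply, MeasurableEquiv.coe_piCongrLeft, Equiv.piCongrLeft_apply_apply,
      Equiv.symm_apply_apply]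
    cases b <;> rfl
  rw [← hT.lintegral_comp (by fun_prop), ← lintegral_prod_mul hF.aemeasurable hG.aemeasurable]
  simp only [Equiv.symm_apply_apply, Sum.elim_inl, Sum.elim_inr]

theorem lintegral_pi_fin_snoc {l : ℕ} {f : (Fin (l + 1) → P) → ℝ≥0∞} (hf : Measurable f) :
    ∫⁻ y, f y ∂(Measure.pi fun _ : Fin (l + 1) => ref) =
      ∫⁻ y, ∫⁻ x, f (Fin.snoc (α := fun _ => P) y x) ∂ref ∂(Measure.pi fun _ : Fin l => ref) := by
  have hmp := (measurePreserving_piFinSuccAbove (fun _ : Fin (l + 1) => ref) (Fin.last l)).symm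
  rw [← hmp.lintegral_comp hf]
  refine (lintegral_prod_symm _ (hf.comp hmp.measurable).aemeasurable).trans ?_
  simp [MeasurableEquiv.piFinSuccAbove, Fin.insertNthEquiv, Fin.insertNth_last']

theorem lintegral_pi_chain_le {l : ℕ} {F : P → ℝ≥0∞} (hF : Measurable F)
    (κ : ℕ → P → P → ℝ≥0∞) (hκ : ∀ a, Measurable (Function.uncurry (κ a))) (c : ℕ → ℝ≥0∞)
    (hc : ∀ a y, ∫⁻ y', κ a y y' ∂ref ≤ c a) :
    ∫⁻ y, F (y 0) * ∏ a : Fin l, κ a (y a.castSucc) (y a.succ)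
        ∂(Measure.pi fun _ : Fin (l + 1) => ref) ≤
      (∫⁻ y, F y ∂ref) * ∏ a : Fin l, c a := by
  have hmeas : ∀ n, Measurable fun y : Fin (n + 1) → P =>
      F (y 0) * ∏ a : Fin n, κ a (y a.castSucc) (y a.succ) := fun n =>
    (hF.comp (measurable_pi_apply 0)).mul <| Finset.measurable_prod _ fun a _ =>
      (hκ a).comp (f := fun y : Fin (n + 1) → P => (y a.castSucc, y a.succ)) (by fun_prop)
  induction l with
  | zero =>
    simp only [Finset.univ_eq_empty, Finset.prod_empty, mul_one]
    exact ((measurePreserving_funUnique ref (Fin 1)).lintegral_comp hF).le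
  | succ l ih =>
    calc _ = ∫⁻ y, ∫⁻ x, (F (y 0) * ∏ a : Fin l, κ a (y a.castSucc) (y a.succ)) *
          κ l (y (Fin.last l)) x ∂ref ∂(Measure.pi fun _ : Fin (l + 1) => ref) := by
          rw [lintegral_pi_fin_snoc ref (hmeas _)]
          refine lintegral_congr fun y => lintegral_congr fun x => ?_
          simp only [Fin.prod_univ_castSucc, ← Fin.castSucc_zero (n := l + 1), Fin.snoc_castSucc,
            Fin.succ_castSucc, Fin.succ_last, Fin.snoc_last, Fin.val_castSucc, Fin.val_last,
            mul_assoc]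
      _ ≤ ∫⁻ y, (F (y 0) * ∏ a : Fin l, κ a (y a.castSucc) (y a.succ)) * c l
          ∂(Measure.pi fun _ : Fin (l + 1) => ref) := by
          refine lintegral_mono fun y => ?_
          have hκy : Measurable (κ l (y (Fin.last l))) := (hκ l).comp measurable_prodMk_left
          dsimp only
          rw [lintegral_const_mul _ hκy]
          gcongr
          exact hc _ _
      _ ≤ _ := by
          rw [lintegral_mul_const _ (hmeas l), Fin.prod_univ_castSucc, ← mul_assoc]
          exact mul_le_mul_left ih _

theorem lintegral_pi_fin_prod {n : ℕ} {g : Fin n → P → ℝ≥0∞} (hg : ∀ i, Measurable (g i)) :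
    ∫⁻ y, ∏ i, g i (y i) ∂(Measure.pi fun _ : Fin n => ref) = ∏ i, ∫⁻ x, g i x ∂ref := by
  induction n with
  | zero => simp
  | succ n ih =>
    have hinit : Measurable fun y : Fin n → P => ∏ i : Fin n, g i.castSucc (y i) := by fun_prop
    rw [lintegral_pi_fin_snoc ref (by fun_prop), Fin.prod_univ_castSucc,
      ← ih fun i => hg i.castSucc, ← lintegral_mul_const _ hinit]
    refine lintegral_congr fun y => ?_
    simp only [Fin.prod_univ_castSucc, Fin.snoc_castSucc, Fin.snoc_last]
    exact lintegral_const_mul _ (hg _)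

variable {ι : Type*} [Fintype ι]

theorem lintegral_pi_prod {g : ι → P → ℝ≥0∞} (hg : ∀ i, Measurable (g i)) :
    ∫⁻ y, ∏ i, g i (y i) ∂(Measure.pi fun _ : ι => ref) = ∏ i, ∫⁻ x, g i x ∂ref := by
  let σ := (Fintype.equivFin ι).symm
  have hmp := measurePreserving_piCongrLeft (fun _ : ι => ref) σ
  rw [← hmp.lintegral_comp (by fun_prop), ← σ.prod_comp,
    ← lintegral_pi_fin_prod ref fun i => hg (σ i)]
  refine lintegral_congr fun y => ?_
  rw [← σ.prod_comp]
  refine Finset.prod_congr rfl fun i _ => ?_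
  rw [MeasurableEquiv.coe_piCongrLeft, Equiv.piCongrLeft_apply_apply]

theorem pi_withDensity {g : ι → P → ℝ≥0∞} (hg : ∀ i, Measurable (g i))
    [∀ i, SigmaFinite (ref.withDensity (g i))] :
    Measure.pi (fun i => ref.withDensity (g i)) =
      (Measure.pi fun _ : ι => ref).withDensity fun y => ∏ i, g i (y i) := by
  refine Measure.pi_eq fun s hs => ?_
  have hind : ∀ y : ι → P, (pi univ s).indicator (fun y => ∏ i, g i (y i)) y =
      ∏ i, (s i).indicator (g i) (y i) := by
    intro y
    by_cases hy : y ∈ pi univ s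
    · rw [indicator_of_mem hy]
      exact Finset.prod_congr rfl fun i _ => (indicator_of_mem (hy i (mem_univ i)) _).symm
    · obtain ⟨i, hi⟩ : ∃ i, y i ∉ s i := by simpa only [mem_univ_pi, not_forall] using hy
      rw [indicator_of_notMem hy,
        Finset.prod_eq_zero (Finset.mem_univ i) (indicator_of_notMem hi _)]
  rw [withDensity_apply _ (MeasurableSet.univ_pi hs),
    ← lintegral_indicator (MeasurableSet.univ_pi hs), lintegral_congr hind,
    lintegral_pi_prod ref fun i => (hg i).indicator (hs i)]
  refine Finset.prod_congr rfl fun i _ => ?_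
  rw [withDensity_apply _ (hs i), lintegral_indicator (hs i)]

end ProductMeasures

section GrandCanonical

variable {P : Type*} [MeasurableSpace P] (ref : Measure P) (z : ℝ≥0∞)

/-- The grand canonical integral, at activity `z`, of a family of functions of tuples. -/
def grandIntegral (F : ∀ k : ℕ, (Fin k → P) → ℝ≥0∞) : ℝ≥0∞ :=
  ∑' k : ℕ, z ^ k * (Nat.factorial k : ℝ≥0∞)⁻¹ * ∫⁻ y, F k y ∂(Measure.pi fun _ : Fin k => ref)

theorem grandIntegral_mono {F G : ∀ k : ℕ, (Fin k → P) → ℝ≥0∞}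
    (h : ∀ k, ∫⁻ y, F k y ∂(Measure.pi fun _ : Fin k => ref) ≤
      ∫⁻ y, G k y ∂(Measure.pi fun _ : Fin k => ref)) :
    grandIntegral ref z F ≤ grandIntegral ref z G :=
  ENNReal.tsum_le_tsum fun k => mul_le_mul_right (h k) _

theorem grandIntegral_add {F G : ∀ k : ℕ, (Fin k → P) → ℝ≥0∞} (hF : ∀ k, Measurable (F k)) :
    grandIntegral ref z (fun k y => F k y + G k y) =
      grandIntegral ref z F + grandIntegral ref z G := by
  unfold grandIntegral
  rw [← ENNReal.tsum_add]
  refine tsum_congr fun k => ?_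
  rw [lintegral_add_left (hF k), mul_add]

theorem grandIntegral_const_mul {F : ∀ k : ℕ, (Fin k → P) → ℝ≥0∞} (hF : ∀ k, Measurable (F k))
    (c : ℝ≥0∞) : grandIntegral ref z (fun k y => c * F k y) = c * grandIntegral ref z F := by
  unfold grandIntegral
  rw [← ENNReal.tsum_mul_left]
  refine tsum_congr fun k => ?_
  rw [lintegral_const_mul _ (hF k)]
  ring

theorem grandIntegral_tsum {F : ℕ → ∀ k : ℕ, (Fin k → P) → ℝ≥0∞} (hF : ∀ l k, Measurable (F l k)) :
    grandIntegral ref z (fun k y => ∑' l, F l k y) = ∑' l, grandIntegral ref z (F l) := by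
  unfold grandIntegral
  rw [ENNReal.tsum_comm]
  refine tsum_congr fun k => ?_
  rw [lintegral_tsum fun l => (hF l k).aemeasurable, ENNReal.tsum_mul_left]

theorem exists_sumEquiv_extending {m n k : ℕ} (hk : m + n = k) (f : Fin m ↪ Fin k) :
    ∃ σ : Fin m ⊕ Fin n ≃ Fin k, ∀ i, σ (.inl i) = f i := by
  classical
  have hc : Fintype.card ↥(range f)ᶜ = Fintype.card (Fin n) := by
    rw [Fintype.card_compl_set, Set.card_range_of_injective f.injective]
    simp only [Fintype.card_fin]
    omega
  exact ⟨((Equiv.ofInjective f f.injective).sumCongr (Fintype.equivOfCardEq hc).symm).trans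
    (Equiv.Set.sumCompl (range f)), fun i => by simp⟩

theorem inv_factorial_mul_descFactorial (n m : ℕ) :
    ((n + m).factorial : ℝ≥0∞)⁻¹ * ((n + m).descFactorial m : ℝ≥0∞) =
      (n.factorial : ℝ≥0∞)⁻¹ := by
  have hfac : ((n + m).factorial : ℝ≥0∞) = n.factorial * (n + m).descFactorial m := by
    rw [← Nat.factorial_mul_descFactorial (Nat.le_add_left m n), Nat.add_sub_cancel]
    push_cast; ring
  have hne : ((n + m).descFactorial m : ℝ≥0∞) ≠ 0 := by
    rw [Nat.cast_ne_zero, Ne, Nat.descFactorial_eq_zero_iff_lt]; omega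
  have htop : ((n + m).descFactorial m : ℝ≥0∞) ≠ ⊤ := ENNReal.natCast_ne_top _
  rw [hfac, ENNReal.mul_inv (Or.inr htop) (Or.inr hne), mul_assoc,
    ENNReal.inv_mul_cancel hne htop, mul_one]

theorem tsum_eq_tsum_add_of_forall_lt_eq_zero (f : ℕ → ℝ≥0∞) (m : ℕ) (hf : ∀ k < m, f k = 0) :
    ∑' k, f k = ∑' n, f (n + m) := by
  rw [← Summable.sum_add_tsum_nat_add' (k := m) ENNReal.summable, Finset.sum_eq_zero, zero_add]
  exact fun k hk => hf k (Finset.mem_range.1 hk)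

section MarkedParticles

variable {ref} [SigmaFinite ref] {m : ℕ} {F : (Fin m → P) → ℝ≥0∞}
  {W : ∀ k : ℕ, (Fin k → P) → ℝ≥0∞} {Θ : ∀ k : ℕ, (Fin m ↪ Fin k) → (Fin k → P) → ℝ≥0∞}

theorem lintegral_sum_embedding_le (hF : Measurable F) (hW : ∀ k, Measurable (W k))
    (hΘm : ∀ k f, Measurable (Θ k f))
    (hΘ : ∀ (n k : ℕ) (f : Fin m ↪ Fin k) (g : Fin n ↪ Fin k),
      (∀ i j, f i ≠ g j) → ∀ y, Θ k f y ≤ F (y ∘ f) * W n (y ∘ g)) (n : ℕ) :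
    ∫⁻ y, ∑ f, Θ (n + m) f y ∂(Measure.pi fun _ : Fin (n + m) => ref) ≤
      ((n + m).descFactorial m : ℝ≥0∞) *
        ((∫⁻ y, F y ∂(Measure.pi fun _ : Fin m => ref)) *
          ∫⁻ y, W n y ∂(Measure.pi fun _ : Fin n => ref)) := by
  rw [lintegral_finsetSum _ fun f _ => hΘm _ f]
  calc _ ≤ ∑ _f : Fin m ↪ Fin (n + m), (∫⁻ y, F y ∂(Measure.pi fun _ : Fin m => ref)) *
        ∫⁻ y, W n y ∂(Measure.pi fun _ : Fin n => ref) := by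
        refine Finset.sum_le_sum fun f _ => ?_
        obtain ⟨σ, hσ⟩ := exists_sumEquiv_extending (add_comm m n) f
        rw [← lintegral_pi_sumEquiv ref σ hF (hW n)]
        refine lintegral_mono fun y => ?_
        simp only [hσ]
        exact hΘ n _ f (Function.Embedding.inr.trans σ.toEmbedding)
          (fun i j h => Sum.inl_ne_inr (σ.injective ((hσ i).trans h))) y
    _ = _ := by
        rw [Finset.sum_const, Finset.card_univ, Fintype.card_embedding_eq]
        simp only [Fintype.card_fin, nsmul_eq_mul]

/-- This is the mechanism of Ruelle's bound on correlation functions: forgetting that the `m` marked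
particles interact with the other ones can only increase the weight. -/
theorem grandIntegral_sum_embedding_le (hF : Measurable F) (hW : ∀ k, Measurable (W k))
    (hΘm : ∀ k f, Measurable (Θ k f))
    (hΘ : ∀ (n k : ℕ) (f : Fin m ↪ Fin k) (g : Fin n ↪ Fin k),
      (∀ i j, f i ≠ g j) → ∀ y, Θ k f y ≤ F (y ∘ f) * W n (y ∘ g)) :
    grandIntegral ref z (fun k y => ∑ f, Θ k f y) ≤
      z ^ m * (∫⁻ y, F y ∂(Measure.pi fun _ : Fin m => ref)) * grandIntegral ref z W := by
  have hzero : ∀ k < m, z ^ k * (k.factorial : ℝ≥0∞)⁻¹ *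
      ∫⁻ y, ∑ f, Θ k f y ∂(Measure.pi fun _ : Fin k => ref) = 0 := by
    intro k hk
    have : IsEmpty (Fin m ↪ Fin k) := Function.Embedding.isEmpty_of_card_lt (by simpa using hk)
    simp
  unfold grandIntegral
  rw [tsum_eq_tsum_add_of_forall_lt_eq_zero _ m hzero, ← ENNReal.tsum_mul_left]
  refine ENNReal.tsum_le_tsum fun n => ?_
  calc _ ≤ z ^ (n + m) * ((n + m).factorial : ℝ≥0∞)⁻¹ * (((n + m).descFactorial m : ℝ≥0∞) *
      ((∫⁻ y, F y ∂(Measure.pi fun _ : Fin m => ref)) *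
        ∫⁻ y, W n y ∂(Measure.pi fun _ : Fin n => ref))) :=
        mul_le_mul_right (lintegral_sum_embedding_le hF hW hΘm hΘ n) _
    _ = z ^ (n + m) * (((n + m).factorial : ℝ≥0∞)⁻¹ * ((n + m).descFactorial m : ℝ≥0∞)) *
      ((∫⁻ y, F y ∂(Measure.pi fun _ : Fin m => ref)) *
        ∫⁻ y, W n y ∂(Measure.pi fun _ : Fin n => ref)) := by
        simp only [mul_assoc]
    _ = _ := by
        rw [inv_factorial_mul_descFactorial, pow_add]
        ring

end MarkedParticles

end GrandCanonical

section SoftPart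

/-- The square of the Euclidean norm of a vector of the plane; the norm of `ℝ × ℝ` is the supremum
norm, whose square is not smooth. -/
def euclidSq (x : ℝ × ℝ) : ℝ := x.1 ^ 2 + x.2 ^ 2

theorem euclidSq_nonneg (x : ℝ × ℝ) : 0 ≤ euclidSq x := by
  unfold euclidSq
  positivity

theorem norm_sq_le_euclidSq (x : ℝ × ℝ) : ‖x‖ ^ 2 ≤ euclidSq x := by
  rcases max_choice ‖x.1‖ ‖x.2‖ with h | h <;>
    rw [Prod.norm_def, h, Real.norm_eq_abs, sq_abs, euclidSq]
  · exact le_add_of_nonneg_right (sq_nonneg _)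
  · exact le_add_of_nonneg_left (sq_nonneg _)

theorem euclidSq_le_two_mul_norm_sq (x : ℝ × ℝ) : euclidSq x ≤ 2 * ‖x‖ ^ 2 := by
  have hfst := pow_le_pow_left₀ (norm_nonneg _) (norm_fst_le x) 2
  have hsnd := pow_le_pow_left₀ (norm_nonneg _) (norm_snd_le x) 2
  rw [Real.norm_eq_abs, sq_abs] at hfst hsnd
  unfold euclidSq
  linarith

/-- The concave parabola of curvature `M` with apex `p.2` over the point `p.1`. -/
def parabola (M : ℝ) (p : (ℝ × ℝ) × ℝ) (x : ℝ × ℝ) : ℝ := p.2 - M * euclidSq (x - p.1)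

/-- The parabolas of curvature `M` and of apex at most `1` below `f`. -/
def Subparabola (f : ℝ × ℝ → ℝ) (M : ℝ) : Type :=
  {p : (ℝ × ℝ) × ℝ // p.2 ≤ 1 ∧ ∀ u, parabola M p u ≤ f u}

/-- The soft part of `f`: the supremum of the positive parts of the parabolas of curvature `M`
below `f`. For large `M` it is a semiconvex minorant close to `f`. -/
def softPart (f : ℝ × ℝ → ℝ) (M : ℝ) (x : ℝ × ℝ) : ℝ :=
  ⨆ p : Subparabola f M, max (parabola M p.1 x) 0

theorem continuous_parabola (M : ℝ) (p : (ℝ × ℝ) × ℝ) : Continuous (parabola M p) := by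
  unfold parabola euclidSq
  fun_prop

theorem parabola_neg_apex (M : ℝ) (p : (ℝ × ℝ) × ℝ) (x : ℝ × ℝ) :
    parabola M (-p.1, p.2) x = parabola M p (-x) := by
  simp only [parabola, euclidSq, Prod.fst_sub, Prod.snd_sub, Prod.fst_neg, Prod.snd_neg]
  ring

theorem exists_parabola_add_sub {M : ℝ} (hM : 0 ≤ M) {p : (ℝ × ℝ) × ℝ} (hp : p.2 ≤ 1)
    {x : ℝ × ℝ} (hx : 0 ≤ parabola M p x) (s : ℝ × ℝ) :
    ∃ w : ℝ, w ^ 2 ≤ 4 * (M * euclidSq s) ∧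
      parabola M p (x + s) = parabola M p x - M * euclidSq s - w ∧
      parabola M p (x - s) = parabola M p x - M * euclidSq s + w := by
  set d := x - p.1 with hd
  have hMd : M * euclidSq d ≤ 1 := by
    unfold parabola at hx
    linarith
  have hcs : (d.1 * s.1 + d.2 * s.2) ^ 2 ≤ euclidSq d * euclidSq s := by
    unfold euclidSq
    nlinarith [sq_nonneg (d.1 * s.2 - d.2 * s.1)]
  refine ⟨2 * M * (d.1 * s.1 + d.2 * s.2), ?_, ?_, ?_⟩
  · calc (2 * M * (d.1 * s.1 + d.2 * s.2)) ^ 2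
        = 4 * M ^ 2 * (d.1 * s.1 + d.2 * s.2) ^ 2 := by ring
      _ ≤ 4 * M ^ 2 * (euclidSq d * euclidSq s) := by gcongr
      _ = 4 * (M * euclidSq s) * (M * euclidSq d) := by ring
      _ ≤ 4 * (M * euclidSq s) := mul_le_of_le_one_right
          (mul_nonneg zero_le_four (mul_nonneg hM (euclidSq_nonneg s))) hMd
  · simp only [parabola, euclidSq, hd, Prod.fst_add, Prod.snd_add, Prod.fst_sub, Prod.snd_sub]
    ring
  · simp only [parabola, euclidSq, hd, Prod.fst_sub, Prod.snd_sub]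
    ring

theorem sq_le_mul_add_of_le {a b c u w : ℝ} (ha0 : 0 ≤ a) (ha1 : a ≤ 1) (hb : 0 ≤ b) (hc : 0 ≤ c)
    (hu : 0 ≤ u) (hw : w ^ 2 ≤ 4 * u) (hab : a - u - w ≤ b) (hac : a - u + w ≤ c) :
    a ^ 2 ≤ b * c + 10 * u := by
  have hbc : 0 ≤ b * c := mul_nonneg hb hc
  rcases le_or_gt |w| (a - u) with hcase | hcase
  · have hplus : 0 ≤ a - u + w := by linarith [neg_abs_le w]
    have : (a - u - w) * (a - u + w) ≤ b * c := mul_le_mul hab hac hplus hb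
    nlinarith
  · rcases le_or_gt 1 u with hu1 | hu1
    · nlinarith
    · have hle : a ^ 2 ≤ (u + |w|) ^ 2 := pow_le_pow_left₀ ha0 (by linarith) 2
      have : (u + |w|) ^ 2 ≤ 2 * u ^ 2 + 2 * w ^ 2 := by
        rw [← sq_abs w]
        nlinarith [sq_nonneg (u - |w|)]
      nlinarith

variable {f : ℝ × ℝ → ℝ} {M : ℝ}

theorem bddAbove_softPart (hf : ∀ x, 0 ≤ f x) (x : ℝ × ℝ) :
    BddAbove (range fun p : Subparabola f M => max (parabola M p.1 x) 0) :=
  ⟨f x, by rintro _ ⟨p, rfl⟩; exact max_le (p.2.2 x) (hf x)⟩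

theorem parabola_le_softPart (hf : ∀ x, 0 ≤ f x) (p : Subparabola f M) (x : ℝ × ℝ) :
    parabola M p.1 x ≤ softPart f M x :=
  (le_max_left _ _).trans (le_ciSup (bddAbove_softPart hf x) p)

theorem softPart_nonneg (x : ℝ × ℝ) : 0 ≤ softPart f M x :=
  Real.iSup_nonneg fun _ => le_max_right _ _

theorem softPart_le (hf : ∀ x, 0 ≤ f x) (x : ℝ × ℝ) : softPart f M x ≤ f x :=
  Real.iSup_le (fun p => max_le (p.2.2 x) (hf x)) (hf x)

theorem softPart_neg (f : ℝ × ℝ → ℝ) (M : ℝ) (x : ℝ × ℝ) :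
    softPart f M (-x) = softPart (fun y => f (-y)) M x := by
  let e : Subparabola f M ≃ Subparabola (fun y => f (-y)) M :=
    { toFun := fun p => ⟨(-p.1.1, p.1.2), p.2.1, fun u => by
        rw [parabola_neg_apex]; exact p.2.2 _⟩
      invFun := fun p => ⟨(-p.1.1, p.1.2), p.2.1, fun u => by
        rw [parabola_neg_apex]; simpa only [neg_neg] using p.2.2 (-u)⟩
      left_inv := fun p => Subtype.ext (Prod.ext (neg_neg _) rfl)
      right_inv := fun p => Subtype.ext (Prod.ext (neg_neg _) rfl) }
  refine Equiv.iSup_congr e fun p => ?_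
  change max (parabola M (-p.1.1, p.1.2) x) 0 = _
  rw [parabola_neg_apex]

theorem measurable_softPart (hf : ∀ x, 0 ≤ f x) : Measurable (softPart f M) :=
  (lowerSemicontinuous_ciSup (bddAbove_softPart hf) fun p =>
    ((continuous_parabola M p.1).max continuous_const).lowerSemicontinuous).measurable

theorem le_softPart_of_forall_norm_lt (hf : ∀ x, 0 ≤ f x) (hM : 0 ≤ M) {c δ : ℝ} (hc : c ≤ 1)
    (hδ : 0 ≤ δ) (hcδ : c ≤ M * δ ^ 2) {x : ℝ × ℝ} (hx : ∀ u, ‖u - x‖ < δ → c ≤ f u) :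
    c ≤ softPart f M x := by
  have hp : ∀ u, parabola M (x, c) u ≤ f u := by
    intro u
    rcases lt_or_ge ‖u - x‖ δ with h | h
    · exact (sub_le_self _ (mul_nonneg hM (euclidSq_nonneg _))).trans (hx u h)
    · have hsq : δ ^ 2 ≤ euclidSq (u - x) :=
        (pow_le_pow_left₀ hδ h 2).trans (norm_sq_le_euclidSq _)
      exact (sub_nonpos.2 (hcδ.trans (mul_le_mul_of_nonneg_left hsq hM))).trans (hf u)
  simpa [parabola, euclidSq] using parabola_le_softPart hf ⟨(x, c), hc, hp⟩ x

theorem softPart_eq_one (hf : ∀ x, 0 ≤ f x) (hf1 : ∀ x, f x ≤ 1) (hM : 1 ≤ M) {x : ℝ × ℝ}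
    (hx : ∀ u, ‖u - x‖ < 1 → f u = 1) : softPart f M x = 1 :=
  le_antisymm ((softPart_le hf x).trans (hf1 x))
    (le_softPart_of_forall_norm_lt hf (zero_le_one.trans hM) le_rfl zero_le_one
      (by simpa using hM) fun u hu => (hx u hu).ge)

theorem softPart_eq_one_of_add_one_le (hf : ∀ x, 0 ≤ f x) (hf1 : ∀ x, f x ≤ 1) (hM : 1 ≤ M)
    {r : ℝ} (hfr : ∀ x, r ≤ ‖x‖ → f x = 1) {x : ℝ × ℝ} (hx : r + 1 ≤ ‖x‖) :
    softPart f M x = 1 := by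
  refine softPart_eq_one hf hf1 hM fun u hu => hfr u ?_
  have := norm_sub_norm_le x u
  rw [norm_sub_rev] at this
  linarith

-- Of two parabolas through the same apex, one gains at `x + s` what it loses at `x - s`, so only
-- second-order terms in `s` remain.
theorem softPart_sq_sub_le (hf : ∀ x, 0 ≤ f x) (hM : 0 ≤ M) (x s : ℝ × ℝ) :
    softPart f M x ^ 2 - softPart f M (x + s) * softPart f M (x - s) ≤
      10 * (M * euclidSq s) := by
  have hu : 0 ≤ M * euclidSq s := mul_nonneg hM (euclidSq_nonneg s)
  set Q := softPart f M (x + s) * softPart f M (x - s)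
  have hQ : 0 ≤ Q := mul_nonneg (softPart_nonneg _) (softPart_nonneg _)
  have hroot : softPart f M x ≤ √(Q + 10 * (M * euclidSq s)) := by
    refine Real.iSup_le (fun p => max_le ?_ (Real.sqrt_nonneg _)) (Real.sqrt_nonneg _)
    rcases le_or_gt (parabola M p.1 x) 0 with hA | hA
    · exact hA.trans (Real.sqrt_nonneg _)
    obtain ⟨w, hw, hadd, hsub⟩ := exists_parabola_add_sub hM p.2.1 hA.le s
    have hA1 : parabola M p.1 x ≤ 1 :=
      (sub_le_self _ (mul_nonneg hM (euclidSq_nonneg _))).trans p.2.1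
    exact Real.le_sqrt_of_sq_le (sq_le_mul_add_of_le hA.le hA1 (softPart_nonneg _)
      (softPart_nonneg _) hu hw (hadd ▸ parabola_le_softPart hf p (x + s))
      (hsub ▸ parabola_le_softPart hf p (x - s)))
  rw [sub_le_iff_le_add']
  calc softPart f M x ^ 2 ≤ √(Q + 10 * (M * euclidSq s)) ^ 2 :=
        pow_le_pow_left₀ (softPart_nonneg x) hroot 2
    _ = Q + 10 * (M * euclidSq s) := Real.sq_sqrt (by positivity)

theorem tendsto_softPart (hf : ∀ x, 0 ≤ f x) (hf1 : ∀ x, f x ≤ 1) {x : ℝ × ℝ}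
    (hx : ContinuousAt f x) :
    Tendsto (fun n : ℕ => softPart f n x) atTop (𝓝 (f x)) := by
  refine tendsto_order.2 ⟨fun a ha => ?_, fun a ha =>
    Eventually.of_forall fun n => (softPart_le hf x).trans_lt ha⟩
  obtain ⟨c, hac, hcf⟩ := exists_between ha
  obtain ⟨δ, hδ, hball⟩ := Metric.eventually_nhds_iff.1 (hx.eventually (lt_mem_nhds hcf))
  filter_upwards [eventually_ge_atTop ⌈(δ ^ 2)⁻¹⌉₊] with n hn
  have hc1 : c ≤ 1 := hcf.le.trans (hf1 x)
  have hnδ : 1 ≤ (n : ℝ) * δ ^ 2 :=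
    (inv_le_iff_one_le_mul₀ (by positivity)).1 ((Nat.le_ceil _).trans (by exact_mod_cast hn))
  exact hac.trans_le (le_softPart_of_forall_norm_lt hf n.cast_nonneg hc1 hδ.le (hc1.trans hnδ)
    fun u hu => (hball (by rwa [dist_eq_norm])).le)

theorem tendsto_lintegral_softPart (hf : ∀ x, 0 ≤ f x) (hf1 : ∀ x, f x ≤ 1)
    (hfm : Measurable f) (hfc : ∀ᵐ x, ContinuousAt f x) {r : ℝ}
    (hfr : ∀ x, r ≤ ‖x‖ → f x = 1) :
    Tendsto (fun n : ℕ => ∫⁻ x, ENNReal.ofReal (f x ^ 2 - softPart f n x ^ 2)) atTop (𝓝 0) := by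
  rw [show (0 : ℝ≥0∞) = ∫⁻ _ : ℝ × ℝ, 0 by simp]
  refine tendsto_lintegral_filter_of_dominated_convergence
    (fun x => (Metric.closedBall (0 : ℝ × ℝ) (r + 1)).indicator 1 x) ?_ ?_ ?_ ?_
  · refine Eventually.of_forall fun n => ?_
    have := measurable_softPart (f := f) (M := n) hf
    fun_prop
  · filter_upwards [eventually_ge_atTop 1] with n hn
    refine Eventually.of_forall fun x => ?_
    by_cases hx : x ∈ Metric.closedBall (0 : ℝ × ℝ) (r + 1)
    · rw [indicator_of_mem hx]
      exact ENNReal.ofReal_le_one.2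
        ((sub_le_self _ (sq_nonneg _)).trans (pow_le_one₀ (hf x) (hf1 x)))
    · rw [mem_closedBall_zero_iff, not_le] at hx
      rw [softPart_eq_one_of_add_one_le hf hf1 (by exact_mod_cast hn) hfr hx.le,
        hfr x (by linarith)]
      simp
  · rw [lintegral_indicator_one measurableSet_closedBall]
    exact measure_closedBall_lt_top.ne
  · filter_upwards [hfc] with x hx
    have hlim : Tendsto (fun n : ℕ => ENNReal.ofReal (f x ^ 2 - softPart f n x ^ 2)) atTop
        (𝓝 (ENNReal.ofReal (f x ^ 2 - f x ^ 2))) :=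
      ENNReal.tendsto_ofReal (tendsto_const_nhds.sub ((tendsto_softPart hf hf1 hx).pow 2))
    simpa using hlim

end SoftPart

section Boltzmann

/-- The Boltzmann factor `e^{-t}` of an energy `t ∈ [0,∞]`. -/
def boltzmann (t : ℝ≥0∞) : ℝ≥0∞ := EReal.exp (-(t : EReal))

theorem continuous_boltzmann : Continuous boltzmann :=
  ENNReal.continuous_exp.comp (continuous_neg.comp continuous_coe_ennreal_ereal)

theorem measurable_boltzmann : Measurable boltzmann := continuous_boltzmann.measurable

@[simp] theorem boltzmann_zero : boltzmann 0 = 1 := by simp [boltzmann]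

@[simp] theorem boltzmann_top : boltzmann ⊤ = 0 := by simp [boltzmann]

theorem boltzmann_coe (t : ℝ≥0) : boltzmann t = ENNReal.ofReal (Real.exp (-(t : ℝ))) := by
  rw [boltzmann, show ((t : ℝ≥0∞) : EReal) = ((t : ℝ) : EReal) from rfl, ← EReal.coe_neg,
    EReal.exp_coe]

theorem boltzmann_add (s t : ℝ≥0∞) : boltzmann (s + t) = boltzmann s * boltzmann t := by
  induction s with
  | top => simp
  | coe s =>
    induction t with
    | top => simp
    | coe t =>
      rw [← ENNReal.coe_add, boltzmann_coe, boltzmann_coe, boltzmann_coe,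
        ← ENNReal.ofReal_mul (Real.exp_nonneg _), ← Real.exp_add, NNReal.coe_add, neg_add]

theorem boltzmann_le_one (t : ℝ≥0∞) : boltzmann t ≤ 1 := by
  rw [boltzmann, ← EReal.exp_zero]
  refine EReal.exp_monotone ?_
  rw [EReal.neg_le, neg_zero]
  exact EReal.coe_ennreal_nonneg t

theorem boltzmann_ne_top (t : ℝ≥0∞) : boltzmann t ≠ ⊤ :=
  ((boltzmann_le_one t).trans_lt ENNReal.one_lt_top).ne

theorem boltzmann_sum {ι : Type*} (s : Finset ι) (f : ι → ℝ≥0∞) :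
    boltzmann (∑ i ∈ s, f i) = ∏ i ∈ s, boltzmann (f i) := by
  classical
  induction s using Finset.induction_on with
  | empty => simp
  | insert a s ha ih => rw [Finset.sum_insert ha, Finset.prod_insert ha, boltzmann_add, ih]

/-- The square root of the Boltzmann factor, as a real number. -/
def boltzRoot (t : ℝ≥0∞) : ℝ := √(boltzmann t).toReal

theorem continuous_boltzRoot : Continuous boltzRoot :=
  continuous_iff_continuousAt.2 fun t =>
    ((ENNReal.tendsto_toReal (boltzmann_ne_top t)).comp (continuous_boltzmann.tendsto t)).sqrt

@[simp] theorem boltzRoot_zero : boltzRoot 0 = 1 := by simp [boltzRoot]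

theorem boltzRoot_nonneg (t : ℝ≥0∞) : 0 ≤ boltzRoot t := Real.sqrt_nonneg _

theorem boltzRoot_le_one (t : ℝ≥0∞) : boltzRoot t ≤ 1 :=
  Real.sqrt_le_one.2
    (ENNReal.toReal_le_of_le_ofReal zero_le_one (by simpa using boltzmann_le_one t))

theorem ofReal_boltzRoot_sq (t : ℝ≥0∞) : ENNReal.ofReal (boltzRoot t ^ 2) = boltzmann t := by
  rw [boltzRoot, Real.sq_sqrt ENNReal.toReal_nonneg, ENNReal.ofReal_toReal (boltzmann_ne_top t)]

end Boltzmann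

/-- A translation invariant pair weight `e` with values in `[0, 1]`, written as the sum of a soft
part `q²` and of a nonnegative remainder of integral at most `eps`. The soft part equals `1` outside
the ball of radius `r`, and `C` bounds the second-order variation of `q`. -/
structure SoftSplit (S : Type*) where
  e : S → S → ℝ × ℝ → ℝ≥0∞
  q : S → S → ℝ × ℝ → ℝ
  r : ℝ
  C : ℝ
  eps : ℝ≥0∞
  r_pos : 0 < r
  C_nonneg : 0 ≤ C
  e_le_one : ∀ σ σ' x, e σ σ' x ≤ 1
  q_nonneg : ∀ σ σ' x, 0 ≤ q σ σ' x
  q_le : ∀ σ σ' x, ENNReal.ofReal (q σ σ' x ^ 2) ≤ e σ σ' x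
  e_symm : ∀ σ σ' x, e σ σ' (-x) = e σ' σ x
  q_symm : ∀ σ σ' x, q σ σ' (-x) = q σ' σ x
  measurable_e : ∀ σ σ', Measurable (e σ σ')
  measurable_q : ∀ σ σ', Measurable (q σ σ')
  q_far : ∀ σ σ' x, r ≤ ‖x‖ → q σ σ' x = 1
  q_sq_sub_le : ∀ σ σ' x s, q σ σ' x ^ 2 - q σ σ' (x + s) * q σ σ' (x - s) ≤ C * ‖s‖ ^ 2
  lintegral_le : ∀ σ σ', ∫⁻ x, (e σ σ' x - ENNReal.ofReal (q σ σ' x ^ 2)) ≤ eps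

theorem exists_lintegral_boltzmann_sub_softPart_le {ι : Type*} [Finite ι] {ψ : ι → ℝ × ℝ → ℝ≥0∞}
    (hmeas : ∀ i, Measurable (ψ i)) (hcont : ∀ i, ∀ᵐ x, ContinuousAt (ψ i) x) {r : ℝ}
    (hfar : ∀ i x, r ≤ ‖x‖ → ψ i x = 0) {ε : ℝ≥0∞} (hε : ε ≠ 0) :
    ∃ n : ℕ, 1 ≤ n ∧ ∀ i, ∫⁻ x, (boltzmann (ψ i x) -
      ENNReal.ofReal (softPart (fun u => boltzRoot (ψ i u)) n x ^ 2)) ≤ ε := by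
  have hlim : ∀ i, ∀ᶠ n : ℕ in atTop, ∫⁻ x, ENNReal.ofReal (boltzRoot (ψ i x) ^ 2 -
      softPart (fun u => boltzRoot (ψ i u)) n x ^ 2) < ε := fun i =>
    (tendsto_lintegral_softPart (fun _ => boltzRoot_nonneg _) (fun _ => boltzRoot_le_one _)
      (continuous_boltzRoot.measurable.comp (hmeas i))
      ((hcont i).mono fun x hx => continuous_boltzRoot.continuousAt.comp hx)
      (fun x hx => by rw [hfar i x hx, boltzRoot_zero])).eventually
      (gt_mem_nhds (pos_iff_ne_zero.2 hε))
  obtain ⟨n, hn, hn1⟩ := ((eventually_all.2 hlim).and (eventually_ge_atTop 1)).exists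
  refine ⟨n, hn1, fun i => le_trans (le_of_eq (lintegral_congr fun x => ?_)) (hn i).le⟩
  rw [← ofReal_boltzRoot_sq, ← ENNReal.ofReal_sub _ (sq_nonneg _)]

theorem exists_softSplit {S : Type*} [Finite S] {ψ : S → S → ℝ × ℝ → ℝ≥0∞}
    (hmeas : ∀ σ σ', Measurable (ψ σ σ')) (hsymm : ∀ σ σ' x, ψ σ σ' (-x) = ψ σ' σ x)
    (hcont : ∀ σ σ', ∀ᵐ x, ContinuousAt (ψ σ σ') x) {r : ℝ} (hr : 0 < r)
    (hfar : ∀ σ σ' x, r ≤ ‖x‖ → ψ σ σ' x = 0) {ε : ℝ≥0∞} (hε : ε ≠ 0) :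
    ∃ D : SoftSplit S, D.eps = ε ∧ ∀ σ σ' x, D.e σ σ' x = boltzmann (ψ σ σ' x) := by
  let f : S → S → ℝ × ℝ → ℝ := fun σ σ' x => boltzRoot (ψ σ σ' x)
  have hf0 : ∀ σ σ' x, 0 ≤ f σ σ' x := fun σ σ' x => boltzRoot_nonneg _
  have hf1 : ∀ σ σ' x, f σ σ' x ≤ 1 := fun σ σ' x => boltzRoot_le_one _
  have hffar : ∀ σ σ' x, r ≤ ‖x‖ → f σ σ' x = 1 := fun σ σ' x hx => by simp [f, hfar σ σ' x hx]
  obtain ⟨n, hn1, hn⟩ := exists_lintegral_boltzmann_sub_softPart_le (ι := S × S)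
    (fun p => hmeas p.1 p.2) (fun p => hcont p.1 p.2) (fun p => hfar p.1 p.2) hε
  refine ⟨{
    e := fun σ σ' x => boltzmann (ψ σ σ' x)
    q := fun σ σ' => softPart (f σ σ') n
    r := r + 1
    C := 20 * n
    eps := ε
    r_pos := by positivity
    C_nonneg := by positivity
    e_le_one := fun _ _ _ => boltzmann_le_one _
    q_nonneg := fun _ _ _ => softPart_nonneg _
    q_le := fun σ σ' x => (ENNReal.ofReal_le_ofReal (pow_le_pow_left₀ (softPart_nonneg _)
      (softPart_le (hf0 σ σ') x) 2)).trans_eq (ofReal_boltzRoot_sq _)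
    e_symm := fun σ σ' x => by rw [hsymm]
    q_symm := fun σ σ' x => by simp only [softPart_neg, f, hsymm]
    measurable_e := fun σ σ' => measurable_boltzmann.comp (hmeas σ σ')
    measurable_q := fun σ σ' => measurable_softPart (hf0 σ σ')
    q_far := fun σ σ' x hx => softPart_eq_one_of_add_one_le (hf0 σ σ') (hf1 σ σ')
      (by exact_mod_cast hn1) (hffar σ σ') hx
    q_sq_sub_le := fun σ σ' x s => (softPart_sq_sub_le (hf0 σ σ') n.cast_nonneg x s).trans ?_
    lintegral_le := fun σ σ' => hn (σ, σ') }, rfl, fun _ _ _ => rfl⟩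
  linarith [mul_le_mul_of_nonneg_left (euclidSq_le_two_mul_norm_sq s) (n.cast_nonneg (α := ℝ))]

theorem measurable_apply_sub {S : Type*} [MeasurableSpace S] [MeasurableSingletonClass S]
    [Countable S] {β : Type*} [MeasurableSpace β]
    {F : S → S → ℝ × ℝ → β} (hF : ∀ σ σ', Measurable (F σ σ')) :
    Measurable fun p : Particle S × Particle S => F p.1.2 p.2.2 (p.1.1 - p.2.1) := by
  have huncurry : Measurable fun p : (S × S) × (ℝ × ℝ) => F p.1.1 p.1.2 p.2 :=
    measurable_from_prod_countable_right fun σ => hF σ.1 σ.2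
  exact huncurry.comp (f := fun p : Particle S × Particle S => ((p.1.2, p.2.2), p.1.1 - p.2.1))
    (by fun_prop)

namespace SoftSplit

variable {S : Type*} (D : SoftSplit S)

/-- The pair weight `e` as a function of two particles. -/
def full (y y' : Particle S) : ℝ≥0∞ := D.e y.2 y'.2 (y.1 - y'.1)

/-- The soft part `q²` of the pair weight as a function of two particles. -/
def soft (y y' : Particle S) : ℝ≥0∞ := ENNReal.ofReal (D.q y.2 y'.2 (y.1 - y'.1) ^ 2)

/-- The remainder of the pair weight as a function of two particles: the weight of the event that
they are connected by a bond in the expansion of the product of pair weights. -/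
def bond (y y' : Particle S) : ℝ≥0∞ := D.full y y' - D.soft y y'

theorem bond_add_soft (y y' : Particle S) : D.bond y y' + D.soft y y' = D.full y y' :=
  tsub_add_cancel_of_le (D.q_le _ _ _)

theorem full_le_one (y y' : Particle S) : D.full y y' ≤ 1 := D.e_le_one _ _ _

theorem full_symm (y y' : Particle S) : D.full y y' = D.full y' y := by
  rw [full, full, ← D.e_symm, neg_sub]

theorem soft_symm (y y' : Particle S) : D.soft y y' = D.soft y' y := by
  rw [soft, soft, ← D.q_symm, neg_sub]

theorem bond_symm (y y' : Particle S) : D.bond y y' = D.bond y' y := by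
  rw [bond, bond, full_symm, soft_symm]

theorem bond_eq_zero {y y' : Particle S} (h : D.r ≤ ‖y.1 - y'.1‖) : D.bond y y' = 0 := by
  rw [bond, soft, D.q_far _ _ _ h, one_pow, ENNReal.ofReal_one]
  exact tsub_eq_zero_of_le (D.full_le_one y y')

section Measurability

variable [MeasurableSpace S] [MeasurableSingletonClass S] [Countable S]

theorem measurable_full : Measurable (Function.uncurry D.full) :=
  measurable_apply_sub D.measurable_e

theorem measurable_soft : Measurable (Function.uncurry D.soft) :=
  ENNReal.measurable_ofReal.comp ((measurable_apply_sub D.measurable_q).pow_const 2)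

theorem measurable_bond : Measurable (Function.uncurry D.bond) :=
  D.measurable_full.sub D.measurable_soft

end Measurability

end SoftSplit

section Reference

variable {S : Type*} [Finite S] [Nonempty S] [MeasurableSpace S] [MeasurableSingletonClass S]

instance : IsProbabilityMeasure (ProbabilityTheory.uniformOn (univ : Set S)) :=
  ProbabilityTheory.isProbabilityMeasure_uniformOn finite_univ univ_nonempty

instance : SigmaFinite (refMeasure S) := by
  unfold refMeasure
  infer_instance

theorem lintegral_refMeasure_le {F : Particle S → ℝ≥0∞} (hF : Measurable F) {c : ℝ≥0∞}
    (hc : ∀ σ, ∫⁻ x, F (x, σ) ≤ c) : ∫⁻ y, F y ∂(refMeasure S) ≤ c := by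
  rw [refMeasure, lintegral_prod_symm _ hF.aemeasurable]
  calc _ ≤ ∫⁻ _ : S, c ∂(ProbabilityTheory.uniformOn (univ : Set S)) := lintegral_mono hc
    _ = c := by simp

theorem lintegral_refMeasure_fst {F : ℝ × ℝ → ℝ≥0∞} (hF : Measurable F) :
    ∫⁻ y, F y.1 ∂(refMeasure S) = ∫⁻ x, F x := by
  rw [refMeasure]
  refine (lintegral_prod_symm _ (hF.comp measurable_fst).aemeasurable).trans ?_
  simp

theorem SoftSplit.lintegral_bond_le (D : SoftSplit S) (y : Particle S) :
    ∫⁻ y', D.bond y y' ∂(refMeasure S) ≤ D.eps := by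
  refine lintegral_refMeasure_le (D.measurable_bond.comp measurable_prodMk_left) fun σ => ?_
  exact (lintegral_sub_left_eq_self (μ := (volume : Measure (ℝ × ℝ)))
    (fun x => D.e y.2 σ x - ENNReal.ofReal (D.q y.2 σ x ^ 2)) y.1).trans_le (D.lintegral_le y.2 σ)

/-- The indicator of the pairs of particles at distance at most `ρ`. -/
def nearIndicator (ρ : ℝ) (y y' : Particle S) : ℝ≥0∞ :=
  (Metric.closedBall (0 : ℝ × ℝ) ρ).indicator 1 (y.1 - y'.1)

theorem nearIndicator_eq_one {S : Type*} {ρ : ℝ} {y y' : Particle S} (h : ‖y.1 - y'.1‖ ≤ ρ) :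
    nearIndicator ρ y y' = 1 :=
  indicator_of_mem (mem_closedBall_zero_iff.2 h) _

theorem measurable_nearIndicator {S : Type*} [MeasurableSpace S] (ρ : ℝ) :
    Measurable (Function.uncurry (nearIndicator (S := S) ρ)) :=
  (measurable_one.indicator measurableSet_closedBall).comp
    (f := fun p : Particle S × Particle S => p.1.1 - p.2.1) (by fun_prop)

theorem lintegral_nearIndicator_le (ρ : ℝ) (y : Particle S) :
    ∫⁻ y', nearIndicator ρ y y' ∂(refMeasure S) ≤ volume (Metric.closedBall (0 : ℝ × ℝ) ρ) := by
  refine lintegral_refMeasure_le ((measurable_nearIndicator ρ).comp measurable_prodMk_left)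
    fun σ => le_of_eq ?_
  refine (lintegral_sub_left_eq_self (μ := (volume : Measure (ℝ × ℝ)))
    ((Metric.closedBall (0 : ℝ × ℝ) ρ).indicator 1) y.1).trans ?_
  rw [lintegral_indicator_one measurableSet_closedBall]

end Reference

section Cutoff

theorem one_add_norm_le_mul {E : Type*} [SeminormedAddCommGroup E] (x y : E) :
    1 + ‖x‖ ≤ (1 + ‖x - y‖) * (1 + ‖y‖) := by
  have := norm_add_le (x - y) y
  rw [sub_add_cancel] at this
  nlinarith [norm_nonneg (x - y), norm_nonneg y]

theorem div_one_add_norm_le_mul {E : Type*} [SeminormedAddCommGroup E] {ρ : ℝ} (hρ : 0 ≤ ρ)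
    (x y : E) : ρ / (1 + ‖y‖) ≤ ρ / (1 + ‖x‖) * (1 + ‖x - y‖) := by
  rw [div_mul_eq_mul_div, div_le_div_iff₀ (by positivity) (by positivity), mul_assoc]
  exact mul_le_mul_of_nonneg_left (one_add_norm_le_mul x y) hρ

/-- A continuously differentiable function `τ` on the plane with values in `[0, 1]` that equals `1`
on the ball of radius `R`, vanishes outside the ball of radius `N`, and whose derivative decays like
`rho / (1 + ‖x‖)`. It tunes the translations from the full shift near the origin to no shift far
away. -/
structure Cutoff where
  τ : ℝ × ℝ → ℝ
  rho : ℝ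
  R : ℝ
  N : ℝ
  rho_nonneg : 0 ≤ rho
  nonneg : ∀ x, 0 ≤ τ x
  le_one : ∀ x, τ x ≤ 1
  contDiff : ContDiff ℝ 1 τ
  norm_fderiv_le : ∀ x, ‖fderiv ℝ τ x‖ ≤ rho / (1 + ‖x‖)
  eq_one : ∀ x, ‖x‖ ≤ R → τ x = 1
  eq_zero : ∀ x, N ≤ ‖x‖ → τ x = 0

namespace Cutoff

variable (T : Cutoff)

theorem continuous : Continuous T.τ := T.contDiff.continuous

theorem differentiable : Differentiable ℝ T.τ := T.contDiff.differentiable one_ne_zero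

theorem continuous_fderiv_apply (w : ℝ × ℝ) : Continuous fun x => fderiv ℝ T.τ x w :=
  (T.contDiff.continuous_fderiv one_ne_zero).clm_apply continuous_const

theorem norm_fderiv_le_rho (x : ℝ × ℝ) : ‖fderiv ℝ T.τ x‖ ≤ T.rho :=
  (T.norm_fderiv_le x).trans (div_le_self T.rho_nonneg (le_add_of_nonneg_right (norm_nonneg x)))

theorem abs_fderiv_apply_le (x w : ℝ × ℝ) : |fderiv ℝ T.τ x w| ≤ T.rho / (1 + ‖x‖) * ‖w‖ :=
  ((fderiv ℝ T.τ x).le_opNorm w).trans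
    (mul_le_mul_of_nonneg_right (T.norm_fderiv_le x) (norm_nonneg w))

theorem abs_sub_le (x y : ℝ × ℝ) :
    |T.τ x - T.τ y| ≤ T.rho / (1 + ‖x‖) * ((1 + ‖x - y‖) * ‖x - y‖) := by
  have hfderiv : ∀ u ∈ Metric.closedBall x ‖x - y‖,
      ‖fderiv ℝ T.τ u‖ ≤ T.rho / (1 + ‖x‖) * (1 + ‖x - y‖) := by
    intro u hu
    refine (T.norm_fderiv_le u).trans ((div_one_add_norm_le_mul T.rho_nonneg x u).trans ?_)
    rw [mem_closedBall_iff_norm'] at hu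
    have := T.rho_nonneg
    gcongr
  have h := (convex_closedBall x ‖x - y‖).norm_image_sub_le_of_norm_fderiv_le
    (fun u _ => T.differentiable u) hfderiv (x := y) (y := x)
    (by rw [mem_closedBall_iff_norm']) (Metric.mem_closedBall_self (norm_nonneg _))
  rwa [Real.norm_eq_abs, mul_assoc] at h

theorem abs_sub_le_rho (x y : ℝ × ℝ) : |T.τ x - T.τ y| ≤ T.rho * ‖x - y‖ :=
  convex_univ.norm_image_sub_le_of_norm_fderiv_le (s := (univ : Set (ℝ × ℝ)))
    (fun u _ => T.differentiable u) (fun u _ => T.norm_fderiv_le_rho u) (mem_univ y) (mem_univ x)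

/-- The translation of the plane by the vector `w`, tuned by the cutoff. -/
def shift (w x : ℝ × ℝ) : ℝ × ℝ := x + T.τ x • w

/-- The Jacobian determinant of the tuned translation `T.shift w`. -/
def jac (w x : ℝ × ℝ) : ℝ := 1 + fderiv ℝ T.τ x w

theorem continuous_jac (w : ℝ × ℝ) : Continuous (T.jac w) :=
  continuous_const.add (T.continuous_fderiv_apply w)

theorem jac_pos {w : ℝ × ℝ} (hw : T.rho * ‖w‖ < 1) (x : ℝ × ℝ) : 0 < T.jac w x := by
  have h : |fderiv ℝ T.τ x w| ≤ T.rho * ‖w‖ := ((fderiv ℝ T.τ x).le_opNorm w).trans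
    (mul_le_mul_of_nonneg_right (T.norm_fderiv_le_rho x) (norm_nonneg w))
  unfold jac
  linarith [neg_abs_le (fderiv ℝ T.τ x w)]

theorem measurable_shift (w : ℝ × ℝ) : Measurable (T.shift w) := by
  have := T.continuous
  exact Continuous.measurable (by unfold shift; fun_prop)

theorem injective_shift {w : ℝ × ℝ} (hw : T.rho * ‖w‖ < 1) : Function.Injective (T.shift w) := by
  intro x y hxy
  by_contra hne
  have hsub : x - y = (T.τ y - T.τ x) • w := by
    simp only [shift] at hxy
    rw [sub_smul]
    linear_combination (exp := 1) hxy
  have hnorm : ‖x - y‖ = |T.τ x - T.τ y| * ‖w‖ := by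
    rw [abs_sub_comm, ← Real.norm_eq_abs, ← norm_smul, ← hsub]
  have hle := mul_le_mul_of_nonneg_right (T.abs_sub_le_rho x y) (norm_nonneg w)
  have hpos : 0 < ‖x - y‖ := norm_pos_iff.2 (sub_ne_zero.2 hne)
  nlinarith

theorem surjective_shift {w : ℝ × ℝ} (hw : T.rho * ‖w‖ < 1) :
    Function.Surjective (T.shift w) := by
  intro y
  have hc : ContractingWith (T.rho * ‖w‖).toNNReal fun x => y - T.τ x • w := by
    refine ⟨by simpa using hw, LipschitzWith.of_dist_le_mul fun a b => ?_⟩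
    rw [dist_eq_norm, dist_eq_norm, sub_sub_sub_cancel_left, ← sub_smul, norm_smul,
      Real.norm_eq_abs, abs_sub_comm]
    calc _ ≤ T.rho * ‖a - b‖ * ‖w‖ :=
          mul_le_mul_of_nonneg_right (T.abs_sub_le_rho a b) (norm_nonneg w)
      _ = _ := by
        rw [Real.coe_toNNReal _ (mul_nonneg T.rho_nonneg (norm_nonneg w))]; ring
  refine ⟨ContractingWith.fixedPoint _ hc, ?_⟩
  have := hc.fixedPoint_isFixedPt
  unfold shift
  nth_rw 1 [← this.eq]
  simp

theorem hasFDerivAt_shift (w x : ℝ × ℝ) : HasFDerivAt (T.shift w)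
    (ContinuousLinearMap.id ℝ (ℝ × ℝ) + (fderiv ℝ T.τ x).smulRight w) x :=
  (hasFDerivAt_id x).add ((T.differentiable x).hasFDerivAt.smul_const w)

theorem measurePreserving_shift {w : ℝ × ℝ} (hw : T.rho * ‖w‖ < 1) :
    MeasurePreserving (T.shift w)
      (volume.withDensity fun x => ENNReal.ofReal (T.jac w x)) volume := by
  refine ⟨T.measurable_shift w, ?_⟩
  have hdet : ∀ x, (ContinuousLinearMap.id ℝ (ℝ × ℝ) + (fderiv ℝ T.τ x).smulRight w).det =
      T.jac w x := fun x =>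
    LinearMap.transvection.det (fderiv ℝ T.τ x : (ℝ × ℝ) →ₗ[ℝ] ℝ) w
  have h := map_withDensity_abs_det_fderiv_eq_addHaar (volume : Measure (ℝ × ℝ))
    (s := univ) MeasurableSet.univ.nullMeasurableSet
    (fun x _ => (T.hasFDerivAt_shift w x).hasFDerivWithinAt) (T.injective_shift hw).injOn
  rw [image_univ, (T.surjective_shift hw).range_eq, Measure.restrict_univ] at h
  simp_rw [hdet, abs_of_pos (T.jac_pos hw _)] at h
  exact h

end Cutoff

theorem deriv_smoothTransition_of_notMem_Icc {x : ℝ} (hx : x ∉ Icc (0 : ℝ) 1) :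
    deriv Real.smoothTransition x = 0 := by
  rcases lt_or_ge x 0 with h | h
  · have : Real.smoothTransition =ᶠ[𝓝 x] fun _ => 0 :=
      (eventually_lt_nhds h).mono fun u hu => Real.smoothTransition.zero_of_nonpos hu.le
    rw [this.deriv_eq, deriv_const]
  · have : Real.smoothTransition =ᶠ[𝓝 x] fun _ => 1 :=
      (eventually_gt_nhds (not_le.1 fun h1 => hx ⟨h, h1⟩)).mono fun u hu =>
        Real.smoothTransition.one_of_one_le (le_of_lt hu)
    rw [this.deriv_eq, deriv_const]

theorem exists_abs_deriv_smoothTransition_le :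
    ∃ K : ℝ, ∀ x, |deriv Real.smoothTransition x| ≤ K := by
  have hc : Continuous (deriv Real.smoothTransition) :=
    (Real.smoothTransition.contDiff (n := 1)).continuous_deriv le_rfl
  obtain ⟨K, hK⟩ := (isCompact_Icc (a := (0 : ℝ)) (b := 1)).exists_bound_of_continuousOn
    hc.continuousOn
  refine ⟨K, fun x => ?_⟩
  by_cases hx : x ∈ Icc (0 : ℝ) 1
  · exact hK x hx
  · rw [deriv_smoothTransition_of_notMem_Icc hx, abs_zero]
    exact (norm_nonneg _).trans (hK 0 ⟨le_rfl, zero_le_one⟩)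

theorem exists_hasFDerivAt_euclidSq (x : ℝ × ℝ) :
    ∃ A : ℝ × ℝ →L[ℝ] ℝ, HasFDerivAt euclidSq A x ∧ ‖A‖ ≤ 4 * ‖x‖ := by
  refine ⟨(2 * x.1) • ContinuousLinearMap.fst ℝ ℝ ℝ + (2 * x.2) • ContinuousLinearMap.snd ℝ ℝ ℝ,
    ?_, ?_⟩
  · refine (((hasFDerivAt_fst (𝕜 := ℝ) (p := x)).pow 2).add
      ((hasFDerivAt_snd (𝕜 := ℝ) (p := x)).pow 2)).congr_fderiv ?_
    ext <;> simp
  · refine (norm_add_le _ _).trans ?_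
    rw [norm_smul, norm_smul, norm_mul, norm_mul, Real.norm_two]
    have hfst : 2 * ‖x.1‖ * ‖ContinuousLinearMap.fst ℝ ℝ ℝ‖ ≤ 2 * ‖x‖ * 1 := by
      gcongr
      exacts [norm_fst_le x, ContinuousLinearMap.norm_fst_le ..]
    have hsnd : 2 * ‖x.2‖ * ‖ContinuousLinearMap.snd ℝ ℝ ℝ‖ ≤ 2 * ‖x‖ * 1 := by
      gcongr
      exacts [norm_snd_le x, ContinuousLinearMap.norm_snd_le ..]
    linarith

/-- The logarithmic cutoff `1 - θ(log (1 + |x|²) / L - 1)` for the smooth transition `θ`: in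
dimension two, only a logarithmic profile has a gradient whose square has a small integral. -/
def logProfile (L : ℝ) (x : ℝ × ℝ) : ℝ :=
  1 - Real.smoothTransition (Real.log (1 + euclidSq x) / L - 1)

theorem one_add_euclidSq_pos (x : ℝ × ℝ) : 0 < 1 + euclidSq x :=
  add_pos_of_pos_of_nonneg one_pos (euclidSq_nonneg x)

theorem contDiff_logProfile (L : ℝ) : ContDiff ℝ 1 (logProfile L) := by
  have hpos : ∀ x, 1 + euclidSq x ≠ 0 := fun x => (one_add_euclidSq_pos x).ne'
  refine contDiff_const.sub ((Real.smoothTransition.contDiff (n := 1)).comp ?_)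
  refine ContDiff.sub (ContDiff.div_const (ContDiff.log ?_ hpos) _) contDiff_const
  unfold euclidSq
  fun_prop

theorem norm_fderiv_logProfile_le {L K : ℝ} (hL : 0 < L)
    (hK : ∀ x, |deriv Real.smoothTransition x| ≤ K) (x : ℝ × ℝ) :
    ‖fderiv ℝ (logProfile L) x‖ ≤ (8 * K / L) / (1 + ‖x‖) := by
  have hK0 : 0 ≤ K := (abs_nonneg _).trans (hK 0)
  have hpos := one_add_euclidSq_pos x
  obtain ⟨A, hA, hAnorm⟩ := exists_hasFDerivAt_euclidSq x
  have hlog := (((hA.const_add 1).log hpos.ne').mul_const L⁻¹).sub_const 1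
  have hderiv : HasFDerivAt (logProfile L) _ x :=
    (((Real.smoothTransition.contDiff (n := 1)).differentiable one_ne_zero
      _).hasDerivAt.comp_hasFDerivAt x hlog).const_sub 1
  rw [hderiv.fderiv, norm_neg, norm_smul, norm_smul, norm_smul, Real.norm_eq_abs,
    Real.norm_of_nonneg (inv_nonneg.2 hL.le), Real.norm_of_nonneg (inv_nonneg.2 hpos.le)]
  have hdecay : (1 + euclidSq x)⁻¹ * (4 * ‖x‖) ≤ 8 / (1 + ‖x‖) := by
    rw [inv_mul_eq_div, div_le_div_iff₀ hpos (by positivity)]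
    nlinarith [norm_sq_le_euclidSq x, sq_nonneg (‖x‖ - 1)]
  calc _ ≤ K * (L⁻¹ * ((1 + euclidSq x)⁻¹ * (4 * ‖x‖))) := by
        gcongr
        exact hK _
    _ ≤ K * (L⁻¹ * (8 / (1 + ‖x‖))) := by gcongr
    _ = _ := by field_simp

theorem logProfile_eq_one {L : ℝ} (hL : 0 < L) {x : ℝ × ℝ}
    (hx : 1 + euclidSq x ≤ Real.exp L) : logProfile L x = 1 := by
  rw [logProfile, Real.smoothTransition.zero_of_nonpos, sub_zero]
  rw [sub_nonpos, div_le_one hL, Real.log_le_iff_le_exp (one_add_euclidSq_pos x)]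
  exact hx

theorem logProfile_eq_zero {L : ℝ} (hL : 0 < L) {x : ℝ × ℝ}
    (hx : Real.exp (2 * L) ≤ 1 + euclidSq x) : logProfile L x = 0 := by
  rw [logProfile, Real.smoothTransition.one_of_one_le, sub_self]
  rw [le_sub_iff_add_le, le_div_iff₀ hL, Real.le_log_iff_exp_le (one_add_euclidSq_pos x)]
  exact (by norm_num : (1 + 1 : ℝ) = 2) ▸ hx

theorem exists_cutoff : ∃ K : ℝ, ∀ m : ℕ, 1 ≤ m →
    ∃ T : Cutoff, T.rho = K / m ∧ T.R = 2 ^ m / 2 ∧ T.N = 4 ^ m := by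
  obtain ⟨K, hK⟩ := exists_abs_deriv_smoothTransition_le
  have hK0 : 0 ≤ K := (abs_nonneg _).trans (hK 0)
  have hlog : 0 < Real.log 4 := Real.log_pos (by norm_num)
  refine ⟨8 * K / Real.log 4, fun m hm => ?_⟩
  have hL : 0 < m * Real.log 4 := mul_pos (by exact_mod_cast hm) hlog
  have hexp : Real.exp (m * Real.log 4) = 4 ^ m := by
    rw [mul_comm, Real.exp_mul, Real.exp_log (by norm_num), Real.rpow_natCast]
  have hpow : (2 : ℝ) ≤ 4 ^ m :=
    (by norm_num : (2 : ℝ) ≤ 4).trans (le_self_pow₀ (by norm_num) (by lia))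
  have hsq : ((2 : ℝ) ^ m) ^ 2 = 4 ^ m := by rw [← pow_mul, mul_comm, pow_mul]; norm_num
  refine ⟨{
    τ := logProfile (m * Real.log 4)
    rho := 8 * K / Real.log 4 / m
    R := 2 ^ m / 2
    N := 4 ^ m
    rho_nonneg := by positivity
    nonneg := fun x => sub_nonneg.2 (Real.smoothTransition.le_one _)
    le_one := fun x => sub_le_self _ (Real.smoothTransition.nonneg _)
    contDiff := contDiff_logProfile _
    norm_fderiv_le := fun x => (norm_fderiv_logProfile_le hL hK x).trans (le_of_eq (by field_simp))
    eq_one := fun x hx => logProfile_eq_one hL ?_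
    eq_zero := fun x hx => logProfile_eq_zero hL ?_ }, rfl, rfl, rfl⟩
  · have h := pow_le_pow_left₀ (norm_nonneg x) hx 2
    rw [div_pow, hsq] at h
    linarith [euclidSq_le_two_mul_norm_sq x]
  · have h := pow_le_pow_left₀ (by positivity) hx 2
    rw [two_mul, Real.exp_add, hexp, ← sq]
    linarith [norm_sq_le_euclidSq x]

end Cutoff

theorem lintegral_pi_of_idempotent {ι P : Type*} [Fintype ι] [DecidableEq ι] [MeasurableSpace P]
    {ref : Measure P} [SigmaFinite ref] {r : ι → ι} (hr : ∀ i, r (r i) = r i) {J : P → ℝ≥0∞}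
    (hJ : Measurable J) [SigmaFinite (ref.withDensity J)] {f : P → P}
    (hf : MeasurePreserving f (ref.withDensity J) ref) {g : P → P → P}
    (hg : Measurable (Function.uncurry g)) (hg' : ∀ a, MeasurePreserving (g a) ref ref)
    {F : (ι → P) → ℝ≥0∞} (hF : Measurable F) :
    ∫⁻ y, (∏ i with r i = i, J (y i)) *
        F (fun i => if r i = i then f (y i) else g (y (r i)) (y i)) ∂(Measure.pi fun _ => ref) =
      ∫⁻ y, F y ∂(Measure.pi fun _ => ref) := by
  let p : ι → Prop := fun i => r i = i
  let E := MeasurableEquiv.piEquivPiSubtypeProd (fun _ : ι => P) p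
  have hE : MeasurePreserving E.symm _ _ :=
    (measurePreserving_piEquivPiSubtypeProd (fun _ : ι => ref) p).symm
  let rep : ι → Subtype p := fun i => ⟨r i, hr i⟩
  have hskew := (measurePreserving_pi (ι := Subtype p) (fun _ => _) (fun _ => _)
    fun _ => hf).skew_product (μc := Measure.pi fun _ : {i // ¬p i} => ref)
    (μd := Measure.pi fun _ : {i // ¬p i} => ref) (g := fun a c i => g (a (rep i)) (c i))
    (measurable_pi_lambda _ fun i => hg.comp (f := fun q : (Subtype p → P) × ({i // ¬p i} → P) =>
      (q.1 (rep i), q.2 i)) (by fun_prop))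
    (Eventually.of_forall fun a => (measurePreserving_pi (ι := {i // ¬p i}) (fun _ => _)
      (fun _ => _) fun i => hg' (a (rep i))).map_eq)
  have hJp : Measurable fun a : Subtype p → P => ∏ i, J (a i) :=
    Finset.measurable_prod _ fun i _ => hJ.comp (measurable_pi_apply i)
  rw [pi_withDensity ref fun _ => hJ, prod_withDensity_left hJp] at hskew
  have hFE := hF.comp E.symm.measurable
  rw [← hE.lintegral_comp_emb E.symm.measurableEmbedding, ← hE.lintegral_comp hF]
  refine Eq.trans ?_ (hskew.lintegral_comp hFE)
  refine Eq.trans ?_ (lintegral_withDensity_eq_lintegral_mul _ (hJp.comp measurable_fst)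
    (hFE.comp hskew.measurable)).symm
  refine lintegral_congr fun ac => ?_
  have hfix : ∀ i (hi : p i), E.symm ac i = ac.1 ⟨i, hi⟩ := fun i hi => dif_pos hi
  have hmov : ∀ i (hi : ¬p i), E.symm ac i = ac.2 ⟨i, hi⟩ := fun i hi => dif_neg hi
  simp only [Pi.mul_apply, Function.comp_apply]
  congr 1
  · rw [Finset.prod_subtype (p := p) _ (fun i => by simp [p])]
    exact Finset.prod_congr rfl fun i _ => by rw [hfix i.1 i.2]
  · refine congrArg F (funext fun i => ?_)
    by_cases hi : p i
    · refine (if_pos hi).trans (Eq.trans ?_ (dif_pos hi).symm)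
      rw [hfix i hi]
    · refine (if_neg hi).trans (Eq.trans ?_ (dif_neg hi).symm)
      rw [hmov i hi, hfix (r i) (hr i)]

section Clusters

variable {ι : Type*}

/-- The graph of a set of bonds. -/
def bondGraph (B : Finset (Sym2 ι)) : SimpleGraph ι :=
  SimpleGraph.fromEdgeSet (B : Set (Sym2 ι))

/-- A representative of the cluster of an index; the clusters are the connected components of the
bond graph. -/
def clusterRep (B : Finset (Sym2 ι)) (i : ι) : ι :=
  Quot.out ((bondGraph B).connectedComponentMk i)

theorem reachable_clusterRep (B : Finset (Sym2 ι)) (i : ι) :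
    (bondGraph B).Reachable i (clusterRep B i) :=
  (SimpleGraph.ConnectedComponent.exact
    (Quot.out_eq ((bondGraph B).connectedComponentMk i))).symm

theorem clusterRep_eq_of_reachable {B : Finset (Sym2 ι)} {i j : ι}
    (h : (bondGraph B).Reachable i j) : clusterRep B i = clusterRep B j := by
  rw [clusterRep, clusterRep, SimpleGraph.ConnectedComponent.sound h]

theorem clusterRep_clusterRep (B : Finset (Sym2 ι)) (i : ι) :
    clusterRep B (clusterRep B i) = clusterRep B i :=
  (clusterRep_eq_of_reachable (reachable_clusterRep B i)).symm

theorem clusterRep_eq_of_mem {B : Finset (Sym2 ι)} {i j : ι} (h : s(i, j) ∈ B) :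
    clusterRep B i = clusterRep B j := by
  rcases eq_or_ne i j with rfl | hij
  · rfl
  · exact clusterRep_eq_of_reachable
      (SimpleGraph.Adj.reachable ((SimpleGraph.fromEdgeSet_adj _).2 ⟨h, hij⟩))

/-- The indices that represent their cluster. -/
def clusterReps [Fintype ι] [DecidableEq ι] (B : Finset (Sym2 ι)) : Finset ι :=
  Finset.univ.filter fun i => clusterRep B i = i

end Clusters

section Move

variable {S ι : Type*} (T : Cutoff) (w : ℝ × ℝ)

/-- The deformation of tuples: each cluster is translated rigidly by a multiple of `w` that depends
on the position of the representative of the cluster. -/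
def clusterMove (B : Finset (Sym2 ι)) (y : ι → Particle S) : ι → Particle S :=
  fun i => ((y i).1 + T.τ (y (clusterRep B i)).1 • w, (y i).2)

/-- The Jacobian of `clusterMove`. -/
def clusterMoveJac [Fintype ι] [DecidableEq ι] (B : Finset (Sym2 ι)) (y : ι → Particle S) : ℝ≥0∞ :=
  ∏ i ∈ clusterReps B, ENNReal.ofReal (T.jac w (y i).1)

variable [MeasurableSpace S]

theorem measurable_clusterMove (B : Finset (Sym2 ι)) :
    Measurable (clusterMove (S := S) T w B) := by
  have := T.continuous.measurable
  unfold clusterMove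
  fun_prop

theorem measurable_clusterMoveJac [Fintype ι] [DecidableEq ι] (B : Finset (Sym2 ι)) :
    Measurable (clusterMoveJac (S := S) T w B) := by
  have := (T.continuous_jac w).measurable
  unfold clusterMoveJac
  fun_prop

variable [Finite S]

theorem measurePreserving_particleShift {w : ℝ × ℝ} (hw : T.rho * ‖w‖ < 1) :
    MeasurePreserving (fun y : Particle S => (T.shift w y.1, y.2))
      ((refMeasure S).withDensity fun y => ENNReal.ofReal (T.jac w y.1)) (refMeasure S) := by
  have h := (T.measurePreserving_shift hw).prod
    (MeasurePreserving.id (ProbabilityTheory.uniformOn (univ : Set S)))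
  rwa [prod_withDensity_left (T.continuous_jac w).measurable.ennreal_ofReal] at h

theorem measurePreserving_particleTranslate (u : ℝ × ℝ) :
    MeasurePreserving (fun y : Particle S => (y.1 + u, y.2)) (refMeasure S) (refMeasure S) :=
  (measurePreserving_add_right volume u).prod (MeasurePreserving.id _)

theorem lintegral_clusterMoveJac_mul [Nonempty S] [MeasurableSingletonClass S] [Fintype ι]
    [DecidableEq ι] {w : ℝ × ℝ} (hw : T.rho * ‖w‖ < 1) (B : Finset (Sym2 ι))
    {F : (ι → Particle S) → ℝ≥0∞} (hF : Measurable F) :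
    ∫⁻ y, clusterMoveJac T w B y * F (clusterMove T w B y)
        ∂(Measure.pi fun _ => refMeasure S) =
      ∫⁻ y, F y ∂(Measure.pi fun _ => refMeasure S) := by
  have hτ := T.continuous.measurable
  have hjac := (T.continuous_jac w).measurable
  have : SigmaFinite ((refMeasure S).withDensity fun y => ENNReal.ofReal (T.jac w y.1)) :=
    SigmaFinite.withDensity_of_ne_top (by simp)
  rw [← lintegral_pi_of_idempotent (clusterRep_clusterRep B)
    (J := fun y : Particle S => ENNReal.ofReal (T.jac w y.1)) (by fun_prop)
    (measurePreserving_particleShift T hw) (g := fun a c => (c.1 + T.τ a.1 • w, c.2))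
    (by unfold Function.uncurry; fun_prop) (fun a => measurePreserving_particleTranslate _) hF]
  refine lintegral_congr fun y => congrArg (fun y' => clusterMoveJac T w B y * F y')
    (funext fun i => ?_)
  split_ifs with hi
  · simp only [clusterMove, hi, Cutoff.shift]
  · rfl

end Move

theorem prod_le_prod_add_sum {α : Type*} [DecidableEq α] (s : Finset α) (a c d : α → ℝ≥0∞)
    (h : ∀ p ∈ s, a p ≤ c p + d p) :
    ∏ p ∈ s, a p ≤ ∏ p ∈ s, c p + ∑ p ∈ s, d p * ∏ p' ∈ s.erase p, a p' := by
  induction s using Finset.induction_on with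
  | empty => simp
  | insert p₀ s hp ih =>
    have ih := ih fun p hps => h p (Finset.mem_insert_of_mem hps)
    have hp₀ : a p₀ ≤ min (a p₀) (c p₀) + d p₀ := by
      rw [← min_add_add_right]
      exact le_min le_self_add (h p₀ (Finset.mem_insert_self _ _))
    have hsum : ∑ p ∈ s, d p * ∏ p' ∈ (insert p₀ s).erase p, a p' =
        a p₀ * ∑ p ∈ s, d p * ∏ p' ∈ s.erase p, a p' := by
      rw [Finset.mul_sum]
      refine Finset.sum_congr rfl fun p hps => ?_
      rw [Finset.erase_insert_of_ne (ne_of_mem_of_not_mem hps hp).symm, Finset.prod_insert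
        (fun h => hp (Finset.mem_of_mem_erase h))]
      ring
    rw [Finset.prod_insert hp, Finset.prod_insert hp, Finset.sum_insert hp,
      Finset.erase_insert hp, hsum]
    calc a p₀ * ∏ p ∈ s, a p
        ≤ (min (a p₀) (c p₀) + d p₀) * ∏ p ∈ s, a p := by gcongr
      _ = min (a p₀) (c p₀) * ∏ p ∈ s, a p + d p₀ * ∏ p ∈ s, a p := add_mul _ _ _
      _ ≤ min (a p₀) (c p₀) * (∏ p ∈ s, c p + ∑ p ∈ s, d p * ∏ p' ∈ s.erase p, a p') +
          d p₀ * ∏ p ∈ s, a p := by gcongr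
      _ ≤ (c p₀ * ∏ p ∈ s, c p + a p₀ * ∑ p ∈ s, d p * ∏ p' ∈ s.erase p, a p') +
          d p₀ * ∏ p ∈ s, a p := by
          rw [mul_add]
          gcongr
          · exact min_le_right _ _
          · exact min_le_left _ _
      _ = _ := by ring

theorem mul_le_half_sq_add_half_sq (a b : ℝ≥0∞) : a * b ≤ 2⁻¹ * a ^ 2 + 2⁻¹ * b ^ 2 := by
  have h := ENNReal.young_inequality a b Real.HolderConjugate.two_two
  simpa only [ENNReal.rpow_two, ENNReal.ofReal_ofNat, ENNReal.div_eq_inv_mul] using h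

theorem one_le_sqrt_mul_sqrt_add_sq {d : ℝ} (hd : |d| < 1) :
    1 ≤ √(1 + d) * √(1 - d) + d ^ 2 := by
  have hd' := abs_lt.1 hd
  have hle : 1 - d ^ 2 ≤ √((1 + d) * (1 - d)) :=
    Real.le_sqrt_of_sq_le (by nlinarith [sq_nonneg d, (sq_lt_one_iff_abs_lt_one d).2 hd])
  rw [Real.sqrt_mul (by linarith)] at hle
  linarith

section Expansion

variable {S ι : Type*} (D : SoftSplit S)

/-- The product of the bond weights over a set of pairs. -/
def bondProd (B : Finset (Sym2 ι)) (y : ι → Particle S) : ℝ≥0∞ :=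
  ∏ p ∈ B, pairVal D.bond y p

/-- The product of the soft weights over a set of pairs. -/
def softProd (s : Finset (Sym2 ι)) (y : ι → Particle S) : ℝ≥0∞ :=
  ∏ p ∈ s, pairVal D.soft y p

/-- The term of the set of bonds `B` in the expansion of `tupleWeight b D.full`. -/
def splitWeight [Fintype ι] [DecidableEq ι] (b : Particle S → ℝ≥0∞) (B : Finset (Sym2 ι))
    (y : ι → Particle S) : ℝ≥0∞ :=
  (∏ i, b (y i)) * (bondProd D B y * softProd D (edges ι \ B) y)

theorem pairVal_bond_add_pairVal_soft (y : ι → Particle S) (p : Sym2 ι) :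
    pairVal D.bond y p + pairVal D.soft y p = pairVal D.full y p :=
  D.bond_add_soft _ _

theorem tupleWeight_eq_sum_splitWeight [Fintype ι] [DecidableEq ι] (b : Particle S → ℝ≥0∞)
    (y : ι → Particle S) :
    tupleWeight b D.full y = ∑ B ∈ (edges ι).powerset, splitWeight D b B y := by
  simp only [tupleWeight, splitWeight, pairProd, bondProd, softProd, ← Finset.mul_sum,
    ← Finset.prod_add, pairVal_bond_add_pairVal_soft]

section Measurability

variable [MeasurableSpace S] [MeasurableSingletonClass S] [Countable S]

theorem measurable_bondProd (B : Finset (Sym2 ι)) : Measurable (bondProd D B) :=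
  Finset.measurable_prod _ fun _ _ => measurable_pairVal D.measurable_bond _

theorem measurable_softProd (s : Finset (Sym2 ι)) : Measurable (softProd D s) :=
  Finset.measurable_prod _ fun _ _ => measurable_pairVal D.measurable_soft _

theorem measurable_splitWeight [Fintype ι] [DecidableEq ι] {b : Particle S → ℝ≥0∞}
    (hb : Measurable b) (B : Finset (Sym2 ι)) : Measurable (splitWeight D b B) :=
  (Finset.measurable_prod _ fun i _ => hb.comp (measurable_pi_apply i)).mul
    ((measurable_bondProd D B).mul (measurable_softProd D _))

end Measurability

variable (T : Cutoff) (w : ℝ × ℝ)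

theorem bondProd_clusterMove (B : Finset (Sym2 ι)) (y : ι → Particle S) :
    bondProd D B (clusterMove T w B y) = bondProd D B y := by
  refine Finset.prod_congr rfl fun p hp => ?_
  have h : s((Quot.out p).1, (Quot.out p).2) ∈ B := (congrArg (· ∈ B) (Quot.out_eq p)).mpr hp
  simp only [pairVal, SoftSplit.bond, SoftSplit.full, SoftSplit.soft, clusterMove,
    clusterRep_eq_of_mem h, add_sub_add_right_eq_sub]

/-- The squared difference of the displacement factors of the members of a pair. -/
def gapSq (B : Finset (Sym2 ι)) (y : ι → Particle S) (p : Sym2 ι) : ℝ :=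
  pairVal (fun a b : ℝ => (a - b) ^ 2) (fun i => T.τ (y (clusterRep B i)).1) p

/-- The second-order loss in the soft weight of a pair that is caused by `clusterMove`. -/
def pairLoss (B : Finset (Sym2 ι)) (y : ι → Particle S) (p : Sym2 ι) : ℝ≥0∞ :=
  ENNReal.ofReal (D.C * ‖w‖ ^ 2 * gapSq T B y p) * pairVal (nearIndicator (D.r + ‖w‖)) y p

/-- The second-order loss in the Jacobian that is caused by one particle. -/
def jacLoss (y : Particle S) : ℝ≥0∞ := ENNReal.ofReal ((fderiv ℝ T.τ y.1 w) ^ 2)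

/-- The square root of the soft weight of a pair after `clusterMove`. -/
def rootMove (B : Finset (Sym2 ι)) (y : ι → Particle S) (p : Sym2 ι) : ℝ :=
  D.q (y (Quot.out p).1).2 (y (Quot.out p).2).2
    ((y (Quot.out p).1).1 - (y (Quot.out p).2).1 +
      (T.τ (y (clusterRep B (Quot.out p).1)).1 - T.τ (y (clusterRep B (Quot.out p).2)).1) • w)

/-- The geometric mean of the Jacobians of `clusterMove` in the directions `w` and `-w`. -/
def jacMean [Fintype ι] [DecidableEq ι] (B : Finset (Sym2 ι)) (y : ι → Particle S) : ℝ≥0∞ :=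
  ∏ i ∈ clusterReps B,
    (ENNReal.ofReal √(T.jac w (y i).1) * ENNReal.ofReal √(T.jac (-w) (y i).1))

theorem pairVal_soft_clusterMove (B : Finset (Sym2 ι)) (y : ι → Particle S) (p : Sym2 ι) :
    pairVal D.soft (clusterMove T w B y) p = ENNReal.ofReal (rootMove D T w B y p) ^ 2 := by
  rw [rootMove, ← ENNReal.ofReal_pow (D.q_nonneg _ _ _), pairVal, SoftSplit.soft]
  congr 3
  simp only [clusterMove, sub_smul]
  abel

theorem pairVal_soft_le (B : Finset (Sym2 ι)) (y : ι → Particle S) (p : Sym2 ι) :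
    pairVal D.soft y p ≤ ENNReal.ofReal (rootMove D T w B y p) *
      ENNReal.ofReal (rootMove D T (-w) B y p) + pairLoss D T w B y p := by
  set i := (Quot.out p).1
  set j := (Quot.out p).2
  set x := (y i).1 - (y j).1
  set t := T.τ (y (clusterRep B i)).1 - T.τ (y (clusterRep B j)).1
  have hplus : rootMove D T w B y p = D.q (y i).2 (y j).2 (x + t • w) := rfl
  have hminus : rootMove D T (-w) B y p = D.q (y i).2 (y j).2 (x - t • w) := by
    rw [sub_eq_add_neg, ← smul_neg]; rfl
  have hsoft : pairVal D.soft y p = ENNReal.ofReal (D.q (y i).2 (y j).2 x ^ 2) := rfl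
  have hloss : pairLoss D T w B y p = ENNReal.ofReal (D.C * ‖w‖ ^ 2 * t ^ 2) *
      (Metric.closedBall (0 : ℝ × ℝ) (D.r + ‖w‖)).indicator 1 x := rfl
  have htw : ‖t • w‖ ≤ ‖w‖ := by
    refine (norm_smul_le _ _).trans (mul_le_of_le_one_left (norm_nonneg _) (abs_le.2 ?_))
    constructor <;> linarith [T.nonneg (y (clusterRep B i)).1, T.nonneg (y (clusterRep B j)).1,
      T.le_one (y (clusterRep B i)).1, T.le_one (y (clusterRep B j)).1]
  rw [hplus, hminus, hsoft, hloss, ← ENNReal.ofReal_mul (D.q_nonneg _ _ _)]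
  by_cases hnear : ‖x‖ ≤ D.r + ‖w‖
  · rw [indicator_of_mem (mem_closedBall_zero_iff.2 hnear), Pi.one_apply, mul_one,
      ← ENNReal.ofReal_add (mul_nonneg (D.q_nonneg _ _ _) (D.q_nonneg _ _ _))
        (mul_nonneg (mul_nonneg D.C_nonneg (sq_nonneg _)) (sq_nonneg _))]
    refine ENNReal.ofReal_le_ofReal ?_
    have h := D.q_sq_sub_le (y i).2 (y j).2 x (t • w)
    rw [norm_smul, mul_pow, Real.norm_eq_abs, sq_abs] at h
    linarith
  · have hplus_far := norm_sub_norm_le x (-(t • w))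
    have hminus_far := norm_sub_norm_le x (t • w)
    rw [norm_neg, sub_neg_eq_add] at hplus_far
    rw [D.q_far _ _ x (by linarith [norm_nonneg w]), D.q_far _ _ (x + t • w) (by linarith),
      D.q_far _ _ (x - t • w) (by linarith)]
    simp

theorem softProd_le_prod_rootMove_add [DecidableEq ι] (s B : Finset (Sym2 ι)) (y : ι → Particle S) :
    softProd D s y ≤ (∏ p ∈ s, ENNReal.ofReal (rootMove D T w B y p)) *
        (∏ p ∈ s, ENNReal.ofReal (rootMove D T (-w) B y p)) +
      ∑ p ∈ s, pairLoss D T w B y p * softProd D (s.erase p) y := by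
  rw [← Finset.prod_mul_distrib]
  exact prod_le_prod_add_sum s _ _ _ fun p _ => pairVal_soft_le D T w B y p

variable {T w} [Fintype ι] [DecidableEq ι]

theorem sq_prod_rootMove_mul_prod_sqrt_jac (hw : T.rho * ‖w‖ < 1) (s B : Finset (Sym2 ι))
    (y : ι → Particle S) :
    ((∏ i ∈ clusterReps B, ENNReal.ofReal √(T.jac w (y i).1)) *
        ∏ p ∈ s, ENNReal.ofReal (rootMove D T w B y p)) ^ 2 =
      clusterMoveJac T w B y * softProd D s (clusterMove T w B y) := by
  rw [mul_pow, ← Finset.prod_pow, ← Finset.prod_pow, clusterMoveJac, softProd]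
  congr 1
  · refine Finset.prod_congr rfl fun i _ => ?_
    rw [← ENNReal.ofReal_pow (Real.sqrt_nonneg _), Real.sq_sqrt (T.jac_pos hw _).le]
  · exact Finset.prod_congr rfl fun p _ => (pairVal_soft_clusterMove D T w B y p).symm

theorem ofReal_sqrt_jac_mul_le_one (hw : T.rho * ‖w‖ < 1) (x : ℝ × ℝ) :
    ENNReal.ofReal √(T.jac w x) * ENNReal.ofReal √(T.jac (-w) x) ≤ 1 := by
  rw [← ENNReal.ofReal_mul (Real.sqrt_nonneg _), ← Real.sqrt_mul (T.jac_pos hw x).le]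
  refine ENNReal.ofReal_le_one.2 (Real.sqrt_le_one.2 ?_)
  rw [Cutoff.jac, Cutoff.jac, map_neg]
  nlinarith [sq_nonneg (fderiv ℝ T.τ x w)]

theorem one_le_ofReal_sqrt_jac_mul_add (hw : T.rho * ‖w‖ < 1) (y : Particle S) :
    1 ≤ ENNReal.ofReal √(T.jac w y.1) * ENNReal.ofReal √(T.jac (-w) y.1) + jacLoss T w y := by
  have hd : |fderiv ℝ T.τ y.1 w| < 1 :=
    (((fderiv ℝ T.τ y.1).le_opNorm w).trans (mul_le_mul_of_nonneg_right
      (T.norm_fderiv_le_rho _) (norm_nonneg w))).trans_lt hw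
  rw [← ENNReal.ofReal_mul (Real.sqrt_nonneg _), jacLoss, ← ENNReal.ofReal_add
    (mul_nonneg (Real.sqrt_nonneg _) (Real.sqrt_nonneg _)) (sq_nonneg _), ENNReal.one_le_ofReal,
    Cutoff.jac, Cutoff.jac, map_neg, ← sub_eq_add_neg]
  exact one_le_sqrt_mul_sqrt_add_sq hd

theorem jacMean_le_one (hw : T.rho * ‖w‖ < 1) (B : Finset (Sym2 ι)) (y : ι → Particle S) :
    jacMean T w B y ≤ 1 :=
  Finset.prod_le_one' fun _ _ => ofReal_sqrt_jac_mul_le_one hw _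

theorem one_le_jacMean_add_sum (hw : T.rho * ‖w‖ < 1) (B : Finset (Sym2 ι))
    (y : ι → Particle S) : 1 ≤ jacMean T w B y + ∑ i, jacLoss T w (y i) := by
  have h := prod_le_prod_add_sum (clusterReps B) (fun _ => 1) _ (fun i => jacLoss T w (y i))
    fun i _ => one_le_ofReal_sqrt_jac_mul_add hw (y i)
  simp only [Finset.prod_const_one, mul_one] at h
  refine h.trans (add_le_add_right (Finset.sum_le_sum_of_subset (Finset.subset_univ _)) _)

theorem softProd_le_of_clusterMove (hw : T.rho * ‖w‖ < 1) (s B : Finset (Sym2 ι))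
    (y : ι → Particle S) :
    softProd D s y ≤
      2⁻¹ * (clusterMoveJac T w B y * softProd D s (clusterMove T w B y)) +
      2⁻¹ * (clusterMoveJac T (-w) B y * softProd D s (clusterMove T (-w) B y)) +
      (∑ p ∈ s, pairLoss D T w B y p * softProd D (s.erase p) y) +
      softProd D s y * ∑ i, jacLoss T w (y i) := by
  let L := ∑ p ∈ s, pairLoss D T w B y p * softProd D (s.erase p) y
  let M := softProd D s y * ∑ i, jacLoss T w (y i)
  let J : ℝ × ℝ → ℝ≥0∞ := fun u => ∏ i ∈ clusterReps B, ENNReal.ofReal √(T.jac u (y i).1)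
  let Q : ℝ × ℝ → ℝ≥0∞ := fun u => ∏ p ∈ s, ENNReal.ofReal (rootMove D T u B y p)
  have hmean : jacMean T w B y = J w * J (-w) := Finset.prod_mul_distrib
  calc softProd D s y
      ≤ softProd D s y * (jacMean T w B y + ∑ i, jacLoss T w (y i)) :=
        le_mul_of_one_le_right' (one_le_jacMean_add_sum hw B y)
    _ = jacMean T w B y * softProd D s y + M := by ring
    _ ≤ jacMean T w B y * (Q w * Q (-w) + L) + M := by
        gcongr; exact softProd_le_prod_rootMove_add D T w s B y
    _ = J w * Q w * (J (-w) * Q (-w)) + jacMean T w B y * L + M := by rw [hmean]; ring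
    _ ≤ 2⁻¹ * (J w * Q w) ^ 2 + 2⁻¹ * (J (-w) * Q (-w)) ^ 2 + L + M := by
        gcongr
        · exact mul_le_half_sq_add_half_sq _ _
        · exact mul_le_of_le_one_left' (jacMean_le_one hw B y)
    _ = _ := by
        rw [sq_prod_rootMove_mul_prod_sqrt_jac D hw,
          sq_prod_rootMove_mul_prod_sqrt_jac D (by rwa [norm_neg])]

end Expansion

section Paths

variable {ι : Type*}

theorem mk_castSucc_succ_injective {l : ℕ} {f : Fin (l + 1) → ι} (hf : Function.Injective f) :
    Function.Injective fun a : Fin l => s(f a.castSucc, f a.succ) := by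
  intro a b hab
  rcases Sym2.eq_iff.1 hab with ⟨h, -⟩ | ⟨h, h'⟩
  · exact Fin.castSucc_injective _ (hf h)
  · have hab := congrArg Fin.val (hf h)
    have hba := congrArg Fin.val (hf h')
    simp only [Fin.val_castSucc, Fin.val_succ] at hab hba
    lia

variable [DecidableEq ι]

/-- The set of bonds of a path, which is given by the sequence of its vertices. -/
def pathEdges {l : ℕ} (f : Fin (l + 1) → ι) : Finset (Sym2 ι) :=
  Finset.univ.image fun a : Fin l => s(f a.castSucc, f a.succ)

theorem pathEdges_subset_iff {l : ℕ} {f : Fin (l + 1) → ι} {B : Finset (Sym2 ι)} :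
    pathEdges f ⊆ B ↔ ∀ a : Fin l, s(f a.castSucc, f a.succ) ∈ B := by
  simp [pathEdges, Finset.image_subset_iff]

theorem notMem_pathEdges {l : ℕ} {f : Fin (l + 1) → ι} {i : ι} (hi : ∀ a, f a ≠ i) (j : ι) :
    s(i, j) ∉ pathEdges f := by
  intro h
  obtain ⟨a, -, ha⟩ := Finset.mem_image.1 h
  rcases Sym2.eq_iff.1 ha with ⟨h', -⟩ | ⟨-, h'⟩
  exacts [hi _ h', hi _ h']

theorem pathEdges_subset_edges [Fintype ι] {l : ℕ} {f : Fin (l + 1) → ι}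
    (hf : Function.Injective f) : pathEdges f ⊆ edges ι :=
  pathEdges_subset_iff.2 fun a => mk_mem_edges.2 (hf.ne a.castSucc_lt_succ.ne)

theorem exists_path_embedding {B : Finset (Sym2 ι)} {i j : ι} (h : (bondGraph B).Reachable i j) :
    ∃ (l : ℕ) (f : Fin (l + 1) ↪ ι), f 0 = i ∧ f (Fin.last l) = j ∧ pathEdges f ⊆ B ∧
      ∀ a, (bondGraph B).Reachable i (f a) := by
  obtain ⟨w, hw⟩ := h.exists_isPath
  refine ⟨w.length, ⟨fun a => w.getVert a, fun a b hab => Fin.ext ?_⟩, w.getVert_zero,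
    w.getVert_length, pathEdges_subset_iff.2 fun a => ?_, fun a => ⟨w.take a⟩⟩
  · exact hw.getVert_injOn (Nat.lt_succ_iff.1 a.2) (Nat.lt_succ_iff.1 b.2) hab
  · exact ((SimpleGraph.fromEdgeSet_adj _).1 (w.adj_getVert_succ a.2)).1

variable {S : Type*} (D : SoftSplit S)

theorem prod_pathEdges {l : ℕ} {f : Fin (l + 1) → ι} (hf : Function.Injective f)
    (y : ι → Particle S) :
    ∏ p ∈ pathEdges f, pairVal D.bond y p =
      ∏ a : Fin l, D.bond (y (f a.castSucc)) (y (f a.succ)) := by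
  rw [pathEdges, Finset.prod_image fun a _ b _ h => mk_castSucc_succ_injective hf h]
  exact Finset.prod_congr rfl fun a _ => pairVal_mk D.bond_symm _ _ _

variable {D} {B : Finset (Sym2 ι)} {y : ι → Particle S}

theorem norm_sub_le_of_path (hB : bondProd D B y ≠ 0) {l : ℕ} {f : Fin (l + 1) → ι}
    (h : pathEdges f ⊆ B) (a : Fin (l + 1)) : ‖(y (f 0)).1 - (y (f a)).1‖ ≤ (a : ℕ) * D.r := by
  have hbond : ∀ a : Fin l, ‖(y (f a.castSucc)).1 - (y (f a.succ)).1‖ ≤ D.r := by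
    intro a
    by_contra! hfar
    refine hB (Finset.prod_eq_zero (pathEdges_subset_iff.1 h a) ?_)
    rw [pairVal_mk D.bond_symm]
    exact D.bond_eq_zero hfar.le
  induction a using Fin.induction with
  | zero => simp
  | succ a ih =>
    have htri := norm_sub_le_norm_sub_add_norm_sub (y (f 0)).1 (y (f a.castSucc)).1 (y (f a.succ)).1
    simp only [Fin.val_castSucc, Fin.val_succ] at ih ⊢
    push_cast
    linarith [hbond a]

end Paths

section MarkedSums

variable {S ι κ : Type*} (D : SoftSplit S)

theorem prod_pairVal_full_le [Fintype κ] [DecidableEq κ] (g : κ ↪ ι) {s : Finset (Sym2 ι)}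
    (hs : ∀ i j, i ≠ j → s(g i, g j) ∈ s) (y : ι → Particle S) :
    ∏ p ∈ s, pairVal D.full y p ≤ pairProd D.full (y ∘ g) := by
  classical
  have himage : pairProd D.full (y ∘ g) =
      ∏ p ∈ (edges κ).image (Sym2.map g), pairVal D.full y p := by
    rw [Finset.prod_image fun a _ b _ h => Sym2.map.injective g.injective h]
    refine Finset.prod_congr rfl fun p _ => ?_
    induction p using Sym2.inductionOn with
    | hf i j =>
      rw [Sym2.map_mk, pairVal_mk D.full_symm, pairVal_mk D.full_symm]
      rfl
  rw [himage]
  refine Finset.prod_le_prod_of_subset_of_le_one' (Finset.image_subset_iff.2 fun p hp => ?_)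
    fun p _ _ => D.full_le_one _ _
  induction p using Sym2.inductionOn with
  | hf i j => exact hs i j (mk_mem_edges.1 hp)

theorem prod_le_mul_prod_comp [Fintype ι] [Fintype κ] {b : Particle S → ℝ≥0∞} (hb : ∀ y, b y ≤ 1)
    {i₀ : ι} {g : κ ↪ ι} (hi₀ : ∀ j, i₀ ≠ g j) (y : ι → Particle S) :
    ∏ i, b (y i) ≤ b (y i₀) * ∏ j, b ((y ∘ g) j) := by
  classical
  have hmap : ∏ j, b ((y ∘ g) j) = ∏ i ∈ Finset.univ.map g, b (y i) := by
    rw [Finset.prod_map]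
    rfl
  have hnotMem : i₀ ∉ Finset.univ.map g := by
    simp only [Finset.mem_map, Finset.mem_univ, true_and, not_exists]
    exact fun j h => hi₀ j h.symm
  rw [hmap, ← Finset.prod_insert (f := fun i => b (y i)) hnotMem]
  exact Finset.prod_le_prod_of_subset_of_le_one' (Finset.subset_univ _) fun i _ _ => hb _

variable [Fintype ι] [DecidableEq ι] (b : Particle S → ℝ≥0∞)

/-- The total weight of the sets of bonds between `t` and `E`. -/
def pinnedWeight (E t : Finset (Sym2 ι)) (y : ι → Particle S) : ℝ≥0∞ :=
  ∑ B ∈ E.powerset with t ⊆ B, (∏ i, b (y i)) * (bondProd D B y * softProd D (E \ B) y)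

theorem pinnedWeight_eq {E t : Finset (Sym2 ι)} (ht : t ⊆ E) (y : ι → Particle S) :
    pinnedWeight D b E t y =
      (∏ i, b (y i)) * ((∏ p ∈ t, pairVal D.bond y p) * ∏ p ∈ E \ t, pairVal D.full y p) := by
  simp only [pinnedWeight, bondProd, softProd, ← Finset.mul_sum,
    sum_powerset_filter_subset_prod_mul_prod ht, pairVal_bond_add_pairVal_soft]

variable [Fintype κ] [DecidableEq κ]

variable {b}

theorem pinnedWeight_le (hb : ∀ y, b y ≤ 1) {E t : Finset (Sym2 ι)} (ht : t ⊆ E) {i₀ : ι}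
    {g : κ ↪ ι} (hi₀ : ∀ j, i₀ ≠ g j) (hg : ∀ i j, i ≠ j → s(g i, g j) ∈ E \ t)
    (y : ι → Particle S) :
    pinnedWeight D b E t y ≤
      b (y i₀) * (∏ p ∈ t, pairVal D.bond y p) * tupleWeight b D.full (y ∘ g) := by
  calc pinnedWeight D b E t y
      = (∏ i, b (y i)) * ((∏ p ∈ t, pairVal D.bond y p) * ∏ p ∈ E \ t, pairVal D.full y p) :=
        pinnedWeight_eq D b ht y
    _ ≤ (b (y i₀) * ∏ j, b ((y ∘ g) j)) *
        ((∏ p ∈ t, pairVal D.bond y p) * pairProd D.full (y ∘ g)) := by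
        gcongr
        exacts [prod_le_mul_prod_comp hb hi₀ y, prod_pairVal_full_le D g hg y]
    _ = _ := by rw [tupleWeight]; ring

variable (b)

/-- The total weight of the sets of bonds that contain a given path, weighted by the value of `K`
at the starting point of the path. -/
def pathTerm {l : ℕ} (K : Particle S → ℝ≥0∞) (f : Fin (l + 1) ↪ ι) (y : ι → Particle S) : ℝ≥0∞ :=
  K (y (f 0)) * pinnedWeight D b (edges ι) (pathEdges f) y

/-- The total weight of the sets of bonds that contain the path `f 1, f 2, …` and avoid the pair
`s(f 0, f 1)`, where the weight of this pair is replaced by `K` and the indicator that the pair is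
`ρ`-near. -/
def pairTerm {l : ℕ} (ρ : ℝ) (K : Particle S → ℝ≥0∞) (f : Fin (l + 2) ↪ ι) (y : ι → Particle S) :
    ℝ≥0∞ :=
  K (y (f 0)) * nearIndicator ρ (y (f 0)) (y (f 1)) *
    pinnedWeight D b ((edges ι).erase s(f 0, f 1)) (pathEdges (Fin.tail f)) y

variable {b}

theorem pathTerm_le (hb : ∀ y, b y ≤ 1) {l : ℕ} (K : Particle S → ℝ≥0∞) (f : Fin (l + 1) ↪ ι)
    (g : κ ↪ ι) (hfg : ∀ i j, f i ≠ g j) (y : ι → Particle S) :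
    pathTerm D b K f y ≤ (b ((y ∘ f) 0) * K ((y ∘ f) 0) *
      ∏ a : Fin l, D.bond ((y ∘ f) a.castSucc) ((y ∘ f) a.succ)) *
      tupleWeight b D.full (y ∘ g) := by
  have hpinned := pinnedWeight_le D hb (pathEdges_subset_edges f.injective) (hfg 0)
    (fun i j hij => Finset.mem_sdiff.2
      ⟨mk_mem_edges.2 (g.injective.ne hij), notMem_pathEdges (fun a => hfg a i) _⟩) y
  rw [prod_pathEdges D f.injective] at hpinned
  refine (mul_le_mul_right hpinned _).trans (le_of_eq ?_)
  simp only [Function.comp_apply]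
  ring

theorem pairTerm_le (hb : ∀ y, b y ≤ 1) {l : ℕ} (ρ : ℝ) (K : Particle S → ℝ≥0∞)
    (f : Fin (l + 2) ↪ ι) (g : κ ↪ ι) (hfg : ∀ i j, f i ≠ g j) (y : ι → Particle S) :
    pairTerm D b ρ K f y ≤ (b ((y ∘ f) 0) * K ((y ∘ f) 0) *
      (nearIndicator ρ ((y ∘ f) 0) ((y ∘ f) 1) *
        ∏ a : Fin l, D.bond ((y ∘ f) a.castSucc.succ) ((y ∘ f) a.succ.succ))) *
      tupleWeight b D.full (y ∘ g) := by
  have hinj : Function.Injective (Fin.tail f) := f.injective.comp (Fin.succ_injective _)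
  have hsub : pathEdges (Fin.tail f) ⊆ (edges ι).erase s(f 0, f 1) :=
    Finset.subset_erase.2 ⟨pathEdges_subset_edges hinj,
      notMem_pathEdges (fun a => f.injective.ne (Fin.succ_ne_zero a)) _⟩
  have hpinned := pinnedWeight_le D hb hsub (hfg 0) (fun i j hij => Finset.mem_sdiff.2
    ⟨Finset.mem_erase.2 ⟨fun h => ?_, mk_mem_edges.2 (g.injective.ne hij)⟩,
      notMem_pathEdges (fun a => hfg a.succ i) _⟩) y
  · rw [prod_pathEdges D hinj] at hpinned
    refine (mul_le_mul_right hpinned _).trans (le_of_eq ?_)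
    simp only [Function.comp_apply, Fin.tail]
    ring
  · rcases Sym2.eq_iff.1 h with ⟨h', -⟩ | ⟨h', -⟩
    exacts [hfg _ _ h'.symm, hfg _ _ h'.symm]

variable [MeasurableSpace S] [MeasurableSingletonClass S]

section Measurability

variable [Countable S]

theorem measurable_pinnedWeight (hb : Measurable b) (E t : Finset (Sym2 ι)) :
    Measurable (pinnedWeight D b E t) :=
  Finset.measurable_sum _ fun B _ =>
    (Finset.measurable_prod _ fun i _ => hb.comp (measurable_pi_apply i)).mul
      ((measurable_bondProd D B).mul (measurable_softProd D _))

theorem measurable_pathTerm (hb : Measurable b) {l : ℕ} {K : Particle S → ℝ≥0∞}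
    (hK : Measurable K) (f : Fin (l + 1) ↪ ι) : Measurable (pathTerm D b K f) :=
  (hK.comp (measurable_pi_apply _)).mul (measurable_pinnedWeight D hb _ _)

theorem measurable_pairTerm (hb : Measurable b) {l : ℕ} (ρ : ℝ) {K : Particle S → ℝ≥0∞}
    (hK : Measurable K) (f : Fin (l + 2) ↪ ι) : Measurable (pairTerm D b ρ K f) :=
  ((hK.comp (measurable_pi_apply _)).mul ((measurable_nearIndicator ρ).comp
    (f := fun y : ι → Particle S => (y (f 0), y (f 1))) (by fun_prop))).mul
    (measurable_pinnedWeight D hb _ _)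

end Measurability

variable [Finite S] [Nonempty S]

theorem grandIntegral_pathTerm_le (hb : Measurable b) (hb1 : ∀ y, b y ≤ 1) (z : ℝ≥0∞) {l : ℕ}
    {K : Particle S → ℝ≥0∞} (hK : Measurable K) :
    grandIntegral (refMeasure S) z (fun k y => ∑ f : Fin (l + 1) ↪ Fin k, pathTerm D b K f y) ≤
      z ^ (l + 1) * ((∫⁻ y, b y * K y ∂(refMeasure S)) * D.eps ^ l) *
        grandIntegral (refMeasure S) z (fun _ y => tupleWeight b D.full y) := by
  have hF : Measurable fun y : Fin (l + 1) → Particle S => b (y 0) * K (y 0) *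
      ∏ a : Fin l, D.bond (y a.castSucc) (y a.succ) := by
    refine ((hb.mul hK).comp (measurable_pi_apply 0)).mul (Finset.measurable_prod _ fun a _ => ?_)
    exact D.measurable_bond.comp (f := fun y : Fin (l + 1) → Particle S =>
      (y a.castSucc, y a.succ)) (by fun_prop)
  refine (grandIntegral_sum_embedding_le z hF
    (fun _ => measurable_tupleWeight hb D.measurable_full)
    (fun k f => measurable_pathTerm D hb hK f)
    (fun n k f g hfg y => pathTerm_le D hb1 K f g hfg y)).trans ?_
  have hchain := lintegral_pi_chain_le (refMeasure S) (l := l) (hb.mul hK) (fun _ => D.bond)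
    (fun _ => D.measurable_bond) (fun _ => D.eps) (fun _ => D.lintegral_bond_le)
  rw [Finset.prod_const, Finset.card_univ, Fintype.card_fin] at hchain
  gcongr
  exact hchain

theorem grandIntegral_pairTerm_le (hb : Measurable b) (hb1 : ∀ y, b y ≤ 1) (z : ℝ≥0∞) {l : ℕ}
    (ρ : ℝ) {K : Particle S → ℝ≥0∞} (hK : Measurable K) :
    grandIntegral (refMeasure S) z (fun k y => ∑ f : Fin (l + 2) ↪ Fin k, pairTerm D b ρ K f y) ≤
      z ^ (l + 2) * ((∫⁻ y, b y * K y ∂(refMeasure S)) *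
        (volume (Metric.closedBall (0 : ℝ × ℝ) ρ) * D.eps ^ l)) *
        grandIntegral (refMeasure S) z (fun _ y => tupleWeight b D.full y) := by
  have hF : Measurable fun y : Fin (l + 2) → Particle S => b (y 0) * K (y 0) *
      (nearIndicator ρ (y 0) (y 1) * ∏ a : Fin l, D.bond (y a.castSucc.succ) (y a.succ.succ)) := by
    refine ((hb.mul hK).comp (measurable_pi_apply 0)).mul (Measurable.mul ?_
      (Finset.measurable_prod _ fun a _ => ?_))
    · exact (measurable_nearIndicator ρ).comp (f := fun y : Fin (l + 2) → Particle S => (y 0, y 1))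
        (by fun_prop)
    · exact D.measurable_bond.comp (f := fun y : Fin (l + 2) → Particle S =>
        (y a.castSucc.succ, y a.succ.succ)) (by fun_prop)
  refine (grandIntegral_sum_embedding_le z hF
    (fun _ => measurable_tupleWeight hb D.measurable_full)
    (fun k f => measurable_pairTerm D hb ρ hK f)
    (fun n k f g hfg y => pairTerm_le D hb1 ρ K f g hfg y)).trans ?_
  have hchain := lintegral_pi_chain_le (refMeasure S) (l := l + 1) (hb.mul hK)
    (fun a => if a = 0 then nearIndicator ρ else D.bond)
    (fun a => by split_ifs; exacts [measurable_nearIndicator ρ, D.measurable_bond])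
    (fun a => if a = 0 then volume (Metric.closedBall (0 : ℝ × ℝ) ρ) else D.eps)
    (fun a y => by split_ifs; exacts [lintegral_nearIndicator_le ρ y, D.lintegral_bond_le y])
  simp only [Fin.prod_univ_succ (n := l), Fin.val_zero, if_true, Fin.val_succ,
    Nat.add_one_ne_zero, if_false, Finset.prod_const, Finset.card_univ, Fintype.card_fin] at hchain
  gcongr
  exact hchain

end MarkedSums

section Losses

theorem Cutoff.abs_sub_le_of_one_add_norm_le (T : Cutoff) {x x' x'' : ℝ × ℝ} {c a : ℝ}
    (hc : 1 + ‖x - x'‖ ≤ c) (ha : 1 + ‖x' - x''‖ ≤ a) :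
    |T.τ x' - T.τ x''| ≤ T.rho / (1 + ‖x‖) * (c * a ^ 2) := by
  have hrho := T.rho_nonneg
  have := norm_nonneg (x - x')
  have ha₀ : 0 ≤ a := (add_nonneg zero_le_one (norm_nonneg _)).trans ha
  calc |T.τ x' - T.τ x''|
      ≤ T.rho / (1 + ‖x'‖) * ((1 + ‖x' - x''‖) * ‖x' - x''‖) := T.abs_sub_le x' x''
    _ ≤ T.rho / (1 + ‖x‖) * (1 + ‖x - x'‖) * (a * a) := by
        gcongr
        exacts [div_one_add_norm_le_mul hrho x x', by linarith]
    _ ≤ T.rho / (1 + ‖x‖) * c * (a * a) := by gcongr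
    _ = T.rho / (1 + ‖x‖) * (c * a ^ 2) := by ring

variable {S ι : Type*} (D : SoftSplit S) (T : Cutoff) (w : ℝ × ℝ) (ρ : ℝ)

/-- Every cluster that meets the ball of radius `T.N` has small extension. -/
def HasSmallClusters (B : Finset (Sym2 ι)) (y : ι → Particle S) : Prop :=
  ∀ i j, (bondGraph B).Reachable i j → ‖(y i).1‖ ≤ T.N → ‖(y i).1 - (y j).1‖ < ρ

/-- The weight of a path of length `l` that controls the clusters of large extension. -/
def badKernel (l : ℕ) (y : Particle S) : ℝ≥0∞ :=
  (Metric.closedBall (0 : ℝ × ℝ) T.N).indicator (fun _ => ENNReal.ofReal ((l * D.r / ρ) ^ 5)) y.1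

/-- The weight of a path of length `l` that controls the clusters of large extension and the loss in
the Jacobian. -/
def pathKernel (l : ℕ) (y : Particle S) : ℝ≥0∞ :=
  badKernel D T ρ l y + if l = 0 then jacLoss T w y else 0

/-- The weight of a path of length `l` that controls the losses in the pair weights. -/
def pairKernel (l : ℕ) (y : Particle S) : ℝ≥0∞ :=
  ENNReal.ofReal (6 * D.C * ‖w‖ ^ 2 * (1 + (D.r + ‖w‖)) ^ 6 * (l + 1) ^ 4 *
    (T.rho / (1 + ‖y.1‖)) ^ 2)

variable {D T w ρ} [DecidableEq ι] {B : Finset (Sym2 ι)} {y : ι → Particle S}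

theorem ofReal_three_mul_sq_add_sq_le_pairKernel (h0 : bondProd D B y ≠ 0) {l : ℕ}
    {f : Fin (l + 2) ↪ ι} (hf : pathEdges (Fin.tail f) ⊆ B)
    (hnear : ‖(y (f 0)).1 - (y (f 1)).1‖ ≤ D.r + ‖w‖) :
    ENNReal.ofReal (D.C * ‖w‖ ^ 2 * (3 * ((T.τ (y (f 0)).1 - T.τ (y (f 1)).1) ^ 2 +
      (T.τ (y (f 1)).1 - T.τ (y (f (Fin.last (l + 1)))).1) ^ 2))) ≤
      pairKernel D T w l (y (f 0)) := by
  have hpath : ‖(y (f 1)).1 - (y (f (Fin.last (l + 1)))).1‖ ≤ l * D.r :=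
    norm_sub_le_of_path h0 hf (Fin.last l)
  have hr := D.r_pos
  have hC := D.C_nonneg
  have hw := norm_nonneg w
  have : (0 : ℝ) ≤ l := l.cast_nonneg
  have hfirst := T.abs_sub_le_of_one_add_norm_le (x := (y (f 0)).1) (x' := (y (f 0)).1)
    (x'' := (y (f 1)).1) (c := 1 + (D.r + ‖w‖)) (a := (l + 1) * (1 + (D.r + ‖w‖)))
    (by rw [sub_self, norm_zero]; linarith) (by nlinarith)
  have hsecond := T.abs_sub_le_of_one_add_norm_le (x := (y (f 0)).1) (x' := (y (f 1)).1)
    (x'' := (y (f (Fin.last (l + 1)))).1) (c := 1 + (D.r + ‖w‖))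
    (a := (l + 1) * (1 + (D.r + ‖w‖))) (by linarith) (by nlinarith)
  refine ENNReal.ofReal_le_ofReal ?_
  calc _ ≤ D.C * ‖w‖ ^ 2 * (3 * ((T.rho / (1 + ‖(y (f 0)).1‖) * ((1 + (D.r + ‖w‖)) *
          ((l + 1) * (1 + (D.r + ‖w‖))) ^ 2)) ^ 2 + (T.rho / (1 + ‖(y (f 0)).1‖) *
          ((1 + (D.r + ‖w‖)) * ((l + 1) * (1 + (D.r + ‖w‖))) ^ 2)) ^ 2)) := by
        gcongr ?_ * (3 * (?_ + ?_))
        exacts [sq_le_sq' (neg_le_of_abs_le hfirst) (le_of_abs_le hfirst),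
          sq_le_sq' (neg_le_of_abs_le hsecond) (le_of_abs_le hsecond)]
    _ = _ := by ring

variable [Fintype ι]

theorem one_le_tsum_badKernel (hρ : 0 < ρ) (h0 : bondProd D B y ≠ 0)
    (hbad : ¬ HasSmallClusters T ρ B y) :
    1 ≤ ∑' l : ℕ, ∑ f : Fin (l + 1) ↪ ι,
      if pathEdges f ⊆ B then badKernel D T ρ l (y (f 0)) else 0 := by
  simp only [HasSmallClusters, not_forall, not_lt] at hbad
  obtain ⟨i, j, hij, hi, hfar⟩ := hbad
  obtain ⟨l, f, hf0, hfl, hfB, -⟩ := exists_path_embedding hij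
  have hpath := norm_sub_le_of_path h0 hfB (Fin.last l)
  rw [hf0, hfl, Fin.val_last] at hpath
  refine le_trans ?_ ((Finset.single_le_sum_of_canonicallyOrdered (Finset.mem_univ f)).trans
    (ENNReal.le_tsum l))
  rw [if_pos hfB, badKernel, hf0, indicator_of_mem (mem_closedBall_zero_iff.2 hi),
    ENNReal.one_le_ofReal]
  exact one_le_pow₀ ((one_le_div hρ).2 (hfar.trans hpath))

theorem sum_jacLoss_le (B : Finset (Sym2 ι)) (y : ι → Particle S) :
    ∑ i, jacLoss T w (y i) ≤ ∑' l : ℕ, ∑ f : Fin (l + 1) ↪ ι,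
      if pathEdges f ⊆ B then if l = 0 then jacLoss T w (y (f 0)) else 0 else 0 := by
  refine le_trans (le_of_eq ?_) (ENNReal.le_tsum 0)
  have htriv : ∀ f : Fin (0 + 1) ↪ ι, pathEdges f ⊆ B := fun f =>
    pathEdges_subset_iff.2 fun a => a.elim0
  simp only [htriv, if_true]
  exact ((Equiv.uniqueEmbeddingEquivResult (α := Fin 1) (β := ι)).sum_comp
    fun i => jacLoss T w (y i)).symm

/-- The sum over the marked paths that control the loss of the pair `p`. -/
def pairMajorant (D : SoftSplit S) (T : Cutoff) (w : ℝ × ℝ) (B : Finset (Sym2 ι))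
    (y : ι → Particle S) (p : Sym2 ι) : ℝ≥0∞ :=
  ∑' l : ℕ, ∑ f : Fin (l + 2) ↪ ι, if s(f 0, f 1) = p ∧ pathEdges (Fin.tail f) ⊆ B then
    pairKernel D T w l (y (f 0)) * nearIndicator (D.r + ‖w‖) (y (f 0)) (y (f 1)) else 0

theorem ofReal_three_mul_sq_add_sq_le_pairMajorant (h0 : bondProd D B y ≠ 0) {i j : ι}
    (hij : clusterRep B i ≠ clusterRep B j) (hnear : ‖(y j).1 - (y i).1‖ ≤ D.r + ‖w‖) :
    ENNReal.ofReal (D.C * ‖w‖ ^ 2 * (3 * ((T.τ (y j).1 - T.τ (y i).1) ^ 2 +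
      (T.τ (y i).1 - T.τ (y (clusterRep B i)).1) ^ 2))) ≤ pairMajorant D T w B y s(i, j) := by
  obtain ⟨l, f, hf0, hfl, hfB, hreach⟩ := exists_path_embedding (reachable_clusterRep B i)
  have hj : j ∉ range f := by
    rintro ⟨a, rfl⟩
    exact hij (clusterRep_eq_of_reachable (hreach a))
  let f' : Fin (l + 2) ↪ ι := ⟨Fin.cons j f, Fin.cons_injective_iff.2 ⟨hj, f.injective⟩⟩
  have hf'0 : f' 0 = j := rfl
  have hf'1 : f' 1 = i := hf0
  have hf'l : f' (Fin.last (l + 1)) = clusterRep B i := hfl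
  refine le_trans ?_ ((Finset.single_le_sum_of_canonicallyOrdered (Finset.mem_univ f')).trans
    (ENNReal.le_tsum l))
  rw [if_pos ⟨by rw [hf'0, hf'1, Sym2.eq_swap], hfB⟩, hf'1, hf'0, nearIndicator_eq_one hnear,
    mul_one]
  simpa only [hf'0, hf'1, hf'l] using
    ofReal_three_mul_sq_add_sq_le_pairKernel (T := T) (f := f') h0 hfB (by rwa [hf'0, hf'1])

theorem pairLoss_le_two_mul_pairMajorant (h0 : bondProd D B y ≠ 0) (p : Sym2 ι) :
    pairLoss D T w B y p ≤ 2 * pairMajorant D T w B y p := by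
  obtain ⟨i, j, hp, hloss⟩ : ∃ i j, s(i, j) = p ∧ pairLoss D T w B y p =
      ENNReal.ofReal (D.C * ‖w‖ ^ 2 *
        (T.τ (y (clusterRep B i)).1 - T.τ (y (clusterRep B j)).1) ^ 2) *
      (Metric.closedBall (0 : ℝ × ℝ) (D.r + ‖w‖)).indicator 1 ((y i).1 - (y j).1) :=
    ⟨_, _, Quot.out_eq p, rfl⟩
  rw [hloss]
  by_cases hnear : ‖(y i).1 - (y j).1‖ ≤ D.r + ‖w‖
  swap
  · rw [indicator_of_notMem (mt mem_closedBall_zero_iff.1 hnear), mul_zero]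
    exact zero_le
  by_cases hij : clusterRep B i = clusterRep B j
  · simp [hij]
  have hi := ofReal_three_mul_sq_add_sq_le_pairMajorant (T := T) (w := w) h0 hij
    (by rwa [norm_sub_rev])
  have hj := ofReal_three_mul_sq_add_sq_le_pairMajorant (T := T) (w := w) h0 (Ne.symm hij) hnear
  rw [hp] at hi
  rw [Sym2.eq_swap, hp] at hj
  have hC := D.C_nonneg
  rw [indicator_of_mem (mem_closedBall_zero_iff.2 hnear), Pi.one_apply, mul_one, two_mul]
  refine le_trans ?_ (add_le_add hi hj)
  rw [← ENNReal.ofReal_add (by positivity) (by positivity), ← mul_add]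
  gcongr
  generalize T.τ (y i).1 = ti, T.τ (y j).1 = tj, T.τ (y (clusterRep B i)).1 = ti',
    T.τ (y (clusterRep B j)).1 = tj'
  nlinarith [sq_nonneg ((ti - tj) - (tj - tj')), sq_nonneg ((ti - tj) + (ti - ti')),
    sq_nonneg ((tj - tj') + (ti - ti')), sq_nonneg (ti - tj)]

/-- The total loss for a set of bonds: the whole weight if some cluster is large, and the losses in
the Jacobian and in the soft weights of the pairs. -/
def lossWeight (D : SoftSplit S) (T : Cutoff) (w : ℝ × ℝ) (ρ : ℝ) (b : Particle S → ℝ≥0∞)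
    (B : Finset (Sym2 ι)) (y : ι → Particle S) : ℝ≥0∞ :=
  ({y | HasSmallClusters T ρ B y}ᶜ.indicator (splitWeight D b B) y +
      splitWeight D b B y * ∑ i, jacLoss T w (y i)) +
    ∑ p ∈ edges ι \ B, pairLoss D T w B y p *
      ((∏ i, b (y i)) * (bondProd D B y * softProd D ((edges ι \ B).erase p) y))

variable {b : Particle S → ℝ≥0∞}

theorem indicator_splitWeight_add_le (hρ : 0 < ρ) (B : Finset (Sym2 ι)) (y : ι → Particle S) :
    {y | HasSmallClusters T ρ B y}ᶜ.indicator (splitWeight D b B) y +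
      splitWeight D b B y * ∑ i, jacLoss T w (y i) ≤
    ∑' l : ℕ, ∑ f : Fin (l + 1) ↪ ι,
      if pathEdges f ⊆ B then pathKernel D T w ρ l (y (f 0)) * splitWeight D b B y else 0 := by
  by_cases h0 : bondProd D B y = 0
  · simp [splitWeight, h0]
  have hbad : {y | HasSmallClusters T ρ B y}ᶜ.indicator (splitWeight D b B) y ≤
      splitWeight D b B y * ∑' l : ℕ, ∑ f : Fin (l + 1) ↪ ι,
        if pathEdges f ⊆ B then badKernel D T ρ l (y (f 0)) else 0 :=
    indicator_apply_le' (fun hB => le_mul_of_one_le_right' (one_le_tsum_badKernel hρ h0 hB))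
      fun _ => zero_le
  refine (add_le_add hbad (mul_le_mul_right (sum_jacLoss_le B y) _)).trans (le_of_eq ?_)
  rw [← mul_add, ← ENNReal.tsum_add, ← ENNReal.tsum_mul_left]
  refine tsum_congr fun l => ?_
  rw [← Finset.sum_add_distrib, Finset.mul_sum]
  refine Finset.sum_congr rfl fun f _ => ?_
  rw [pathKernel]
  split_ifs <;> ring

theorem sum_indicator_splitWeight_add_le (hρ : 0 < ρ) (y : ι → Particle S) :
    ∑ B ∈ (edges ι).powerset, ({y | HasSmallClusters T ρ B y}ᶜ.indicator (splitWeight D b B) y +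
      splitWeight D b B y * ∑ i, jacLoss T w (y i)) ≤
    ∑' l : ℕ, ∑ f : Fin (l + 1) ↪ ι, pathTerm D b (pathKernel D T w ρ l) f y := by
  refine (Finset.sum_le_sum fun B _ => indicator_splitWeight_add_le hρ B y).trans (le_of_eq ?_)
  rw [← Summable.tsum_finsetSum fun _ _ => ENNReal.summable]
  refine tsum_congr fun l => ?_
  rw [Finset.sum_comm]
  refine Finset.sum_congr rfl fun f _ => ?_
  rw [pathTerm, pinnedWeight, Finset.mul_sum, Finset.sum_filter]
  rfl

theorem sum_sum_pairLoss_mul_le (y : ι → Particle S) :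
    ∑ B ∈ (edges ι).powerset, ∑ p ∈ edges ι \ B, pairLoss D T w B y p *
      ((∏ i, b (y i)) * (bondProd D B y * softProd D ((edges ι \ B).erase p) y)) ≤
    2 * ∑' l : ℕ, ∑ f : Fin (l + 2) ↪ ι,
      pairTerm D b (D.r + ‖w‖) (pairKernel D T w l) f y := by
  let X : Finset (Sym2 ι) → Sym2 ι → ℝ≥0∞ := fun B p =>
    (∏ i, b (y i)) * (bondProd D B y * softProd D ((edges ι).erase p \ B) y)
  have hcomm : ∀ (B : Finset (Sym2 ι)) (p : Sym2 ι), B ∈ (edges ι).powerset ∧ p ∈ edges ι \ B ↔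
      B ∈ ((edges ι).erase p).powerset ∧ p ∈ edges ι := by
    intro B p
    simp only [Finset.mem_powerset, Finset.mem_sdiff, Finset.subset_erase]
    tauto
  have hX : ∀ B p, pairLoss D T w B y p * X B p ≤ 2 * (pairMajorant D T w B y p * X B p) := by
    intro B p
    by_cases h0 : bondProd D B y = 0
    · simp [X, h0]
    · exact (mul_le_mul_left (pairLoss_le_two_mul_pairMajorant h0 p) _).trans_eq (mul_assoc _ _ _)
  simp only [← Finset.erase_sdiff_comm]
  rw [Finset.sum_comm' hcomm]
  refine (Finset.sum_le_sum fun p _ => Finset.sum_le_sum fun B _ => hX B p).trans (le_of_eq ?_)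
  simp only [← Finset.mul_sum, pairMajorant, ← ENNReal.tsum_mul_right]
  congr 1
  simp only [← Summable.tsum_finsetSum fun _ _ => ENNReal.summable]
  refine tsum_congr fun l => ?_
  rw [← Finset.sum_fiberwise_of_maps_to (t := edges ι) (g := fun f : Fin (l + 2) ↪ ι => s(f 0, f 1))
    fun f _ => mk_mem_edges.2 (f.injective.ne Fin.zero_ne_one)]
  refine Finset.sum_congr rfl fun p _ => ?_
  simp only [Finset.sum_mul, Finset.sum_filter]
  rw [Finset.sum_comm]
  refine Finset.sum_congr rfl fun f _ => ?_
  split_ifs with hp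
  · subst hp
    simp only [true_and, pairTerm, pinnedWeight, Finset.mul_sum, Finset.sum_filter, ite_mul,
      zero_mul, mul_ite, mul_zero, X]
  · simp [hp]

theorem sum_lossWeight_le (hρ : 0 < ρ) (y : ι → Particle S) :
    ∑ B ∈ (edges ι).powerset, lossWeight D T w ρ b B y ≤
      (∑' l : ℕ, ∑ f : Fin (l + 1) ↪ ι, pathTerm D b (pathKernel D T w ρ l) f y) +
      2 * ∑' l : ℕ, ∑ f : Fin (l + 2) ↪ ι,
        pairTerm D b (D.r + ‖w‖) (pairKernel D T w l) f y := by
  simp only [lossWeight]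
  rw [Finset.sum_add_distrib]
  exact add_le_add (sum_indicator_splitWeight_add_le hρ y) (sum_sum_pairLoss_mul_le y)

end Losses

section FiniteVolume

variable {S ι : Type*} {D : SoftSplit S} {T : Cutoff} {w : ℝ × ℝ} {ρ : ℝ} {b : Particle S → ℝ≥0∞}
  [Fintype ι]

theorem prod_weight_clusterMove {B : Finset (Sym2 ι)} {y : ι → Particle S}
    (hfar : ∀ y : Particle S, ‖y.1‖ ≤ T.N + ρ + ‖w‖ → b y = 1) (hsmall : HasSmallClusters T ρ B y) :
    ∏ i, b (clusterMove T w B y i) = ∏ i, b (y i) := by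
  refine Finset.prod_congr rfl fun i _ => ?_
  by_cases hτ : T.τ (y (clusterRep B i)).1 = 0
  · rw [clusterMove, hτ, zero_smul, add_zero]
  have hN : ‖(y (clusterRep B i)).1‖ ≤ T.N := by
    by_contra! hN
    exact hτ (T.eq_zero _ hN.le)
  have hdist := hsmall (clusterRep B i) i (reachable_clusterRep B i).symm hN
  have hnorm : ‖(y i).1‖ ≤ T.N + ρ := by
    linarith [norm_sub_rev (y i).1 (y (clusterRep B i)).1,
      norm_sub_norm_le (y i).1 (y (clusterRep B i)).1]
  have hshift : ‖T.τ (y (clusterRep B i)).1 • w‖ ≤ ‖w‖ := by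
    rw [norm_smul, Real.norm_of_nonneg (T.nonneg _)]
    exact mul_le_of_le_one_left (norm_nonneg _) (T.le_one _)
  rw [hfar (y i) (by linarith [norm_nonneg w]), hfar]
  exact (norm_add_le _ _).trans (add_le_add hnorm hshift)

variable [DecidableEq ι]

theorem splitWeight_le_of_hasSmallClusters (hw : T.rho * ‖w‖ < 1)
    (hfar : ∀ y : Particle S, ‖y.1‖ ≤ T.N + ρ + ‖w‖ → b y = 1) {B : Finset (Sym2 ι)}
    {y : ι → Particle S} (hsmall : HasSmallClusters T ρ B y) :
    splitWeight D b B y ≤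
      2⁻¹ * (clusterMoveJac T w B y * splitWeight D b B (clusterMove T w B y)) +
      2⁻¹ * (clusterMoveJac T (-w) B y * splitWeight D b B (clusterMove T (-w) B y)) +
      lossWeight D T w ρ b B y := by
  have hb := prod_weight_clusterMove (w := w) hfar hsmall
  have hb' := prod_weight_clusterMove (w := -w) (by rwa [norm_neg]) hsmall
  have hpair : (∏ i, b (y i)) * (bondProd D B y * ∑ p ∈ edges ι \ B, pairLoss D T w B y p *
      softProd D ((edges ι \ B).erase p) y) = ∑ p ∈ edges ι \ B, pairLoss D T w B y p *
        ((∏ i, b (y i)) * (bondProd D B y * softProd D ((edges ι \ B).erase p) y)) := by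
    simp only [Finset.mul_sum]
    exact Finset.sum_congr rfl fun p _ => by ring
  rw [lossWeight, ← hpair]
  simp only [splitWeight, hb, hb', bondProd_clusterMove]
  calc _ ≤ _ := mul_le_mul_right (mul_le_mul_right
        (softProd_le_of_clusterMove D hw (edges ι \ B) B y) (bondProd D B y)) (∏ i, b (y i))
    _ ≤ _ := le_add_self (b := {y | HasSmallClusters T ρ B y}ᶜ.indicator (splitWeight D b B) y)
    _ = _ := by unfold splitWeight; ring

variable (D T w b) in
/-- The total weight that the sets of bonds contribute to `A` after `clusterMove`. -/
def movedWeight (A : Set (ι → Particle S)) (y : ι → Particle S) : ℝ≥0∞ :=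
  ∑ B ∈ (edges ι).powerset,
    clusterMoveJac T w B y * A.indicator (splitWeight D b B) (clusterMove T w B y)

theorem indicator_tupleWeight_eq_sum (A : Set (ι → Particle S)) (y : ι → Particle S) :
    A.indicator (tupleWeight b D.full) y =
      ∑ B ∈ (edges ι).powerset, A.indicator (splitWeight D b B) y := by
  by_cases hy : y ∈ A
  · simp only [indicator_of_mem hy, tupleWeight_eq_sum_splitWeight]
  · simp only [indicator_of_notMem hy, Finset.sum_const_zero]

variable {A A₁ A₂ : Set (ι → Particle S)}

theorem indicator_tupleWeight_le (hw : T.rho * ‖w‖ < 1)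
    (hfar : ∀ y : Particle S, ‖y.1‖ ≤ T.N + ρ + ‖w‖ → b y = 1)
    (h₁ : ∀ B, ∀ y ∈ A, HasSmallClusters T ρ B y → clusterMove T w B y ∈ A₁)
    (h₂ : ∀ B, ∀ y ∈ A, HasSmallClusters T ρ B y → clusterMove T (-w) B y ∈ A₂)
    (y : ι → Particle S) :
    A.indicator (tupleWeight b D.full) y ≤
      2⁻¹ * movedWeight D T w b A₁ y + 2⁻¹ * movedWeight D T (-w) b A₂ y +
        ∑ B ∈ (edges ι).powerset, lossWeight D T w ρ b B y := by
  simp only [indicator_tupleWeight_eq_sum, movedWeight, Finset.mul_sum,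
    ← Finset.sum_add_distrib]
  refine Finset.sum_le_sum fun B _ => ?_
  refine indicator_apply_le' (fun hA => ?_) fun _ => zero_le
  by_cases hsmall : HasSmallClusters T ρ B y
  · rw [indicator_of_mem (h₁ B y hA hsmall), indicator_of_mem (h₂ B y hA hsmall)]
    exact splitWeight_le_of_hasSmallClusters hw hfar hsmall
  · rw [lossWeight, indicator_of_mem (s := {y | HasSmallClusters T ρ B y}ᶜ) hsmall]
    exact (le_self_add.trans le_self_add).trans le_add_self

variable [MeasurableSpace S] [MeasurableSingletonClass S]

theorem measurable_movedWeight [Countable S] (hb : Measurable b) (w : ℝ × ℝ)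
    (hA : MeasurableSet A) : Measurable (movedWeight D T w b A) :=
  Finset.measurable_sum _ fun B _ => (measurable_clusterMoveJac T w B).mul
    (((measurable_splitWeight D hb B).indicator hA).comp (measurable_clusterMove T w B))

variable [Finite S] [Nonempty S]

theorem lintegral_movedWeight (hw : T.rho * ‖w‖ < 1) (hb : Measurable b) (hA : MeasurableSet A) :
    ∫⁻ y, movedWeight D T w b A y ∂(Measure.pi fun _ => refMeasure S) =
      ∫⁻ y, A.indicator (tupleWeight b D.full) y ∂(Measure.pi fun _ => refMeasure S) := by
  have hmeas := fun B => (measurable_splitWeight (ι := ι) D hb B).indicator hA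
  have hmoved : ∀ B, Measurable fun y =>
      clusterMoveJac T w B y * A.indicator (splitWeight D b B) (clusterMove T w B y) := fun B =>
    (measurable_clusterMoveJac T w B).mul ((hmeas B).comp (measurable_clusterMove T w B))
  simp only [indicator_tupleWeight_eq_sum, movedWeight]
  rw [lintegral_finsetSum _ fun B _ => hmeas B, lintegral_finsetSum _ fun B _ => hmoved B]
  exact Finset.sum_congr rfl fun B _ => lintegral_clusterMoveJac_mul T hw B (hmeas B)

theorem lintegral_indicator_tupleWeight_le (hw : T.rho * ‖w‖ < 1) (hρ : 0 < ρ) (hb : Measurable b)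
    (hfar : ∀ y : Particle S, ‖y.1‖ ≤ T.N + ρ + ‖w‖ → b y = 1)
    (hA₁ : MeasurableSet A₁) (hA₂ : MeasurableSet A₂)
    (h₁ : ∀ B, ∀ y ∈ A, HasSmallClusters T ρ B y → clusterMove T w B y ∈ A₁)
    (h₂ : ∀ B, ∀ y ∈ A, HasSmallClusters T ρ B y → clusterMove T (-w) B y ∈ A₂) :
    ∫⁻ y, A.indicator (tupleWeight b D.full) y ∂(Measure.pi fun _ : ι => refMeasure S) ≤
      ∫⁻ y, (2⁻¹ * A₁.indicator (tupleWeight b D.full) y +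
        2⁻¹ * A₂.indicator (tupleWeight b D.full) y) +
        ((∑' l : ℕ, ∑ f : Fin (l + 1) ↪ ι, pathTerm D b (pathKernel D T w ρ l) f y) +
        2 * ∑' l : ℕ, ∑ f : Fin (l + 2) ↪ ι,
          pairTerm D b (D.r + ‖w‖) (pairKernel D T w l) f y)
        ∂(Measure.pi fun _ : ι => refMeasure S) := by
  have htuple := measurable_tupleWeight (ι := ι) hb D.measurable_full
  have hmoved₁ := measurable_movedWeight (D := D) (T := T) hb w hA₁
  have hmoved₂ := measurable_movedWeight (D := D) (T := T) hb (-w) hA₂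
  have hind₁ := htuple.indicator hA₁
  have hind₂ := htuple.indicator hA₂
  have hmoved : Measurable fun y =>
      2⁻¹ * movedWeight D T w b A₁ y + 2⁻¹ * movedWeight D T (-w) b A₂ y :=
    (hmoved₁.const_mul _).add (hmoved₂.const_mul _)
  have hind : Measurable fun y => 2⁻¹ * A₁.indicator (tupleWeight b D.full) y +
      2⁻¹ * A₂.indicator (tupleWeight b D.full) y :=
    (hind₁.const_mul _).add (hind₂.const_mul _)
  refine (lintegral_mono fun y => (indicator_tupleWeight_le hw hfar h₁ h₂ y).trans
    (add_le_add_right (sum_lossWeight_le hρ y) _)).trans (le_of_eq ?_)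
  rw [lintegral_add_left hmoved,
    lintegral_add_left (hmoved₁.const_mul _), lintegral_const_mul _ hmoved₁,
    lintegral_const_mul _ hmoved₂, lintegral_movedWeight hw hb hA₁,
    lintegral_movedWeight (by rwa [norm_neg]) hb hA₂,
    lintegral_add_left hind,
    lintegral_add_left (hind₁.const_mul _), lintegral_const_mul _ hind₁,
    lintegral_const_mul _ hind₂]

end FiniteVolume

section LossBound

variable {S : Type*} [MeasurableSpace S] (D : SoftSplit S) (T : Cutoff) (w : ℝ × ℝ) (ρ : ℝ)
  (b : Particle S → ℝ≥0∞) (z : ℝ≥0∞)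

theorem measurable_jacLoss : Measurable (jacLoss (S := S) T w) := by
  have := (T.continuous_fderiv_apply w).measurable
  unfold jacLoss
  fun_prop

theorem measurable_badKernel (l : ℕ) : Measurable (badKernel D T ρ l) :=
  (measurable_const.indicator measurableSet_closedBall).comp measurable_fst

theorem measurable_pathKernel (l : ℕ) : Measurable (pathKernel D T w ρ l) := by
  refine (measurable_badKernel D T ρ l).add ?_
  split_ifs
  exacts [measurable_jacLoss T w, measurable_const]

theorem measurable_pairKernel (l : ℕ) : Measurable (pairKernel D T w l) := by
  unfold pairKernel
  fun_prop

/-- The bound on the total loss that results from integrating the weights of the paths. -/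
def lossBound : ℝ≥0∞ :=
  (∑' l : ℕ, z ^ (l + 1) * ((∫⁻ y, b y * pathKernel D T w ρ l y ∂(refMeasure S)) * D.eps ^ l)) +
  2 * ∑' l : ℕ, z ^ (l + 2) * ((∫⁻ y, b y * pairKernel D T w l y ∂(refMeasure S)) *
    (volume (Metric.closedBall (0 : ℝ × ℝ) (D.r + ‖w‖)) * D.eps ^ l))

variable {D T w ρ b}
variable [Finite S] [Nonempty S] [MeasurableSingletonClass S]

theorem grandIntegral_indicator_tupleWeight_le (hw : T.rho * ‖w‖ < 1) (hρ : 0 < ρ)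
    (hb : Measurable b) (hb1 : ∀ y, b y ≤ 1)
    (hfar : ∀ y : Particle S, ‖y.1‖ ≤ T.N + ρ + ‖w‖ → b y = 1)
    {A A₁ A₂ : ∀ k : ℕ, Set (Fin k → Particle S)} (hA₁ : ∀ k, MeasurableSet (A₁ k))
    (hA₂ : ∀ k, MeasurableSet (A₂ k))
    (h₁ : ∀ k B, ∀ y ∈ A k, HasSmallClusters T ρ B y → clusterMove T w B y ∈ A₁ k)
    (h₂ : ∀ k B, ∀ y ∈ A k, HasSmallClusters T ρ B y → clusterMove T (-w) B y ∈ A₂ k) :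
    grandIntegral (refMeasure S) z (fun k y => (A k).indicator (tupleWeight b D.full) y) ≤
      2⁻¹ * grandIntegral (refMeasure S) z (fun k y => (A₁ k).indicator (tupleWeight b D.full) y) +
      2⁻¹ * grandIntegral (refMeasure S) z (fun k y => (A₂ k).indicator (tupleWeight b D.full) y) +
      lossBound D T w ρ b z *
        grandIntegral (refMeasure S) z (fun _ y => tupleWeight b D.full y) := by
  have htuple := fun k => measurable_tupleWeight (ι := Fin k) hb D.measurable_full
  have hind₁ := fun k => (htuple k).indicator (hA₁ k)
  have hind₂ := fun k => (htuple k).indicator (hA₂ k)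
  have hind : ∀ k, Measurable fun y => 2⁻¹ * (A₁ k).indicator (tupleWeight b D.full) y +
      2⁻¹ * (A₂ k).indicator (tupleWeight b D.full) y := fun k =>
    ((hind₁ k).const_mul _).add ((hind₂ k).const_mul _)
  have hpath : ∀ l k, Measurable fun y : Fin k → Particle S => ∑ f : Fin (l + 1) ↪ Fin k,
      pathTerm D b (pathKernel D T w ρ l) f y := fun l k =>
    Finset.measurable_sum _ fun f _ =>
      measurable_pathTerm D hb (measurable_pathKernel D T w ρ l) f
  have hpair : ∀ l k, Measurable fun y : Fin k → Particle S => ∑ f : Fin (l + 2) ↪ Fin k,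
      pairTerm D b (D.r + ‖w‖) (pairKernel D T w l) f y := fun l k =>
    Finset.measurable_sum _ fun f _ => measurable_pairTerm D hb _ (measurable_pairKernel D T w l) f
  refine (grandIntegral_mono (refMeasure S) z fun k => lintegral_indicator_tupleWeight_le hw hρ hb
    hfar (hA₁ k) (hA₂ k) (h₁ k) (h₂ k)).trans ?_
  rw [grandIntegral_add _ _ hind,
    grandIntegral_add _ _ fun k => (hind₁ k).const_mul _, grandIntegral_const_mul _ _ hind₁,
    grandIntegral_const_mul _ _ hind₂,
    grandIntegral_add _ _ fun k => Measurable.tsum fun l => hpath l k,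
    grandIntegral_const_mul _ _ fun k => Measurable.tsum fun l => hpair l k,
    grandIntegral_tsum _ _ hpath, grandIntegral_tsum _ _ hpair, lossBound, add_mul, mul_assoc 2,
    ← ENNReal.tsum_mul_right, ← ENNReal.tsum_mul_right]
  gcongr with l l
  · exact grandIntegral_pathTerm_le D hb hb1 z (measurable_pathKernel D T w ρ l)
  · exact grandIntegral_pairTerm_le D hb hb1 z _ (measurable_pairKernel D T w l)

end LossBound

section WeightSeries

/-- The series `∑ (l + 1)⁵ / 2ˡ`, which dominates the losses along paths of all lengths `l`. -/
def weightSeries : ℝ≥0∞ := ∑' l : ℕ, ENNReal.ofReal ((l + 1) ^ 5) * 2⁻¹ ^ l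

theorem weightSeries_ne_top : weightSeries ≠ ⊤ := by
  have hsum : Summable fun l : ℕ => ((l + 1 : ℕ) : ℝ) ^ 5 * (2⁻¹ : ℝ) ^ (l + 1) :=
    (summable_nat_add_iff 1).2
      (summable_pow_mul_geometric_of_norm_lt_one 5 (r := (2⁻¹ : ℝ)) (by norm_num))
  convert (hsum.mul_left 2).tsum_ofReal_ne_top using 1
  refine tsum_congr fun l => ?_
  rw [← ENNReal.ofReal_ofNat 2, ← ENNReal.ofReal_inv_of_pos two_pos,
    ← ENNReal.ofReal_pow (by norm_num), ← ENNReal.ofReal_mul (by positivity)]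
  congr 1
  push_cast
  ring

theorem tsum_pow_mul_le {z e c : ℝ≥0∞} (hze : z * e ≤ 2⁻¹) {I : ℕ → ℝ≥0∞}
    (hI : ∀ l : ℕ, I l ≤ ENNReal.ofReal ((l + 1) ^ 5) * c) (n : ℕ) :
    ∑' l : ℕ, z ^ (l + n) * (I l * e ^ l) ≤ z ^ n * weightSeries * c := by
  rw [weightSeries, ← ENNReal.tsum_mul_left, ← ENNReal.tsum_mul_right]
  refine ENNReal.tsum_le_tsum fun l => ?_
  calc z ^ (l + n) * (I l * e ^ l) = z ^ n * I l * (z * e) ^ l := by rw [mul_pow]; ring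
    _ ≤ z ^ n * (ENNReal.ofReal ((l + 1) ^ 5) * c) * 2⁻¹ ^ l := by
      gcongr
      exact hI l
    _ = _ := by ring

end WeightSeries

section LogarithmicGrowth

theorem volume_closedBall_prod (R : ℝ) :
    volume (Metric.closedBall (0 : ℝ × ℝ) R) = ENNReal.ofReal (2 * R) ^ 2 := by
  have hprod : Metric.closedBall (0 : ℝ × ℝ) R = Metric.closedBall 0 R ×ˢ Metric.closedBall 0 R :=
    (closedBall_prod_same 0 0 R).symm
  rw [hprod, Measure.volume_eq_prod, Measure.prod_prod, Real.volume_closedBall, sq]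

theorem setLIntegral_sq_le {s : Set (ℝ × ℝ)} {R c : ℝ} {f : ℝ × ℝ → ℝ} (hR : 0 ≤ R)
    (hs : s ⊆ Metric.closedBall 0 R) (hf₀ : ∀ x, 0 ≤ f x) (hf : ∀ x ∈ s, f x ≤ c) :
    ∫⁻ x in s, ENNReal.ofReal (f x ^ 2) ≤ ENNReal.ofReal (c ^ 2 * (2 * R) ^ 2) :=
  calc ∫⁻ x in s, ENNReal.ofReal (f x ^ 2)
      ≤ ∫⁻ _ in s, ENNReal.ofReal (c ^ 2) :=
        setLIntegral_mono measurable_const fun x hx =>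
          ENNReal.ofReal_le_ofReal (pow_le_pow_left₀ (hf₀ x) (hf x hx) 2)
    _ = ENNReal.ofReal (c ^ 2) * volume s := setLIntegral_const _ _
    _ ≤ ENNReal.ofReal (c ^ 2) * volume (Metric.closedBall (0 : ℝ × ℝ) R) := by gcongr
    _ = _ := by
      rw [volume_closedBall_prod, ← ENNReal.ofReal_pow (by positivity),
        ← ENNReal.ofReal_mul (by positivity)]

theorem lintegral_inv_one_add_norm_sq_le (J : ℕ) :
    ∫⁻ x in Metric.closedBall (0 : ℝ × ℝ) (2 ^ J), ENNReal.ofReal ((1 / (1 + ‖x‖)) ^ 2) ≤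
      ENNReal.ofReal (16 * (J + 1)) := by
  have hpos : ∀ x : ℝ × ℝ, 0 ≤ 1 / (1 + ‖x‖) := fun x => by positivity
  induction J with
  | zero =>
    refine (setLIntegral_sq_le (R := 1) (c := 1) zero_le_one (by rw [pow_zero]) hpos
      fun x _ => ?_).trans (ENNReal.ofReal_le_ofReal (by norm_num))
    exact div_le_one_of_le₀ (by linarith [norm_nonneg x]) (by positivity)
  | succ J ih =>
    have hcover : Metric.closedBall (0 : ℝ × ℝ) (2 ^ (J + 1)) ⊆ Metric.closedBall 0 (2 ^ J) ∪
        (Metric.closedBall 0 (2 ^ (J + 1)) \ Metric.closedBall 0 (2 ^ J)) := by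
      rw [union_sdiff_self]
      exact subset_union_right
    have hannulus := setLIntegral_sq_le (R := 2 ^ (J + 1)) (c := 1 / 2 ^ J)
      (s := Metric.closedBall (0 : ℝ × ℝ) (2 ^ (J + 1)) \ Metric.closedBall 0 (2 ^ J))
      (by positivity) sdiff_subset hpos fun x hx => by
        have hx := not_le.1 (mt mem_closedBall_zero_iff.2 hx.2)
        gcongr
        linarith
    refine (lintegral_mono_set hcover).trans ((lintegral_union_le _ _ _).trans
      ((add_le_add ih hannulus).trans ?_))
    rw [← ENNReal.ofReal_add (by positivity) (by positivity)]
    refine ENNReal.ofReal_le_ofReal (le_of_eq ?_)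
    push_cast
    field_simp
    ring

theorem setLIntegral_div_one_add_norm_sq_le (K : ℝ) {m : ℕ} (hm : 1 ≤ m) :
    ∫⁻ x in Metric.closedBall (0 : ℝ × ℝ) (4 ^ (m + 1)),
      ENNReal.ofReal ((K / m / (1 + ‖x‖)) ^ 2) ≤ ENNReal.ofReal (80 * K ^ 2 / m) := by
  have hm : (1 : ℝ) ≤ m := by exact_mod_cast hm
  have hradius : (4 : ℝ) ^ (m + 1) = 2 ^ (2 * (m + 1)) := by rw [pow_mul]; norm_num
  calc _ = ∫⁻ x in Metric.closedBall (0 : ℝ × ℝ) (2 ^ (2 * (m + 1))),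
        ENNReal.ofReal ((K / m) ^ 2) * ENNReal.ofReal ((1 / (1 + ‖x‖)) ^ 2) := by
        rw [hradius]
        refine lintegral_congr fun x => ?_
        rw [← ENNReal.ofReal_mul (by positivity), ← mul_pow, mul_one_div]
    _ ≤ ENNReal.ofReal ((K / m) ^ 2) * ENNReal.ofReal (16 * ((2 * (m + 1) : ℕ) + 1)) := by
        rw [lintegral_const_mul _ (by fun_prop)]
        gcongr
        exact lintegral_inv_one_add_norm_sq_le _
    _ ≤ ENNReal.ofReal ((K / m) ^ 2) * ENNReal.ofReal (80 * m) := by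
        have : 16 * ((2 * (m + 1) : ℕ) + 1 : ℝ) ≤ 80 * m := by push_cast; linarith
        gcongr
    _ = ENNReal.ofReal (80 * K ^ 2 / m) := by
        rw [← ENNReal.ofReal_mul (by positivity)]
        congr 1
        field_simp

end LogarithmicGrowth

section LossEstimate

variable {S : Type*} {D : SoftSplit S} {T : Cutoff} {w : ℝ × ℝ} {ρ : ℝ}
  {b : Particle S → ℝ≥0∞} {z : ℝ≥0∞} {L : ℝ}

variable (D w z) in
/-- The factor by which the integral of the squared gradient of the cutoff enters `lossBound`. -/
def lossRate : ℝ≥0∞ :=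
  z * weightSeries * ENNReal.ofReal (‖w‖ ^ 2) +
    2 * (z ^ 2 * weightSeries * (ENNReal.ofReal (6 * D.C * ‖w‖ ^ 2 * (1 + (D.r + ‖w‖)) ^ 6) *
      volume (Metric.closedBall (0 : ℝ × ℝ) (D.r + ‖w‖))))

theorem lossRate_ne_top (hz : z ≠ ⊤) : lossRate D w z ≠ ⊤ :=
  have hseries : ∀ n, z ^ n * weightSeries ≠ ⊤ := fun _ =>
    ENNReal.mul_ne_top (ENNReal.pow_ne_top hz) weightSeries_ne_top
  ENNReal.add_ne_top.2
    ⟨ENNReal.mul_ne_top (pow_one z ▸ hseries 1) ENNReal.ofReal_ne_top,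
      ENNReal.mul_ne_top ENNReal.ofNat_ne_top (ENNReal.mul_ne_top (hseries 2)
        (ENNReal.mul_ne_top ENNReal.ofReal_ne_top measure_closedBall_lt_top.ne))⟩

variable [Finite S] [Nonempty S] [MeasurableSpace S] [MeasurableSingletonClass S]

theorem lintegral_mul_le_setLIntegral (hb1 : ∀ y, b y ≤ 1) (hbL : ∀ y, L < ‖y.1‖ → b y = 0)
    {F : Particle S → ℝ≥0∞} {G : ℝ × ℝ → ℝ≥0∞} (hG : Measurable G) (hFG : ∀ y, F y ≤ G y.1) :
    ∫⁻ y, b y * F y ∂(refMeasure S) ≤ ∫⁻ x in Metric.closedBall (0 : ℝ × ℝ) L, G x := by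
  rw [← lintegral_indicator measurableSet_closedBall,
    ← lintegral_refMeasure_fst (S := S) (hG.indicator measurableSet_closedBall)]
  refine lintegral_mono fun y => ?_
  dsimp only
  by_cases hy : ‖y.1‖ ≤ L
  · rw [indicator_of_mem (mem_closedBall_zero_iff.2 hy)]
    exact (mul_le_of_le_one_left' (hb1 y)).trans (hFG y)
  · rw [hbL y (not_le.1 hy), zero_mul]
    exact zero_le

theorem lintegral_mul_badKernel_le (hρ : 0 < ρ) (hb1 : ∀ y, b y ≤ 1) (l : ℕ) :
    ∫⁻ y, b y * badKernel D T ρ l y ∂(refMeasure S) ≤ ENNReal.ofReal ((l + 1) ^ 5) *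
      (ENNReal.ofReal ((D.r / ρ) ^ 5) * volume (Metric.closedBall (0 : ℝ × ℝ) T.N)) := by
  have hr := D.r_pos
  calc ∫⁻ y, b y * badKernel D T ρ l y ∂(refMeasure S)
      ≤ ∫⁻ y, badKernel D T ρ l y ∂(refMeasure S) :=
        lintegral_mono fun y => mul_le_of_le_one_left' (hb1 y)
    _ = ENNReal.ofReal ((l * D.r / ρ) ^ 5) * volume (Metric.closedBall (0 : ℝ × ℝ) T.N) :=
        (lintegral_refMeasure_fst (measurable_const.indicator measurableSet_closedBall)).trans
          (lintegral_indicator_const measurableSet_closedBall _)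
    _ ≤ _ := by
        rw [← mul_assoc, ← ENNReal.ofReal_mul (by positivity), ← mul_pow, mul_div_assoc]
        gcongr
        linarith

theorem lintegral_mul_jacLoss_le (hb1 : ∀ y, b y ≤ 1) (hbL : ∀ y, L < ‖y.1‖ → b y = 0) :
    ∫⁻ y, b y * jacLoss T w y ∂(refMeasure S) ≤ ENNReal.ofReal (‖w‖ ^ 2) *
      ∫⁻ x in Metric.closedBall (0 : ℝ × ℝ) L, ENNReal.ofReal ((T.rho / (1 + ‖x‖)) ^ 2) := by
  have hmeas : Measurable fun x : ℝ × ℝ => ENNReal.ofReal ((T.rho / (1 + ‖x‖)) ^ 2) := by fun_prop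
  rw [← lintegral_const_mul _ hmeas]
  refine lintegral_mul_le_setLIntegral hb1 hbL (hmeas.const_mul _) fun y => ?_
  have := T.abs_fderiv_apply_le y.1 w
  rw [jacLoss, ← ENNReal.ofReal_mul (by positivity), ← sq_abs, mul_comm, ← mul_pow]
  gcongr

theorem lintegral_mul_pathKernel_le (hρ : 0 < ρ) (hb : Measurable b) (hb1 : ∀ y, b y ≤ 1)
    (hbL : ∀ y, L < ‖y.1‖ → b y = 0) (l : ℕ) :
    ∫⁻ y, b y * pathKernel D T w ρ l y ∂(refMeasure S) ≤ ENNReal.ofReal ((l + 1) ^ 5) *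
      (ENNReal.ofReal ((D.r / ρ) ^ 5) * volume (Metric.closedBall (0 : ℝ × ℝ) T.N) +
        ENNReal.ofReal (‖w‖ ^ 2) *
          ∫⁻ x in Metric.closedBall (0 : ℝ × ℝ) L, ENNReal.ofReal ((T.rho / (1 + ‖x‖)) ^ 2)) := by
  simp only [pathKernel, mul_add]
  have hbad : Measurable fun y => b y * badKernel D T ρ l y := hb.mul (measurable_badKernel D T ρ l)
  rw [lintegral_add_left hbad]
  refine add_le_add (lintegral_mul_badKernel_le hρ hb1 l) ?_
  split_ifs with hl
  · rw [hl, Nat.cast_zero, zero_add, one_pow, ENNReal.ofReal_one, one_mul]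
    exact lintegral_mul_jacLoss_le hb1 hbL
  · simp only [mul_zero, lintegral_zero, zero_le]

theorem lintegral_mul_pairKernel_le (hb1 : ∀ y, b y ≤ 1) (hbL : ∀ y, L < ‖y.1‖ → b y = 0) (l : ℕ) :
    ∫⁻ y, b y * pairKernel D T w l y ∂(refMeasure S) ≤ ENNReal.ofReal ((l + 1) ^ 5) *
      (ENNReal.ofReal (6 * D.C * ‖w‖ ^ 2 * (1 + (D.r + ‖w‖)) ^ 6) *
        ∫⁻ x in Metric.closedBall (0 : ℝ × ℝ) L, ENNReal.ofReal ((T.rho / (1 + ‖x‖)) ^ 2)) := by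
  have hr := D.r_pos
  have hC := D.C_nonneg
  have hmeas : Measurable fun x : ℝ × ℝ => ENNReal.ofReal ((T.rho / (1 + ‖x‖)) ^ 2) := by fun_prop
  rw [← mul_assoc, ← lintegral_const_mul _ hmeas]
  refine lintegral_mul_le_setLIntegral hb1 hbL (hmeas.const_mul _) fun y => ?_
  rw [pairKernel, ← ENNReal.ofReal_mul (by positivity), ← ENNReal.ofReal_mul (by positivity),
    mul_comm (((l : ℝ) + 1) ^ 5)]
  gcongr
  exacts [by linarith [(l.cast_nonneg : (0 : ℝ) ≤ l)], by norm_num]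

theorem lossBound_le (hz : z * D.eps ≤ 2⁻¹) (hρ : 0 < ρ) (hb : Measurable b) (hb1 : ∀ y, b y ≤ 1)
    (hbL : ∀ y, L < ‖y.1‖ → b y = 0) :
    lossBound D T w ρ b z ≤ z * weightSeries * (ENNReal.ofReal ((D.r / ρ) ^ 5) *
        volume (Metric.closedBall (0 : ℝ × ℝ) T.N)) + lossRate D w z *
      ∫⁻ x in Metric.closedBall (0 : ℝ × ℝ) L, ENNReal.ofReal ((T.rho / (1 + ‖x‖)) ^ 2) := by
  have hpath := tsum_pow_mul_le hz
    (lintegral_mul_pathKernel_le (D := D) (T := T) (w := w) hρ hb hb1 hbL) 1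
  have hpair := tsum_pow_mul_le hz (fun l => (mul_le_mul_left
    (lintegral_mul_pairKernel_le (D := D) (T := T) (w := w) hb1 hbL l)
    (volume (Metric.closedBall (0 : ℝ × ℝ) (D.r + ‖w‖)))).trans_eq (mul_assoc _ _ _)) 2
  simp only [mul_assoc (lintegral _ _)] at hpair
  refine (add_le_add hpath (mul_le_mul_right hpair 2)).trans (le_of_eq ?_)
  rw [lossRate]
  ring

theorem lossBound_le_of_cutoff (hz : z * D.eps ≤ 2⁻¹) {K : ℝ} {m : ℕ} (hm : 1 ≤ m)
    (hrho : T.rho = K / m) (hN : T.N = 4 ^ m) (hb : Measurable b) (hb1 : ∀ y, b y ≤ 1)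
    (hbL : ∀ y, 4 ^ (m + 1) < ‖y.1‖ → b y = 0) :
    lossBound D T w (2 ^ m / 4) b z ≤
      z * weightSeries * ENNReal.ofReal (4 * (4 * D.r) ^ 5 / 2 ^ m) +
        lossRate D w z * ENNReal.ofReal (80 * K ^ 2 / m) := by
  have hr := D.r_pos
  refine (lossBound_le hz (by positivity) hb hb1 hbL).trans ?_
  rw [hrho, hN]
  gcongr
  · have hsq : (4 : ℝ) ^ m = 2 ^ m * 2 ^ m := by rw [← mul_pow]; norm_num
    rw [volume_closedBall_prod, ← ENNReal.ofReal_pow (by positivity),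
      ← ENNReal.ofReal_mul (by positivity), hsq]
    refine ENNReal.ofReal_le_ofReal (le_of_eq ?_)
    field_simp
    ring
  · exact setLIntegral_div_one_add_norm_sq_le K hm

theorem tendsto_ofReal_const_div {u : ℕ → ℝ} (hu : Tendsto u atTop atTop) (c : ℝ) :
    Tendsto (fun m => ENNReal.ofReal (c / u m)) atTop (𝓝 0) := by
  simpa only [ENNReal.ofReal_zero] using
    ENNReal.tendsto_ofReal ((tendsto_const_nhds (x := c)).div_atTop hu)

variable (D) in
theorem exists_lossBound_le (hz : z * D.eps ≤ 2⁻¹) (hztop : z ≠ ⊤) (w : ℝ × ℝ) (M : ℝ)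
    {ε : ℝ≥0∞} (hε : ε ≠ 0) :
    ∃ (T : Cutoff) (ρ L : ℝ), 0 < ρ ∧ T.rho * ‖w‖ < 1 ∧ M + ρ ≤ T.R ∧ M ≤ T.N ∧
      T.N + ρ + ‖w‖ + M ≤ L ∧ ∀ b : Particle S → ℝ≥0∞, Measurable b → (∀ y, b y ≤ 1) →
        (∀ y, L < ‖y.1‖ → b y = 0) → lossBound D T w ρ b z ≤ ε := by
  obtain ⟨K, hcut⟩ := exists_cutoff
  have htwo : Tendsto (fun m : ℕ => (2 : ℝ) ^ m) atTop atTop :=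
    tendsto_pow_atTop_atTop_of_one_lt one_lt_two
  have hloss : Tendsto (fun m : ℕ =>
      z * weightSeries * ENNReal.ofReal (4 * (4 * D.r) ^ 5 / 2 ^ m) +
        lossRate D w z * ENNReal.ofReal (80 * K ^ 2 / m)) atTop (𝓝 0) := by
    simpa only [mul_zero, add_zero] using
      (ENNReal.Tendsto.const_mul (tendsto_ofReal_const_div htwo _)
        (Or.inr (ENNReal.mul_ne_top hztop weightSeries_ne_top))).add
      (ENNReal.Tendsto.const_mul (tendsto_ofReal_const_div tendsto_natCast_atTop_atTop _)
        (Or.inr (lossRate_ne_top hztop)))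
  have hrho : Tendsto (fun m : ℕ => K / m * ‖w‖) atTop (𝓝 0) := by
    simpa only [zero_mul] using (tendsto_const_div_atTop_nhds_zero_nat K).mul_const ‖w‖
  obtain ⟨m, hm, hm_loss, hm_rho, hm_two⟩ := ((eventually_ge_atTop 1).and
    ((hloss.eventually (gt_mem_nhds (pos_iff_ne_zero.2 hε))).and
      ((hrho.eventually (gt_mem_nhds one_pos)).and
        (htwo.eventually_ge_atTop (4 * (|M| + ‖w‖)))))).exists
  obtain ⟨T, hTrho, hTR, hTN⟩ := hcut m hm
  have hpow : (2 : ℝ) ^ m ≤ 4 ^ m := by gcongr; norm_num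
  have hM := le_abs_self M
  have hM₀ := abs_nonneg M
  have hw₀ := norm_nonneg w
  refine ⟨T, 2 ^ m / 4, 4 ^ (m + 1), by positivity, by rwa [hTrho], by rw [hTR]; linarith,
    by rw [hTN]; linarith, by rw [hTN, pow_succ]; linarith, fun b hb hb1 hbL => ?_⟩
  exact (lossBound_le_of_cutoff hz hm hTrho hTN hb hb1 hbL).trans hm_loss.le

end LossEstimate

section SFinite

variable {α β : Type*} [MeasurableSpace α] [MeasurableSpace β]

theorem isSFiniteKernel_of_apply_univ_le (κ : Kernel α β) {N : α → ℕ} (hN : Measurable N)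
    (hκ : ∀ a, κ a univ ≤ N a) : IsSFiniteKernel κ := by
  classical
  have hlevel : ∀ n, MeasurableSet {a | N a = n} := fun n => hN (measurableSet_singleton n)
  refine ⟨⟨fun n => Kernel.piecewise (hlevel n) κ 0,
    fun n => ⟨⟨n, ENNReal.natCast_lt_top n, fun a => ?_⟩⟩, Kernel.ext fun a => ?_⟩⟩
  · rw [Kernel.piecewise_apply]
    split_ifs with ha
    exacts [ha ▸ hκ a, zero_le]
  · refine Measure.ext fun A hA => ?_
    rw [Kernel.sum_apply' _ _ hA, tsum_eq_single (N a), Kernel.piecewise_apply]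
    · exact (if_pos rfl).symm ▸ rfl
    · intro n hn
      rw [Kernel.piecewise_apply, if_neg (show a ∉ {a | N a = n} from hn.symm)]
      rfl

theorem isSFiniteKernel_of_restrict_preimage (κ : Kernel α β) {g : β → ℕ} (hg : Measurable g)
    (hκ : ∀ n, IsSFiniteKernel (κ.restrict (hg (measurableSet_singleton n)))) :
    IsSFiniteKernel κ := by
  have hsum : κ = Kernel.sum fun n => κ.restrict (hg (measurableSet_singleton n)) := by
    refine Kernel.ext fun a => ?_
    simp only [Kernel.sum_apply, Kernel.restrict_apply]
    rw [← Measure.restrict_iUnion (fun m n hmn => (disjoint_singleton.2 hmn).preimage g)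
      fun n => hg (measurableSet_singleton n), ← preimage_iUnion, iUnion_of_singleton,
      preimage_univ, Measure.restrict_univ]
  rw [hsum]
  exact Kernel.isSFiniteKernel_sum

end SFinite

section PointKernel

variable {S : Type*}

theorem Config.finite_inter_floor_norm (Y : Config S) (n : ℕ) :
    (Y.1 ∩ (fun y => ⌊‖y.1‖⌋₊) ⁻¹' {n}).Finite := by
  refine Y.2 {x | ⌊‖x‖⌋₊ = n} (isBounded_iff_forall_norm_le.2 ⟨n + 1, fun x hx => ?_⟩)
  exact (hx ▸ Nat.lt_floor_add_one ‖x‖).le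

theorem Config.countable (Y : Config S) : Y.1.Countable := by
  have hcover : Y.1 = ⋃ n : ℕ, Y.1 ∩ (fun y => ⌊‖y.1‖⌋₊) ⁻¹' {n} := by
    rw [← inter_iUnion, ← preimage_iUnion, iUnion_of_singleton, preimage_univ, inter_univ]
  rw [hcover]
  exact countable_iUnion fun n => (Y.finite_inter_floor_norm n).countable

variable [MeasurableSpace S]

theorem measurable_floor_norm : Measurable fun y : Particle S => ⌊‖y.1‖⌋₊ := by fun_prop

theorem Config.measurable_comp_count {β : Type*} [MeasurableSpace β] (g : ℕ∞ → β)
    {A : Set (Particle S)} (hA : MeasurableSet A) :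
    Measurable fun Y : Config S => g (Config.count A Y) :=
  Measurable.comp (fun _ _ => trivial) (Config.measurable_count hA)

variable [MeasurableSingletonClass S]

theorem Config.measurableSet (Y : Config S) : MeasurableSet Y.1 := Y.countable.measurableSet

theorem Config.count_restrict_apply (Y : Config S) {A : Set (Particle S)} (hA : MeasurableSet A) :
    Measure.count.restrict Y.1 A = (Config.count A Y : ℝ≥0∞) := by
  rw [Measure.restrict_apply hA, Measure.count_apply (hA.inter Y.measurableSet), inter_comm]
  rfl

/-- The counting measure of a configuration, as a kernel. -/
def pointKernel (S : Type*) [MeasurableSpace S] [MeasurableSingletonClass S] :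
    Kernel (Config S) (Particle S) where
  toFun Y := Measure.count.restrict Y.1
  measurable' := Measure.measurable_of_measurable_coe _ fun A hA => by
    simp only [Config.count_restrict_apply _ hA]
    exact Config.measurable_comp_count (fun n => (n : ℝ≥0∞)) hA

theorem pointKernel_apply (Y : Config S) : pointKernel S Y = Measure.count.restrict Y.1 := rfl

theorem lintegral_pointKernel (Y : Config S) (f : Particle S → ℝ≥0∞) :
    ∫⁻ y, f y ∂(pointKernel S Y) = ∑' y : Y.1, f y := by
  rw [pointKernel_apply, ← lintegral_indicator Y.measurableSet, lintegral_count, tsum_subtype]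

instance : IsSFiniteKernel (pointKernel S) := by
  refine isSFiniteKernel_of_restrict_preimage _ measurable_floor_norm fun n => ?_
  have hn := measurable_floor_norm (S := S) (measurableSet_singleton n)
  refine isSFiniteKernel_of_apply_univ_le _
    (Config.measurable_comp_count ENat.toNat hn) fun Y => le_of_eq ?_
  have hfin : Config.count ((fun y => ⌊‖y.1‖⌋₊) ⁻¹' {n}) Y ≠ ⊤ :=
    encard_ne_top_iff.2 (Y.finite_inter_floor_norm n)
  rw [Kernel.restrict_apply, Measure.restrict_apply_univ, pointKernel_apply,
    Y.count_restrict_apply hn, ← ENat.toENNReal_coe, ENat.natCast_toNat hfin]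

end PointKernel

section Measurability

variable {S : Type*} [MeasurableSpace S] {U : Particle S → Particle S → ℝ≥0∞}

/-- The interaction of a particle with a configuration. -/
def field (U : Particle S → Particle S → ℝ≥0∞) (Y : Config S) (y : Particle S) : ℝ≥0∞ :=
  ∑' y' : Y.1, U y y'

theorem measurable_field (hU : Measurable (Function.uncurry U)) (Y : Config S) :
    Measurable (field U Y) :=
  have : Countable Y.1 := Y.countable
  Measurable.tsum fun _ => hU.comp (measurable_id.prodMk measurable_const)

variable [MeasurableSingletonClass S]

theorem measurable_interaction (hU : Measurable (Function.uncurry U)) :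
    Measurable fun Y : Config S × Config S => interaction U Y.1 Y.2 := by
  have hfield : Measurable fun q : (Config S × Config S) × Particle S =>
      ∫⁻ y, U q.2 y ∂(pointKernel S q.1.2) :=
    Measurable.lintegral_kernel_prod_right'
      (κ := (pointKernel S).comap (fun q : (Config S × Config S) × Particle S => q.1.2)
        (by fun_prop))
      (f := fun q : ((Config S × Config S) × Particle S) × Particle S => U q.1.2 q.2)
      (hU.comp (f := fun q : ((Config S × Config S) × Particle S) × Particle S => (q.1.2, q.2))
        (by fun_prop))
  have hsum := Measurable.lintegral_kernel_prod_right'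
    (κ := (pointKernel S).comap Prod.fst measurable_fst) hfield
  simp only [Kernel.comap_apply, lintegral_pointKernel] at hsum
  exact hsum

variable [Countable S]

theorem measurable_energy (hU : Measurable (Function.uncurry U)) : Measurable (energy U) := by
  have hpair : Measurable (Function.uncurry fun y y' : Particle S =>
      ({y' | y' ≠ y} : Set (Particle S)).indicator (U y) y') := by
    have hne : MeasurableSet {p : Particle S × Particle S | p.2 ≠ p.1} :=
      (measurableSet_eq_fun measurable_snd measurable_fst).compl
    classical
    convert hU.indicator hne using 1
    funext ⟨y, y'⟩
    simp only [Function.uncurry_apply_pair, indicator_apply, Set.mem_ofPred_eq]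
  exact ((measurable_interaction hpair).comp (measurable_id.prodMk measurable_id)).const_mul _

theorem measurable_weight (hU : Measurable (Function.uncurry U)) (z : ℝ) {Λ : Set (ℝ × ℝ)}
    (hΛ : MeasurableSet Λ) : Measurable (weight U z Λ) := by
  have hrestrict := Config.measurable_restrict (S := S) hΛ
  have henergy : Measurable (hamiltonian U Λ) :=
    ((measurable_energy hU).comp hrestrict).add
      ((measurable_interaction hU).comp (hrestrict.prodMk (Config.measurable_restrict hΛ.compl)))
  exact (measurable_boltzmann.comp henergy).mul (Config.measurable_comp_count
    (fun n => ENNReal.ofReal z ^ n.toNat) (measurable_fst hΛ))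

end Measurability

section PairSums

variable {ι P R : Type*} [Fintype ι] [LinearOrder ι] {u : P → P → R}

theorem sum_edges_pairVal [AddCommMonoid R] (hu : ∀ a b, u a b = u b a) (y : ι → P) :
    ∑ p ∈ edges ι, pairVal u y p = ∑ i, ∑ j, if i < j then u (y i) (y j) else 0 := by
  rw [edges, ← Finset.sum_product', Finset.univ_product_univ, ← Finset.sum_filter,
    ← Finset.sym2_univ, Finset.sum_sym2_filter_not_isDiag]
  refine Finset.sum_congr (Finset.ext fun p => ?_) fun p _ => pairVal_mk hu y p.1 p.2
  simpa only [Finset.mem_filter, Finset.mem_offDiag, Finset.mem_univ, true_and,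
    and_iff_right_iff_imp] using ne_of_lt

theorem sum_sum_ne_eq_two_mul [NonAssocSemiring R] (hu : ∀ a b, u a b = u b a) (y : ι → P) :
    ∑ i, ∑ j, (if j ≠ i then u (y i) (y j) else 0) = 2 * ∑ p ∈ edges ι, pairVal u y p := by
  have hswap : ∑ i, ∑ j, (if i < j then u (y i) (y j) else 0) =
      ∑ i, ∑ j, (if j < i then u (y i) (y j) else 0) := by
    rw [Finset.sum_comm]
    simp only [hu]
  rw [two_mul, sum_edges_pairVal hu]
  nth_rewrite 2 [hswap]
  simp only [← Finset.sum_add_distrib]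
  refine Finset.sum_congr rfl fun i _ => Finset.sum_congr rfl fun j _ => ?_
  rcases lt_trichotomy i j with h | rfl | h
  · simp [h, h.ne', h.not_gt]
  · simp
  · simp [h, h.ne, h.not_gt]

end PairSums

section FiniteConfigurations

variable {S : Type*} {U : Particle S → Particle S → ℝ≥0∞} {ι : Type*} [Fintype ι]
  {y : ι → Particle S} {Y : Config S}

theorem energy_eq_sum [LinearOrder ι] (hsymm : ∀ a b, U a b = U b a) (hy : Function.Injective y)
    (hY : Y.1 = range y) : energy U Y = ∑ p ∈ edges ι, pairVal U y p := by
  have hordered : energy U Y = 2⁻¹ * ∑ i, ∑ j, (if j ≠ i then U (y i) (y j) else 0) := by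
    rw [energy, hY, tsum_range (fun y₁ => ∑' y₂ : range y,
      ({y | y ≠ y₁} : Set (Particle S)).indicator (U y₁) y₂) hy, tsum_fintype]
    refine congrArg _ (Finset.sum_congr rfl fun i _ => ?_)
    rw [tsum_range (fun y₂ => ({p | p ≠ y i} : Set (Particle S)).indicator (U (y i)) y₂) hy,
      tsum_fintype]
    classical
    simp only [indicator_apply, Set.mem_ofPred_eq, hy.ne_iff]
  rw [hordered, sum_sum_ne_eq_two_mul hsymm, ← mul_assoc,
    ENNReal.inv_mul_cancel two_ne_zero ENNReal.ofNat_ne_top, one_mul]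

theorem interaction_eq_sum (hy : Function.Injective y) (hY : Y.1 = range y) (Y' : Config S) :
    interaction U Y Y' = ∑ i, field U Y' (y i) := by
  rw [interaction, hY, tsum_range (fun y₁ => ∑' y₂ : Y'.1, U y₁ y₂) hy, tsum_fintype]
  rfl

end FiniteConfigurations

section BoundaryConditions

variable {S : Type*} {U : Particle S → Particle S → ℝ≥0∞} {Λ : Set (ℝ × ℝ)} {k : ℕ}
  {y : Fin k → Particle S}

/-- The configuration formed by the entries of a tuple inside `Λ` and the particles of a boundary
condition outside `Λ`. -/
def glue (Λ : Set (ℝ × ℝ)) (Ybar : Config S) (y : Fin k → Particle S) : Config S :=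
  ((Config.ofTuple y).restrict Λ).union (Ybar.restrict Λᶜ)

theorem mem_glue (Ybar : Config S) {p : Particle S} (hp : p.1 ∈ Λ) :
    p ∈ (glue Λ Ybar y).1 ↔ ∃ i, y i = p := by
  constructor
  · rintro (⟨hpy, -⟩ | ⟨-, hp'⟩)
    · exact hpy
    · exact absurd hp hp'
  · exact fun hpy => Or.inl ⟨hpy, hp⟩

theorem restrict_glue (Ybar : Config S) (hy : ∀ i, (y i).1 ∈ Λ) :
    ((glue Λ Ybar y).restrict Λ).1 = range y := by
  refine Subset.antisymm (fun p hp => (mem_glue Ybar hp.2).1 hp.1) ?_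
  rintro _ ⟨i, rfl⟩
  exact ⟨(mem_glue Ybar (hy i)).2 ⟨i, rfl⟩, hy i⟩

theorem restrict_compl_glue (Λ : Set (ℝ × ℝ)) (Ybar : Config S) (y : Fin k → Particle S) :
    (glue Λ Ybar y).restrict Λᶜ = Ybar.restrict Λᶜ := by
  refine Subtype.ext (Set.ext fun p => ?_)
  constructor
  · rintro ⟨⟨_, hp⟩ | hp, hp'⟩
    · exact absurd hp hp'
    · exact hp
  · exact fun hp => ⟨Or.inr hp, hp.2⟩

/-- The one-particle weight of a particle in `Λ` in the field of a boundary condition. -/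
def boundaryWeight (U : Particle S → Particle S → ℝ≥0∞) (Λ : Set (ℝ × ℝ)) (Ybar : Config S) :
    Particle S → ℝ≥0∞ :=
  (cyl S Λ).indicator fun y => boltzmann (field U (Ybar.restrict Λᶜ) y)

theorem boundaryWeight_le_one (Ybar : Config S) (y : Particle S) :
    boundaryWeight U Λ Ybar y ≤ 1 :=
  indicator_le' (fun _ _ => boltzmann_le_one _) (fun _ _ => zero_le) y

theorem weight_glue (hsymm : ∀ a b, U a b = U b a) (z : ℝ) (Ybar : Config S)
    (hy : Function.Injective y) (hyΛ : ∀ i, (y i).1 ∈ Λ) :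
    weight U z Λ (glue Λ Ybar y) = ENNReal.ofReal z ^ k *
      tupleWeight (boundaryWeight U Λ Ybar) (fun a b => boltzmann (U a b)) y := by
  have hrange := restrict_glue Ybar hyΛ
  have hcard : (range y).ncard = k := by
    rw [← image_univ, ncard_image_of_injective _ hy, ncard_univ, Nat.card_fin]
  have hfield : ∀ i, boundaryWeight U Λ Ybar (y i) = boltzmann (field U (Ybar.restrict Λᶜ) (y i)) :=
    fun i => indicator_of_mem (show y i ∈ cyl S Λ from hyΛ i) _
  rw [weight, hrange, hcard, mul_comm, hamiltonian, energy_eq_sum hsymm hy hrange,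
    interaction_eq_sum hy hrange, restrict_compl_glue, ← boltzmann, boltzmann_add, boltzmann_sum,
    boltzmann_sum, tupleWeight, mul_comm (∏ p ∈ edges (Fin k), _)]
  simp only [hfield]
  rfl

theorem indicator_weight_glue (hsymm : ∀ a b, U a b = U b a) (z : ℝ) (Ybar : Config S)
    (A : Set (Config S)) (hy : Function.Injective y) :
    (univ.pi fun _ => cyl S Λ).indicator (fun y => A.indicator (weight U z Λ) (glue Λ Ybar y)) y =
      ENNReal.ofReal z ^ k * {y | glue Λ Ybar y ∈ A}.indicator
        (tupleWeight (boundaryWeight U Λ Ybar) fun a b => boltzmann (U a b)) y := by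
  classical
  by_cases hyΛ : ∀ i, (y i).1 ∈ Λ
  · rw [indicator_of_mem (show y ∈ univ.pi fun _ => cyl S Λ from fun i _ => hyΛ i)]
    simp only [indicator_apply, Set.mem_ofPred_eq, weight_glue hsymm z Ybar hy hyΛ, mul_ite,
      mul_zero]
  · obtain ⟨i, hi⟩ := not_forall.1 hyΛ
    have hzero : tupleWeight (boundaryWeight U Λ Ybar) (fun a b => boltzmann (U a b)) y = 0 := by
      have hnot : y i ∉ cyl S Λ := hi
      rw [tupleWeight, Finset.prod_eq_zero (Finset.mem_univ i) (indicator_of_notMem hnot _),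
        zero_mul]
    have hnot : y ∉ univ.pi fun _ => cyl S Λ := fun h => hi (h i trivial)
    rw [indicator_of_notMem hnot, indicator_apply, hzero, ite_self, mul_zero]

end BoundaryConditions

section InjectiveTuples

variable {P : Type*} [MeasurableSpace P] [MeasurableEq P] (ref : Measure P) [SigmaFinite ref]
  [NullSingletonClass ref] {k : ℕ}

theorem measure_pi_eq_eq_zero {i j : Fin k} (hij : i ≠ j) :
    Measure.pi (fun _ => ref) {y | y i = y j} = 0 := by
  obtain ⟨k, rfl⟩ : ∃ n, k = n + 1 := Nat.exists_eq_add_one.2 i.pos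
  obtain ⟨j, rfl⟩ := Fin.exists_succAbove_eq hij.symm
  have hdiag : MeasurableSet {q : P × (Fin k → P) | q.1 = q.2 j} :=
    measurableSet_eq_fun (by fun_prop) (by fun_prop)
  have hpreserving := measurePreserving_piFinSuccAbove (fun _ : Fin (k + 1) => ref) i
  calc Measure.pi (fun _ => ref) {y | y i = y (i.succAbove j)}
      = (ref.prod (Measure.pi fun _ => ref)) {q : P × (Fin k → P) | q.1 = q.2 j} :=
        hpreserving.measure_preimage hdiag.nullMeasurableSet
    _ = 0 := (Measure.measure_prod_null hdiag).2 <| Eventually.of_forall fun x =>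
        (congrArg _ (Set.ext fun _ => eq_comm)).trans (Measure.pi_hyperplane (fun _ => ref) j x)

theorem ae_injective (k : ℕ) :
    ∀ᵐ y ∂(Measure.pi fun _ : Fin k => ref), Function.Injective y := by
  have hne : ∀ p : Fin k × Fin k, ∀ᵐ y ∂(Measure.pi fun _ : Fin k => ref),
      p.1 ≠ p.2 → y p.1 ≠ y p.2 := fun p => by
    by_cases hp : p.1 = p.2
    · exact Eventually.of_forall fun _ h => absurd hp h
    · exact (measure_eq_zero_iff_ae_notMem.1 (measure_pi_eq_eq_zero ref hp)).mono fun _ hy _ => hy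
  filter_upwards [ae_all_iff.2 hne] with y hy i j hij
  exact not_imp_not.1 (hy (i, j)) hij

end InjectiveTuples

section FiniteVolumeFormula

variable {S : Type*} [MeasurableSpace S] {U : Particle S → Particle S → ℝ≥0∞} {Λ : Set (ℝ × ℝ)}

theorem measurable_boundaryWeight (hU : Measurable (Function.uncurry U)) (hΛ : MeasurableSet Λ)
    (Ybar : Config S) : Measurable (boundaryWeight U Λ Ybar) :=
  (measurable_boltzmann.comp (measurable_field hU _)).indicator (measurable_fst hΛ)

variable [MeasurableSingletonClass S]

theorem measurable_glue [Countable S] (hΛ : MeasurableSet Λ) (Ybar : Config S) (k : ℕ) :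
    Measurable fun y : Fin k → Particle S => glue Λ Ybar y :=
  (Config.measurable_glue hΛ Ybar).comp Config.measurable_ofTuple

variable [Finite S]

theorem lintegral_poissonBC (hΛ : MeasurableSet Λ) (Ybar : Config S) {f : Config S → ℝ≥0∞}
    (hf : Measurable f) :
    ∫⁻ Y, f Y ∂(poissonBC Λ Ybar) = ENNReal.ofReal (Real.exp (-(volume Λ).toReal)) *
      ∑' k : ℕ, (Nat.factorial k : ℝ≥0∞)⁻¹ *
        ∫⁻ y, (univ.pi fun _ : Fin k => cyl S Λ).indicator (fun y => f (glue Λ Ybar y)) y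
          ∂(Measure.pi fun _ : Fin k => refMeasure S) := by
  have hglue := Config.measurable_glue hΛ Ybar
  have hcyl : MeasurableSet (cyl S Λ) := measurable_fst hΛ
  rw [poissonBC, lintegral_map hf hglue, poisson, lintegral_smul_measure, smul_eq_mul,
    lintegral_sum_measure]
  refine congrArg _ (tsum_congr fun k => ?_)
  rw [lintegral_smul_measure, smul_eq_mul,
    lintegral_map (f := fun Y : Config S => f ((Y.restrict Λ).union (Ybar.restrict Λᶜ)))
      (hf.comp hglue) Config.measurable_ofTuple,
    ← Measure.restrict_pi_pi, lintegral_indicator (MeasurableSet.univ_pi fun _ => hcyl)]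
  rfl

instance : NullSingletonClass (refMeasure S) := by
  unfold refMeasure
  infer_instance

theorem lintegral_indicator_weight (hU : Measurable (Function.uncurry U))
    (hsymm : ∀ a b, U a b = U b a) (z : ℝ) (hΛ : MeasurableSet Λ) (Ybar : Config S)
    {A : Set (Config S)} (hA : MeasurableSet A) :
    ∫⁻ Y, A.indicator (weight U z Λ) Y ∂(poissonBC Λ Ybar) =
      ENNReal.ofReal (Real.exp (-(volume Λ).toReal)) *
        grandIntegral (refMeasure S) (ENNReal.ofReal z) fun _ y =>
          {y | glue Λ Ybar y ∈ A}.indicator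
            (tupleWeight (boundaryWeight U Λ Ybar) fun a b => boltzmann (U a b)) y := by
  rw [lintegral_poissonBC hΛ Ybar ((measurable_weight hU z hΛ).indicator hA), grandIntegral]
  refine congrArg _ (tsum_congr fun k => ?_)
  have htuple : Measurable fun y : Fin k → Particle S => {y | glue Λ Ybar y ∈ A}.indicator
      (tupleWeight (boundaryWeight U Λ Ybar) fun a b => boltzmann (U a b)) y :=
    (measurable_tupleWeight (e := fun a b => boltzmann (U a b))
      (measurable_boundaryWeight hU hΛ Ybar) (measurable_boltzmann.comp hU)).indicator
      (measurable_glue hΛ Ybar k hA)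
  rw [mul_comm (ENNReal.ofReal z ^ k), mul_assoc, ← lintegral_const_mul _ htuple]
  refine congrArg _ (lintegral_congr_ae ?_)
  filter_upwards [ae_injective (refMeasure S) k] with y hy
    using indicator_weight_glue hsymm z Ybar A hy

theorem partitionFunction_eq (hU : Measurable (Function.uncurry U))
    (hsymm : ∀ a b, U a b = U b a) (z : ℝ) (hΛ : MeasurableSet Λ) (Ybar : Config S) :
    partitionFunction U z Λ Ybar = ENNReal.ofReal (Real.exp (-(volume Λ).toReal)) *
      grandIntegral (refMeasure S) (ENNReal.ofReal z) fun _ y =>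
        tupleWeight (boundaryWeight U Λ Ybar) (fun a b => boltzmann (U a b)) y := by
  have h := lintegral_indicator_weight hU hsymm z hΛ Ybar MeasurableSet.univ
  simp only [indicator_univ, mem_univ, ofPred_true] at h
  exact h

end FiniteVolumeFormula

section LocalShift

variable {S : Type*} {T : Cutoff} {ρ m L : ℝ} {w : ℝ × ℝ} {k : ℕ} {B : Finset (Sym2 (Fin k))}
  {y : Fin k → Particle S}

theorem Config.mem_translate {Y : Config S} {v : ℝ × ℝ} {p : Particle S} :
    p ∈ (Y.translate v).1 ↔ (p.1 - v, p.2) ∈ Y.1 := by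
  constructor
  · rintro ⟨q, hq, rfl⟩
    simpa only [add_sub_cancel_right] using hq
  · exact fun hp => ⟨_, hp, by simp only [sub_add_cancel]⟩

theorem norm_fst_le_norm_clusterMove_add (T : Cutoff) (w : ℝ × ℝ) (B : Finset (Sym2 (Fin k)))
    (y : Fin k → Particle S) (i : Fin k) : ‖(y i).1‖ ≤ ‖(clusterMove T w B y i).1‖ + ‖w‖ := by
  have hshift : ‖T.τ (y (clusterRep B i)).1 • w‖ ≤ ‖w‖ := by
    rw [norm_smul, Real.norm_eq_abs, abs_of_nonneg (T.nonneg _)]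
    exact mul_le_of_le_one_left (norm_nonneg w) (T.le_one _)
  calc ‖(y i).1‖ = ‖(clusterMove T w B y i).1 - T.τ (y (clusterRep B i)).1 • w‖ := by
        rw [clusterMove, add_sub_cancel_right]
    _ ≤ ‖(clusterMove T w B y i).1‖ + ‖w‖ := (norm_sub_le _ _).trans (by gcongr)

theorem HasSmallClusters.clusterMove_eq {M : ℝ} (hy : HasSmallClusters T ρ B y) (hR : M + ρ ≤ T.R)
    (hN : M ≤ T.N) (w : ℝ × ℝ) {i : Fin k} (hi : ‖(y i).1‖ ≤ M) :
    clusterMove T w B y i = ((y i).1 + w, (y i).2) := by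
  have hclose := hy i (clusterRep B i) (reachable_clusterRep B i) (hi.trans hN)
  have hrep : ‖(y (clusterRep B i)).1‖ ≤ T.R := by
    linarith [norm_le_norm_add_norm_sub (y i).1 (y (clusterRep B i)).1]
  rw [clusterMove, T.eq_one _ hrep, one_smul]

theorem HasSmallClusters.clusterMove_eq_iff (hy : HasSmallClusters T ρ B y)
    (hR : m + 2 * ‖w‖ + ρ ≤ T.R) (hN : m + 2 * ‖w‖ ≤ T.N) {p : Particle S} (hp : ‖p.1‖ ≤ m)
    (i : Fin k) : clusterMove T w B y i = (p.1 + w, p.2) ↔ y i = p := by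
  constructor
  · intro h
    have hi : ‖(y i).1‖ ≤ m + 2 * ‖w‖ := by
      have hmove := norm_fst_le_norm_clusterMove_add T w B y i
      rw [h] at hmove
      linarith [norm_add_le p.1 w]
    rw [hy.clusterMove_eq hR hN w hi, Prod.mk.injEq, add_left_inj] at h
    exact Prod.ext h.1 h.2
  · rintro rfl
    exact hy.clusterMove_eq hR hN w (by linarith [norm_nonneg w])

theorem restrict_translate_glue_clusterMove (hR : m + 2 * ‖w‖ + ρ ≤ T.R) (hN : m + 2 * ‖w‖ ≤ T.N)
    (hL : m + ‖w‖ ≤ L) (Ybar : Config S) (hy : HasSmallClusters T ρ B y) :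
    ((glue (Metric.closedBall 0 L) Ybar (clusterMove T w B y)).translate (-w)).restrict
        (Metric.closedBall 0 m) =
      (glue (Metric.closedBall 0 L) Ybar y).restrict (Metric.closedBall 0 m) := by
  refine Subtype.ext (Set.ext fun p => and_congr_left fun hpm => ?_)
  have hp : ‖p.1‖ ≤ m := mem_closedBall_zero_iff.1 hpm
  have hpL : p.1 ∈ Metric.closedBall (0 : ℝ × ℝ) L :=
    mem_closedBall_zero_iff.2 (by linarith [norm_nonneg w])
  have hpwL : p.1 + w ∈ Metric.closedBall (0 : ℝ × ℝ) L :=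
    mem_closedBall_zero_iff.2 (by linarith [norm_add_le p.1 w])
  rw [Config.mem_translate, sub_neg_eq_add, mem_glue (p := (p.1 + w, p.2)) Ybar hpwL,
    mem_glue Ybar hpL]
  exact exists_congr fun i => hy.clusterMove_eq_iff hR hN hp i

end LocalShift

section KernelInequality

variable {S : Type*} {U : Particle S → Particle S → ℝ≥0∞}

theorem boundaryWeight_eq_one {r L : ℝ} (hr : 0 ≤ r)
    (hU : ∀ y y' : Particle S, r ≤ ‖y.1 - y'.1‖ → U y y' = 0) (Ybar : Config S) {y : Particle S}
    (hy : ‖y.1‖ ≤ L - r) : boundaryWeight U (Metric.closedBall 0 L) Ybar y = 1 := by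
  have hfield : field U (Ybar.restrict (Metric.closedBall 0 L)ᶜ) y = 0 := by
    refine ENNReal.tsum_eq_zero.2 fun y' => hU _ _ ?_
    have hy' : L < ‖y'.1.1‖ := not_le.1 (mt mem_closedBall_zero_iff.2 y'.2.2)
    linarith [norm_le_norm_add_norm_sub y.1 y'.1.1]
  have hmem : y ∈ cyl S (Metric.closedBall 0 L) := mem_closedBall_zero_iff.2 (by linarith)
  rw [boundaryWeight, indicator_of_mem hmem, hfield, boltzmann_zero]

theorem boundaryWeight_eq_zero {L : ℝ} (Ybar : Config S) {y : Particle S} (hy : L < ‖y.1‖) :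
    boundaryWeight U (Metric.closedBall 0 L) Ybar y = 0 :=
  indicator_of_notMem (s := cyl S (Metric.closedBall 0 L))
    (mt mem_closedBall_zero_iff.1 (not_le.2 hy)) _

variable [MeasurableSpace S]

theorem gibbsKernel_le_one (U : Particle S → Particle S → ℝ≥0∞) (z : ℝ) (Λ : Set (ℝ × ℝ))
    (Ybar : Config S) (A : Set (Config S)) : gibbsKernel U z Λ Ybar A ≤ 1 := by
  refine le_trans ?_ (ENNReal.inv_mul_le_one (partitionFunction U z Λ Ybar))
  rw [gibbsKernel]
  gcongr
  exact lintegral_mono fun Y => indicator_le_self' (fun _ _ => zero_le) Y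

variable [Finite S] [Nonempty S] [MeasurableSingletonClass S]

theorem gibbsKernel_le_of_clusterMove (D : SoftSplit S) (hU : Measurable (Function.uncurry U))
    (hsymm : ∀ a b, U a b = U b a) (hD : D.full = fun a b => boltzmann (U a b)) (z : ℝ)
    {T : Cutoff} {w : ℝ × ℝ} {ρ : ℝ} (hw : T.rho * ‖w‖ < 1) (hρ : 0 < ρ) {Λ : Set (ℝ × ℝ)}
    (hΛ : MeasurableSet Λ) (Ybar : Config S)
    (hfar : ∀ y : Particle S, ‖y.1‖ ≤ T.N + ρ + ‖w‖ → boundaryWeight U Λ Ybar y = 1)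
    {A A₁ A₂ : Set (Config S)} (hA : MeasurableSet A) (hA₁ : MeasurableSet A₁)
    (hA₂ : MeasurableSet A₂)
    (h₁ : ∀ k B (y : Fin k → Particle S), glue Λ Ybar y ∈ A → HasSmallClusters T ρ B y →
      glue Λ Ybar (clusterMove T w B y) ∈ A₁)
    (h₂ : ∀ k B (y : Fin k → Particle S), glue Λ Ybar y ∈ A → HasSmallClusters T ρ B y →
      glue Λ Ybar (clusterMove T (-w) B y) ∈ A₂) :
    gibbsKernel U z Λ Ybar A ≤ 2⁻¹ * gibbsKernel U z Λ Ybar A₁ +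
      2⁻¹ * gibbsKernel U z Λ Ybar A₂ +
        lossBound D T w ρ (boundaryWeight U Λ Ybar) (ENNReal.ofReal z) := by
  have hloss := grandIntegral_indicator_tupleWeight_le (ENNReal.ofReal z) (D := D)
    (A := fun _ => {y | glue Λ Ybar y ∈ A}) (A₁ := fun _ => {y | glue Λ Ybar y ∈ A₁})
    (A₂ := fun _ => {y | glue Λ Ybar y ∈ A₂}) hw hρ
    (measurable_boundaryWeight hU hΛ Ybar) (boundaryWeight_le_one Ybar) hfar
    (fun k => measurable_glue hΛ Ybar k hA₁) (fun k => measurable_glue hΛ Ybar k hA₂) h₁ h₂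
  rw [hD] at hloss
  set Z := partitionFunction U z Λ Ybar with hZ
  set c := ENNReal.ofReal (Real.exp (-(volume Λ).toReal))
  set l := lossBound D T w ρ (boundaryWeight U Λ Ybar) (ENNReal.ofReal z)
  have hdistrib : ∀ g₁ g₂ g₃ : ℝ≥0∞, Z⁻¹ * (c * (2⁻¹ * g₁ + 2⁻¹ * g₂ + l * g₃)) =
      2⁻¹ * (Z⁻¹ * (c * g₁)) + 2⁻¹ * (Z⁻¹ * (c * g₂)) + l * (Z⁻¹ * (c * g₃)) := by
    intros
    ring
  simp only [gibbsKernel, ← hZ, lintegral_indicator_weight hU hsymm z hΛ Ybar, hA, hA₁, hA₂]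
  refine (mul_le_mul_right (mul_le_mul_right hloss _) _).trans ?_
  rw [hdistrib, ← partitionFunction_eq hU hsymm z hΛ Ybar]
  gcongr
  exact mul_le_of_le_one_right' (ENNReal.inv_mul_le_one Z)

theorem exists_gibbsKernel_le (D : SoftSplit S) (hU : Measurable (Function.uncurry U))
    (hsymm : ∀ a b, U a b = U b a) (hD : D.full = fun a b => boltzmann (U a b)) {r : ℝ} (hr : 0 ≤ r)
    (hrange : ∀ y y' : Particle S, r ≤ ‖y.1 - y'.1‖ → U y y' = 0) {z : ℝ}
    (hz : ENNReal.ofReal z * D.eps ≤ 2⁻¹) (w : ℝ × ℝ) {m : ℝ} (hm : 0 ≤ m) {ε : ℝ≥0∞}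
    (hε : ε ≠ 0) : ∃ Λ : Set (ℝ × ℝ), MeasurableSet Λ ∧ Bornology.IsBounded Λ ∧
      ∀ A : Set (Config S), MeasurableSet[eventsIn S (Metric.closedBall 0 m)] A →
        ∀ Ybar : Config S, gibbsKernel U z Λ Ybar A ≤
          2⁻¹ * gibbsKernel U z Λ Ybar (Config.translate (-w) ⁻¹' A) +
            2⁻¹ * gibbsKernel U z Λ Ybar (Config.translate w ⁻¹' A) + ε := by
  obtain ⟨T, ρ, L, hρ, hw, hR, hN, hL, hloss⟩ :=
    exists_lossBound_le D hz ENNReal.ofReal_ne_top w (m + 2 * ‖w‖ + r) hε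
  have hw0 := norm_nonneg w
  have hΛ : MeasurableSet (Metric.closedBall (0 : ℝ × ℝ) L) := measurableSet_closedBall
  refine ⟨_, hΛ, Metric.isBounded_closedBall, ?_⟩
  rintro _ ⟨A, hA, rfl⟩ Ybar
  have hA₀ := Config.measurable_restrict (S := S)
    (measurableSet_closedBall (x := (0 : ℝ × ℝ)) (ε := m)) hA
  have hlocal : ∀ v : ℝ × ℝ, ‖v‖ = ‖w‖ → ∀ k B (y : Fin k → Particle S),
      glue (Metric.closedBall 0 L) Ybar y ∈ Config.restrict (Metric.closedBall 0 m) ⁻¹' A →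
      HasSmallClusters T ρ B y → (glue (Metric.closedBall 0 L) Ybar
        (clusterMove T v B y)).translate (-v) ∈ Config.restrict (Metric.closedBall 0 m) ⁻¹' A := by
    intro v hv k B y hyA hy
    rwa [mem_preimage, restrict_translate_glue_clusterMove (by linarith) (by linarith)
      (by linarith) Ybar hy]
  refine (gibbsKernel_le_of_clusterMove D hU hsymm hD z hw hρ hΛ Ybar
    (fun y hy => boundaryWeight_eq_one hr hrange Ybar (by linarith)) hA₀
    (Config.measurable_translate (-w) hA₀) (Config.measurable_translate w hA₀)
    (hlocal w rfl) fun k B y hyA hy => ?_).trans ?_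
  · have hneg := hlocal (-w) (norm_neg w) k B y hyA hy
    rwa [neg_neg] at hneg
  · gcongr
    exact hloss _ (measurable_boundaryWeight hU hΛ Ybar) (boundaryWeight_le_one Ybar)
      fun y hy => boundaryWeight_eq_zero Ybar hy

end KernelInequality

section LocalEvents

variable {S : Type*}

theorem Config.translate_translate (u v : ℝ × ℝ) (Y : Config S) :
    (Y.translate u).translate v = Y.translate (u + v) := by
  refine Subtype.ext ?_
  simp only [Config.translate, image_image, add_assoc]

theorem Config.translate_zero (Y : Config S) : Y.translate 0 = Y := by
  refine Subtype.ext ?_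
  simp only [Config.translate, add_zero, Prod.mk.eta, image_id']

theorem Config.restrict_restrict_of_subset {Δ Δ' : Set (ℝ × ℝ)} (h : Δ ⊆ Δ') (Y : Config S) :
    (Y.restrict Δ').restrict Δ = Y.restrict Δ :=
  Subtype.ext (Set.ext fun _ => ⟨fun hp => ⟨hp.1.1, hp.2⟩, fun hp => ⟨⟨hp.1, h hp.2⟩, hp.2⟩⟩)

theorem Config.restrict_translate_restrict {Δ Δ' : Set (ℝ × ℝ)} {v : ℝ × ℝ}
    (h : ∀ x, x + v ∈ Δ → x ∈ Δ') (Y : Config S) :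
    ((Y.restrict Δ').translate v).restrict Δ = (Y.translate v).restrict Δ := by
  refine Subtype.ext (Set.ext fun p => ?_)
  constructor
  · rintro ⟨⟨q, hq, rfl⟩, hp⟩
    exact ⟨⟨q, hq.1, rfl⟩, hp⟩
  · rintro ⟨⟨q, hq, rfl⟩, hp⟩
    exact ⟨⟨q, ⟨hq, h _ hp⟩, rfl⟩, hp⟩

theorem Config.exists_subset_restrict_closedBall {Y : Config S} {t : Set (Particle S)}
    (ht : t.Finite) (htY : t ⊆ Y.1) : ∃ m : ℕ, t ⊆ (Y.restrict (Metric.closedBall 0 m)).1 := by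
  obtain ⟨C, hC⟩ := (ht.image Prod.fst).isBounded.exists_norm_le
  obtain ⟨m, hm⟩ := exists_nat_ge C
  exact ⟨m, fun p hp =>
    ⟨htY hp, mem_closedBall_zero_iff.2 ((hC _ (mem_image_of_mem _ hp)).trans hm)⟩⟩

theorem Config.count_le_iff (B : Set (Particle S)) (a : ℕ∞) (Y : Config S) :
    Config.count B Y ≤ a ↔
      ∀ m : ℕ, Config.count B (Y.restrict (Metric.closedBall 0 m)) ≤ a := by
  refine ⟨fun h m => (encard_le_encard (inter_subset_inter_left _ inter_subset_left)).trans h,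
    fun h => le_of_not_gt fun hlt => ?_⟩
  obtain ⟨t, htYB, hta⟩ := exists_subset_encard_eq (Order.add_one_le_of_lt hlt)
  have htfin : t.Finite := by
    rw [← encard_ne_top_iff, hta]
    exact WithTop.add_ne_top.2 ⟨hlt.ne_top, ENat.one_ne_top⟩
  obtain ⟨m, hm⟩ := Config.exists_subset_restrict_closedBall htfin (htYB.trans inter_subset_left)
  have hle := (encard_le_encard (subset_inter hm (htYB.trans inter_subset_right))).trans (h m)
  rw [hta] at hle
  exact absurd hle (not_le.2 ((ENat.lt_add_one_iff hlt.ne_top).2 le_rfl))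

theorem measurable_enat_of_measurableSet_le {α : Type*} [MeasurableSpace α] {f : α → ℕ∞}
    (hf : ∀ a, MeasurableSet {x | f x ≤ a}) : Measurable[_, ⊤] f := by
  have hsingleton : ∀ a, MeasurableSet (f ⁻¹' {a}) := fun a => by
    have hdiff : f ⁻¹' {a} = {x | f x ≤ a} \ ⋃ c ∈ Iio a, {x | f x ≤ c} := by
      ext x
      simp only [mem_preimage, mem_singleton_iff, Set.mem_sdiff, mem_iUnion, mem_Iio,
        Set.mem_ofPred_eq, exists_prop, not_exists, not_and]
      exact ⟨fun h => ⟨h.le, fun c hc hx => (h ▸ hx).not_gt hc⟩,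
        fun h => h.1.eq_or_lt.resolve_right fun hlt => h.2 _ hlt le_rfl⟩
    rw [hdiff]
    exact (hf a).diff (MeasurableSet.biUnion (to_countable _) fun c _ => hf c)
  intro t _
  rw [← biUnion_preimage_singleton]
  exact MeasurableSet.biUnion (to_countable t) fun a _ => hsingleton a

variable [MeasurableSpace S]

/-- The local events: those that only depend on the particles in some ball around the origin. -/
def IsLocal (A : Set (Config S)) : Prop :=
  ∃ m : ℕ, MeasurableSet[eventsIn S (Metric.closedBall 0 m)] A

theorem eventsIn_mono {Δ Δ' : Set (ℝ × ℝ)} (hΔ : MeasurableSet Δ) (h : Δ ⊆ Δ') :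
    eventsIn S Δ ≤ eventsIn S Δ' := by
  rintro _ ⟨A, hA, rfl⟩
  refine ⟨Config.restrict Δ ⁻¹' A, Config.measurable_restrict hΔ hA, ?_⟩
  rw [← preimage_comp]
  exact congrArg (· ⁻¹' A) (funext (Config.restrict_restrict_of_subset h))

theorem eventsIn_closedBall_mono : Monotone fun m : ℕ => eventsIn S (Metric.closedBall 0 m) :=
  fun _ _ hmn => eventsIn_mono measurableSet_closedBall
    (Metric.closedBall_subset_closedBall (Nat.cast_le.2 hmn))

theorem IsLocal.measurableSet {A : Set (Config S)} (hA : IsLocal A) : MeasurableSet A := by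
  obtain ⟨m, hm⟩ := hA
  exact eventsIn_le measurableSet_closedBall _ hm

theorem IsLocal.translate {A : Set (Config S)} (hA : IsLocal A) (v : ℝ × ℝ) :
    IsLocal (Config.translate v ⁻¹' A) := by
  obtain ⟨m, A, hA, rfl⟩ := hA
  obtain ⟨n, hn⟩ := exists_nat_ge (m + ‖v‖)
  have hball : ∀ x : ℝ × ℝ, x + v ∈ Metric.closedBall 0 (m : ℝ) → x ∈ Metric.closedBall 0 (n : ℝ) :=
    fun x hx => by
      rw [mem_closedBall_zero_iff] at hx ⊢
      have hsub := norm_sub_le (x + v) v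
      rw [add_sub_cancel_right] at hsub
      linarith
  refine ⟨n, Config.translate v ⁻¹' (Config.restrict (Metric.closedBall 0 m) ⁻¹' A),
    Config.measurable_translate v (Config.measurable_restrict measurableSet_closedBall hA), ?_⟩
  simp only [← preimage_comp]
  exact congrArg (· ⁻¹' A) (funext (Config.restrict_translate_restrict hball))

theorem isPiSystem_isLocal : IsPiSystem {A : Set (Config S) | IsLocal A} := by
  rintro A ⟨m, hA⟩ B ⟨n, hB⟩ -
  exact ⟨max m n, (eventsIn_closedBall_mono (le_max_left m n) _ hA).inter
    (eventsIn_closedBall_mono (le_max_right m n) _ hB)⟩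

theorem generateFrom_isLocal : (Config.instMeasurableSpace : MeasurableSpace (Config S)) =
    MeasurableSpace.generateFrom {A : Set (Config S) | IsLocal A} := by
  refine le_antisymm (iSup₂_le fun B hB => ?_)
    (MeasurableSpace.generateFrom_le fun A hA => IsLocal.measurableSet hA)
  refine (@measurable_enat_of_measurableSet_le _ (MeasurableSpace.generateFrom _) _
    fun a => ?_).comap_le
  have hball : {Y | Config.count B Y ≤ a} =
      ⋂ m : ℕ, {Y | Config.count B (Y.restrict (Metric.closedBall 0 m)) ≤ a} := by
    ext Y
    rw [mem_iInter]
    exact Config.count_le_iff B a Y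
  rw [hball]
  refine MeasurableSet.iInter fun m => MeasurableSpace.measurableSet_generateFrom ⟨m, ?_⟩
  exact ⟨{Y | Config.count B Y ≤ a}, Config.measurable_count hB (t := Iic a) trivial, rfl⟩

end LocalEvents

section TranslationInvariance

theorem le_of_midpoint_le_of_bounded {a : ℕ → ℝ} (ha : ∀ k, a (k + 1) ≤ (a k + a (k + 2)) / 2)
    {C : ℝ} (hC : ∀ k, a k ≤ C) : a 1 ≤ a 0 := by
  by_contra! h
  have hstep : ∀ k, a 1 - a 0 ≤ a (k + 1) - a k := by
    intro k
    induction k with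
    | zero => exact le_rfl
    | succ k ih => linarith [ha k]
  have hgrow : ∀ k : ℕ, a 0 + k * (a 1 - a 0) ≤ a k := by
    intro k
    induction k with
    | zero => simp
    | succ k ih => push_cast; linarith [hstep k]
  obtain ⟨k, hk⟩ := exists_nat_gt ((C - a 0) / (a 1 - a 0))
  rw [div_lt_iff₀ (sub_pos.2 h)] at hk
  linarith [hgrow k, hC k]

variable {S : Type*} [MeasurableSpace S] {μ : Measure (Config S)}

theorem measureReal_translate_preimage_le [IsProbabilityMeasure μ]
    (h : ∀ A : Set (Config S), IsLocal A → ∀ v : ℝ × ℝ,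
      μ.real A ≤ (μ.real (Config.translate (-v) ⁻¹' A) + μ.real (Config.translate v ⁻¹' A)) / 2)
    {A : Set (Config S)} (hA : IsLocal A) (v : ℝ × ℝ) :
    μ.real (Config.translate v ⁻¹' A) ≤ μ.real A := by
  have hmid : ∀ k : ℕ, μ.real (Config.translate (((k + 1 : ℕ) : ℝ) • v) ⁻¹' A) ≤
      (μ.real (Config.translate ((k : ℝ) • v) ⁻¹' A) +
        μ.real (Config.translate (((k + 2 : ℕ) : ℝ) • v) ⁻¹' A)) / 2 := fun k => by
    have hk := h _ (hA.translate (((k + 1 : ℕ) : ℝ) • v)) v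
    have hleft : -v + ((k + 1 : ℕ) : ℝ) • v = (k : ℝ) • v := by push_cast; module
    have hright : v + ((k + 1 : ℕ) : ℝ) • v = ((k + 2 : ℕ) : ℝ) • v := by push_cast; module
    simpa only [← preimage_comp, Function.comp_def, Config.translate_translate, hleft, hright]
      using hk
  have hle := le_of_midpoint_le_of_bounded
    (a := fun k : ℕ => μ.real (Config.translate ((k : ℝ) • v) ⁻¹' A)) hmid
    fun _ => measureReal_le_one
  have hzero : Config.translate (S := S) 0 = id := funext Config.translate_zero
  simpa only [Nat.cast_one, one_smul, Nat.cast_zero, zero_smul, hzero, preimage_id] using hle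

theorem map_translate_eq_of_midpoint_le [IsProbabilityMeasure μ]
    (h : ∀ A : Set (Config S), IsLocal A → ∀ v : ℝ × ℝ,
      μ.real A ≤ (μ.real (Config.translate (-v) ⁻¹' A) + μ.real (Config.translate v ⁻¹' A)) / 2)
    (v : ℝ × ℝ) : μ.map (Config.translate v) = μ := by
  have heq : ∀ A : Set (Config S), IsLocal A → μ (Config.translate v ⁻¹' A) = μ A := by
    intro A hA
    have hback := measureReal_translate_preimage_le h (hA.translate v) (-v)
    simp only [← preimage_comp, Function.comp_def, Config.translate_translate, neg_add_cancel,
      Config.translate_zero] at hback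
    exact (measureReal_eq_measureReal_iff).1
      ((measureReal_translate_preimage_le h hA v).antisymm hback)
  have hmeas := Config.measurable_translate (S := S) v
  have : IsProbabilityMeasure (μ.map (Config.translate v)) :=
    Measure.isProbabilityMeasure_map hmeas.aemeasurable
  refine ext_of_generate_finite _ generateFrom_isLocal isPiSystem_isLocal (fun A hA => ?_)
    (by simp only [measure_univ])
  rw [Measure.map_apply hmeas (IsLocal.measurableSet hA), heq A hA]

variable {U : Particle S → Particle S → ℝ≥0∞} {z : ℝ}

theorem IsGibbsMeasure.integrable_gibbsKernel (hμ : IsGibbsMeasure U z μ) {Λ : Set (ℝ × ℝ)}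
    (hΛ : MeasurableSet Λ) (hb : Bornology.IsBounded Λ) {A : Set (Config S)}
    (hA : MeasurableSet A) : Integrable (fun Ybar => (gibbsKernel U z Λ Ybar A).toReal) μ :=
  integrable_condExp.congr (hμ.2 Λ hΛ hb A hA)

theorem IsGibbsMeasure.integral_gibbsKernel (hμ : IsGibbsMeasure U z μ) {Λ : Set (ℝ × ℝ)}
    (hΛ : MeasurableSet Λ) (hb : Bornology.IsBounded Λ) {A : Set (Config S)}
    (hA : MeasurableSet A) : ∫ Ybar, (gibbsKernel U z Λ Ybar A).toReal ∂μ = μ.real A := by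
  have := hμ.1
  rw [← integral_congr_ae (hμ.2 Λ hΛ hb A hA), integral_condExp (eventsIn_le hΛ.compl),
    integral_indicator_const _ hA, smul_eq_mul, mul_one]

theorem IsGibbsMeasure.measureReal_le_of_gibbsKernel_le (hμ : IsGibbsMeasure U z μ)
    {Λ : Set (ℝ × ℝ)} (hΛ : MeasurableSet Λ) (hb : Bornology.IsBounded Λ)
    {A A₁ A₂ : Set (Config S)} (hA : MeasurableSet A) (hA₁ : MeasurableSet A₁)
    (hA₂ : MeasurableSet A₂) {ε : ℝ} (hε : 0 ≤ ε)
    (h : ∀ Ybar, gibbsKernel U z Λ Ybar A ≤ 2⁻¹ * gibbsKernel U z Λ Ybar A₁ +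
      2⁻¹ * gibbsKernel U z Λ Ybar A₂ + ENNReal.ofReal ε) :
    μ.real A ≤ (μ.real A₁ + μ.real A₂) / 2 + ε := by
  have := hμ.1
  have hfin : ∀ Ybar A, gibbsKernel U z Λ Ybar A ≠ ⊤ := fun Ybar A =>
    ne_top_of_le_ne_top ENNReal.one_ne_top (gibbsKernel_le_one U z Λ Ybar A)
  have hreal : ∀ Ybar, (gibbsKernel U z Λ Ybar A).toReal ≤
      ((gibbsKernel U z Λ Ybar A₁).toReal + (gibbsKernel U z Λ Ybar A₂).toReal) / 2 + ε := by
    intro Ybar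
    have hhalf : ∀ A, 2⁻¹ * gibbsKernel U z Λ Ybar A ≠ ⊤ := fun A =>
      ENNReal.mul_ne_top (ENNReal.inv_ne_top.2 two_ne_zero) (hfin Ybar A)
    have hsum := ENNReal.add_ne_top.2 ⟨hhalf A₁, hhalf A₂⟩
    have hle := ENNReal.toReal_mono (ENNReal.add_ne_top.2 ⟨hsum, ENNReal.ofReal_ne_top⟩) (h Ybar)
    rw [ENNReal.toReal_add hsum ENNReal.ofReal_ne_top, ENNReal.toReal_add (hhalf _) (hhalf _),
      ENNReal.toReal_mul, ENNReal.toReal_mul, ENNReal.toReal_ofReal hε, ENNReal.toReal_inv,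
      ENNReal.toReal_ofNat] at hle
    linarith
  have hint₁ := hμ.integrable_gibbsKernel hΛ hb hA₁
  have hint₂ := hμ.integrable_gibbsKernel hΛ hb hA₂
  have hint : Integrable (fun Ybar => ((gibbsKernel U z Λ Ybar A₁).toReal +
      (gibbsKernel U z Λ Ybar A₂).toReal) / 2) μ := (hint₁.add hint₂).div_const 2
  have hle := integral_mono (hμ.integrable_gibbsKernel hΛ hb hA) (hint.add (integrable_const ε))
    hreal
  rwa [integral_add' hint (integrable_const ε), integral_div, integral_add hint₁ hint₂,
    hμ.integral_gibbsKernel hΛ hb hA, hμ.integral_gibbsKernel hΛ hb hA₁,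
    hμ.integral_gibbsKernel hΛ hb hA₂, integral_const, probReal_univ, one_smul] at hle

variable [Finite S] [Nonempty S] [MeasurableSingletonClass S]

theorem IsGibbsMeasure.measureReal_le (hμ : IsGibbsMeasure U z μ) (D : SoftSplit S)
    (hU : Measurable (Function.uncurry U)) (hsymm : ∀ a b, U a b = U b a)
    (hD : D.full = fun a b => boltzmann (U a b)) {r : ℝ} (hr : 0 ≤ r)
    (hrange : ∀ y y' : Particle S, r ≤ ‖y.1 - y'.1‖ → U y y' = 0)
    (hz : ENNReal.ofReal z * D.eps ≤ 2⁻¹) {A : Set (Config S)} (hA : IsLocal A) (v : ℝ × ℝ) :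
    μ.real A ≤
      (μ.real (Config.translate (-v) ⁻¹' A) + μ.real (Config.translate v ⁻¹' A)) / 2 := by
  obtain ⟨m, hm⟩ := id hA
  refine le_of_forall_pos_le_add fun ε hε => ?_
  obtain ⟨Λ, hΛ, hb, hle⟩ := exists_gibbsKernel_le D hU hsymm hD hr hrange hz v
    (Nat.cast_nonneg m) (ENNReal.ofReal_pos.2 hε).ne'
  exact hμ.measureReal_le_of_gibbsKernel_le hΛ hb hA.measurableSet
    (hA.translate (-v)).measurableSet (hA.translate v).measurableSet hε.le (hle A hm)

end TranslationInvariance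

section Seminorm

variable {E : Type*} [NormedAddCommGroup E] [NormedSpace ℝ E] [FiniteDimensional ℝ E]
  (h : Seminorm ℝ E)

theorem continuous_seminorm : Continuous h :=
  continuousOn_univ.1 (h.convexOn.continuousOn isOpen_univ)

theorem exists_mul_norm_le_seminorm (hnorm : ∀ x, h x = 0 → x = 0) :
    ∃ c > 0, ∀ x, c * ‖x‖ ≤ h x := by
  rcases subsingleton_or_nontrivial E with _ | _
  · exact ⟨1, one_pos, fun x => by simp [Subsingleton.elim x 0]⟩
  obtain ⟨x₀, hx₀, hmin⟩ := (isCompact_sphere (0 : E) 1).exists_isMinOn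
    (NormedSpace.sphere_nonempty.2 zero_le_one) (continuous_seminorm h).continuousOn
  have hx₀ne : x₀ ≠ 0 := ne_zero_of_mem_unit_sphere ⟨x₀, hx₀⟩
  refine ⟨h x₀, (apply_nonneg h _).lt_of_ne' (mt (hnorm x₀) hx₀ne), fun x => ?_⟩
  rcases eq_or_ne x 0 with rfl | hx
  · simp
  have hle : h x₀ ≤ h (‖x‖⁻¹ • x) :=
    hmin (mem_sphere_zero_iff_norm.2 (norm_smul_inv_norm (𝕜 := ℝ) hx))
  rwa [map_smul_eq_mul, norm_inv, norm_norm, inv_mul_eq_div,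
    le_div_iff₀ (norm_pos_iff.2 hx)] at hle

theorem addHaar_seminorm_eq_one [MeasurableSpace E] [BorelSpace E] (μ : Measure E)
    [μ.IsAddHaarMeasure] : μ {x | h x = 1} = 0 := by
  have hnhds : h.ball 0 1 ∈ 𝓝 0 := h.ball_mem_nhds (continuous_seminorm h) one_pos
  have hfrontier : {x | h x = 1} = frontier (h.ball 0 1) := by
    ext x
    rw [← gauge_eq_one_iff_mem_frontier (h.convex_ball 0 1) hnhds, h.gauge_ball]
    rfl
  rw [hfrontier]
  exact (h.convex_ball 0 1).addHaar_frontier μ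

theorem addHaar_seminorm_eq [MeasurableSpace E] [BorelSpace E] (μ : Measure E)
    [μ.IsAddHaarMeasure] {ρ : ℝ≥0} (hρ : ρ ≠ 0) : μ {x | h x = ρ} = 0 := by
  have hscale : {x | h x = ρ} = {x | (ρ⁻¹ • h) x = 1} := by
    ext x
    change h x = ρ ↔ (ρ : ℝ)⁻¹ * h x = 1
    rw [inv_mul_eq_one₀ (NNReal.coe_ne_zero.2 hρ), eq_comm]
  rw [hscale]
  exact addHaar_seminorm_eq_one _ μ

end Seminorm

section Potts

/-- A seminorm as a map to the nonnegative reals, the domain of the radial profiles. -/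
def nnSeminorm {E : Type*} [AddCommGroup E] [Module ℝ E] (h : Seminorm ℝ E) (x : E) : ℝ≥0 :=
  ⟨h x, apply_nonneg h x⟩

theorem nnSeminorm_neg {E : Type*} [AddCommGroup E] [Module ℝ E] (h : Seminorm ℝ E) (x : E) :
    nnSeminorm h (-x) = nnSeminorm h x :=
  Subtype.ext (map_neg_eq_map h x)

theorem WellBehaved.exists_finite_continuousAt {φ : ℝ≥0 → ℝ≥0∞} (hφ : WellBehaved φ) :
    ∃ s : Set ℝ≥0, s.Finite ∧ ∀ t ∉ s, ContinuousAt φ t := by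
  obtain ⟨n, r, -, htop, hzero, hcont, -⟩ := hφ
  refine ⟨range r, finite_range r, fun t ht => ?_⟩
  have hne : ∀ i, r i ≠ t := fun i hi => ht ⟨i, hi⟩
  rcases lt_or_ge t (r 0) with hlt | hge
  · exact continuousAt_const.congr ((eventually_lt_nhds hlt).mono fun u hu => (htop u hu).symm)
  rcases lt_or_ge (r (Fin.last n)) t with hgt | hle
  · exact continuousAt_const.congr ((eventually_gt_nhds hgt).mono fun u hu => (hzero u hu).symm)
  obtain ⟨i, hi₁, hi₂⟩ : ∃ i : Fin n, r i.castSucc < t ∧ t < r i.succ := by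
    by_contra! hstep
    have hbelow : ∀ i : Fin (n + 1), r i < t := fun i => by
      induction i using Fin.induction with
      | zero => exact hge.lt_of_ne (hne 0)
      | succ i ih => exact (hstep i ih).lt_of_ne (hne _)
    exact (hbelow (Fin.last n)).not_ge hle
  exact (hcont i).continuousAt (Ioo_mem_nhds hi₁ hi₂)

theorem WellBehaved.exists_eq_zero {φ : ℝ≥0 → ℝ≥0∞} (hφ : WellBehaved φ) :
    ∃ ρ : ℝ≥0, ∀ t, ρ < t → φ t = 0 := by
  obtain ⟨n, r, -, -, hzero, -⟩ := hφ
  exact ⟨r (Fin.last n), hzero⟩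

variable {E : Type*} [NormedAddCommGroup E] [NormedSpace ℝ E] [FiniteDimensional ℝ E]
  {h : Seminorm ℝ E}

theorem continuous_nnSeminorm : Continuous (nnSeminorm h) :=
  (continuous_seminorm h).subtype_mk _

theorem WellBehaved.ae_continuousAt_comp_nnSeminorm [Nontrivial E] [MeasurableSpace E]
    [BorelSpace E] {μ : Measure E} [μ.IsAddHaarMeasure] (hnorm : ∀ x, h x = 0 → x = 0)
    {φ : ℝ≥0 → ℝ≥0∞} (hφ : WellBehaved φ) :
    ∀ᵐ x ∂μ, ContinuousAt (fun x => φ (nnSeminorm h x)) x := by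
  obtain ⟨s, hs, hcont⟩ := hφ.exists_finite_continuousAt
  have hne : ∀ t, ∀ᵐ x ∂μ, nnSeminorm h x ≠ t := fun t => by
    rcases eq_or_ne t 0 with rfl | ht
    · filter_upwards [Measure.ae_ne μ 0] with x hx
      exact fun hx₀ => hx (hnorm x (congrArg NNReal.toReal hx₀))
    · exact measure_mono_null (fun x hx => congrArg NNReal.toReal (not_not.1 hx))
        (addHaar_seminorm_eq h μ ht)
  filter_upwards [(ae_ball_iff hs.countable).2 fun t _ => hne t] with x hx
  exact (hcont _ fun hmem => hx _ hmem rfl).comp continuous_nnSeminorm.continuousAt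

theorem exists_forall_norm_ge_eq_zero {ι : Type*} [Finite ι] (hnorm : ∀ x, h x = 0 → x = 0)
    {φ : ι → ℝ≥0 → ℝ≥0∞} (hφ : ∀ i, WellBehaved (φ i)) :
    ∃ r : ℝ, ∀ i x, r ≤ ‖x‖ → φ i (nnSeminorm h x) = 0 := by
  obtain ⟨c, hc, hch⟩ := exists_mul_norm_le_seminorm h hnorm
  choose ρ hρ using fun i => (hφ i).exists_eq_zero
  obtain ⟨K, hK⟩ := (finite_range ρ).bddAbove
  refine ⟨(K + 1) / c, fun i x hx => hρ i _ ((hK ⟨i, rfl⟩).trans_lt ?_)⟩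
  rw [div_le_iff₀' hc] at hx
  exact NNReal.coe_lt_coe.1 ((lt_add_one (K : ℝ)).trans_le (hx.trans (hch x)))

end Potts

/-- The translation invariant pair potential that is given by the functions `ψ σ σ'` of the
difference of the positions of two particles with spins `σ` and `σ'`. -/
def pairPotential {S : Type*} (ψ : S → S → ℝ × ℝ → ℝ≥0∞) (y y' : Particle S) : ℝ≥0∞ :=
  ψ y.2 y'.2 (y.1 - y'.1)

end GibbsParticles

end

open GibbsParticles in
theorem theorem1_general {S : Type*} [Finite S] [Nonempty S] [MeasurableSpace S]
    [MeasurableSingletonClass S] {z : ℝ} (hz : 0 < z) {ψ : S → S → ℝ × ℝ → ℝ≥0∞}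
    (hmeas : ∀ σ σ', Measurable (ψ σ σ')) (hsymm : ∀ σ σ' x, ψ σ σ' (-x) = ψ σ' σ x)
    (hcont : ∀ σ σ', ∀ᵐ x, ContinuousAt (ψ σ σ') x) {r : ℝ}
    (hfar : ∀ σ σ' x, r ≤ ‖x‖ → ψ σ σ' x = 0) {μ : Measure (Config S)}
    (hμ : IsGibbsMeasure (pairPotential ψ) z μ) (v : ℝ × ℝ) :
    μ.map (Config.translate v) = μ := by
  have hfar' : ∀ σ σ' x, max r 1 ≤ ‖x‖ → ψ σ σ' x = 0 := fun σ σ' x hx =>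
    hfar σ σ' x ((le_max_left r 1).trans hx)
  have hr : 0 < max r 1 := lt_max_of_lt_right one_pos
  obtain ⟨D, hDeps, hDe⟩ := exists_softSplit hmeas hsymm hcont hr hfar'
    (ε := 2⁻¹ * (ENNReal.ofReal z)⁻¹) (by simp)
  have hzD : ENNReal.ofReal z * D.eps ≤ 2⁻¹ := by
    rw [hDeps, mul_left_comm, ENNReal.mul_inv_cancel (ENNReal.ofReal_pos.2 hz).ne'
      ENNReal.ofReal_ne_top, mul_one]
  have := hμ.1
  exact map_translate_eq_of_midpoint_le (fun A hA v => hμ.measureReal_le D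
    (measurable_apply_sub hmeas) (fun a b => by rw [pairPotential, ← hsymm, neg_sub, pairPotential])
    (funext₂ fun _ _ => hDe _ _ _) hr.le (fun y y' => hfar' _ _ _) hzD hA v) v

theorem theorem1 {S : Type*} [Fintype S] [Nonempty S] [MeasurableSpace S]
    [MeasurableSingletonClass S] (z : ℝ) (hz : 0 < z)
    (h : Seminorm ℝ (ℝ × ℝ)) (hnorm : ∀ x, h x = 0 → x = 0)
    (φ : S → S → ℝ≥0 → ℝ≥0∞) (hmeas : ∀ σ₁ σ₂, Measurable (φ σ₁ σ₂))
    (hsymm : ∀ σ₁ σ₂, φ σ₁ σ₂ = φ σ₂ σ₁)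
    (hwell : ∀ σ₁ σ₂, GibbsParticles.WellBehaved (φ σ₁ σ₂))
    (μ : Measure (GibbsParticles.Config S))
    (hμ : GibbsParticles.IsGibbsMeasure (GibbsParticles.pottsPotential h φ) z μ) :
    ∀ v : ℝ × ℝ, μ.map (GibbsParticles.Config.translate v) = μ := by
  open GibbsParticles in
  obtain ⟨r, hr⟩ := exists_forall_norm_ge_eq_zero hnorm fun p : S × S => hwell p.1 p.2
  exact theorem1_general hz (fun σ₁ σ₂ => (hmeas σ₁ σ₂).comp continuous_nnSeminorm.measurable)
    (fun σ₁ σ₂ x => by simp only [Function.comp_apply, nnSeminorm_neg, hsymm σ₁ σ₂])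
    (fun σ₁ σ₂ => (hwell σ₁ σ₂).ae_continuousAt_comp_nnSeminorm hnorm)
    (fun σ₁ σ₂ => hr (σ₁, σ₂)) hμ
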